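/- Let $d\ge 1$, $\nu>0$, $\alpha>0$, and let $\mathrm P$ be the law of a homogeneous Poisson point process $\eta$ in $\mathbb R^d$ with intensity $\nu$. Let $P$ be a probability law on $(0,\infty)$ whose tail is regularly varying: $P(W>w)=w^{-(\tau-1)}L(w)$ for $w>0$, with $L$ slowly varying at $+\infty$. Given $\eta$, assign to the points $x\in\eta$ i.i.d. weights $W_x$ with law $P$; given the weights, join each pair of distinct points $x,y\in\eta$ by an undirected edge, independently for different pairs, with probability $$1-\exp\Big(-\frac{W_xW_y}{\|x-y\|^{\alpha}}\Big).$$ Let $P^\eta$ denote the law of the resulting random graph $G$ on the vertex set $\eta$. For a vertex $x$ let $D_x$ be its degree, $\Delta_x$ the number of triangles of $G$ having $x$ as a vertex, and $$\mathrm{CC}(x)=\frac{2\Delta_x}{D_x(D_x-1)},$$ with $\mathrm{CC}(x)=0$ if $D_x\in\{0,1\}$ (and, by convention, if $D_x=\infty$). For $n\in\mathbb N$ let $B_n$ be the box $[-n/2,n/2]^d$ and $$\mathrm{CC}_n=\frac1{|\eta\cap B_n|}\sum_{x\in\eta\cap B_n}\mathrm{CC}(x),$$ where $\mathrm{CC}(x)$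 is computed in the whole graph $G$. Finally, let $\mathbb E_0[\mathrm{CC}(0)]=\int E^{\eta\cup\{0\}}[\mathrm{CC}(0)]\,\mathrm P(d\eta)$ be the expectation of the local clustering coefficient of the origin under the Palm law $\mathbb P_0=\mathrm P\times P^{\eta\cup\{0\}}$. **Theorem.** Suppose that $\alpha>d$ and $\gamma:=\alpha(\tau-1)/d>1$. Then for $\mathrm P$-almost every $\eta$, $P^\eta$-almost surely, all degrees in $G$ are finite and the averaged clustering coefficient $\lim_{n\to\infty}\mathrm{CC}_n$ exists. It does not depend on $\eta$ and is given by $$\lim_{n\to\infty}\mathrm{CC}_n=\mathbb E_0[\mathrm{CC}(0)]>0.$$ -/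

import Mathlib

open MeasureTheory ProbabilityTheory Filter Topology Set

/-- `L` is slowly varying at `+∞`. -/
def IsSlowlyVarying (L : ℝ → ℝ) : Prop :=
  (∀ᶠ x in atTop, 0 < L x) ∧
    ∀ c : ℝ, 0 < c → Tendsto (fun x => L (c * x) / L x) atTop (𝓝 1)

/-- The law `μ` of the weights has a tail `μ(W > w) = w ^ (-(τ - 1)) * L w`, `w > 0`, with `L`
slowly varying at `+∞`. -/
def HasRegularlyVaryingTail (μ : Measure ℝ) (τ : ℝ) : Prop :=
  ∃ L : ℝ → ℝ, IsSlowlyVarying L ∧ ∀ w : ℝ, 0 < w → μ.real (Ioi w) = w ^ (-(τ - 1)) * L w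

/-- The Euclidean space `ℝ^d`. -/
abbrev Space (d : ℕ) : Type := EuclideanSpace ℝ (Fin d)

/-- Point configurations in `ℝ^d`, listed as sequences: the points of `η` are `η 0, η 1, …`. -/
abbrev Config (d : ℕ) : Type := ℕ → Space d

/-- The number of points of the configuration `η` in `A`, counted with multiplicity. -/
noncomputable def pointCount {d : ℕ} (A : Set (Space d)) (η : Config d) : ℕ∞ :=
  {i : ℕ | η i ∈ A}.encard

/-- `P` is the law of (an enumeration of) a homogeneous Poisson point process in `ℝ^d` with
intensity `ν`: the number of points in a set of finite volume is Poisson with parameter `ν` times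
the volume, and the numbers of points in disjoint sets are independent. As the points are
counted with multiplicity, almost surely they are pairwise distinct. -/
structure IsPoissonPointProcess {d : ℕ} (ν : ℝ) (P : Measure (Config d)) : Prop where
  isProbabilityMeasure : IsProbabilityMeasure P
  poisson : ∀ A : Set (Space d), MeasurableSet A → volume A ≠ ⊤ → ∀ k : ℕ,
    P {η | pointCount A η = k} = poissonMeasure (ν * volume.real A).toNNReal {k}
  indep : ∀ (n : ℕ) (A : Fin n → Set (Space d)), (∀ i, MeasurableSet (A i)) →
    Pairwise (fun i j => Disjoint (A i) (A j)) → iIndepFun (fun i => pointCount (A i)) P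

/-- The probability that two vertices at `x` and `y` with weights `w` and `w'` are linked. -/
noncomputable def linkProb {d : ℕ} (α : ℝ) (x y : Space d) (w w' : ℝ) : ℝ :=
  1 - Real.exp (-(w * w' / ‖x - y‖ ^ α))

/-- The graph on the points of `η` (the vertex `i` stands for the point `η i`) with weights `w`,
in which the edge `{i, j}` is present when the number `u s(i, j)` is below its probability. -/
noncomputable def spatialGraph {d : ℕ} (α : ℝ) (η : Config d)
    (ω : (ℕ → ℝ) × (Sym2 ℕ → unitInterval)) : SimpleGraph ℕ where
  Adj i j := i ≠ j ∧ (ω.2 s(i, j) : ℝ) < linkProb α (η i) (η j) (ω.1 i) (ω.1 j)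
  symm := ⟨fun i j h => by
    refine ⟨h.1.symm, ?_⟩
    have h2 := h.2
    rw [linkProb] at h2 ⊢
    rwa [Sym2.eq_swap, norm_sub_rev, mul_comm (ω.1 j)]⟩
  loopless := ⟨fun i h => h.1 rfl⟩

/-- The joint law of i.i.d. weights with law `μ` at the vertices and, independent of them, i.i.d.
uniform variables on the pairs of vertices. -/
noncomputable def markLaw (μ : Measure ℝ) [IsProbabilityMeasure μ] :
    Measure ((ℕ → ℝ) × (Sym2 ℕ → unitInterval)) :=
  (Measure.infinitePi fun _ : ℕ => μ).prod
    (Measure.infinitePi fun _ : Sym2 ℕ => (volume : Measure unitInterval))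

/-- The quenched law `P^η`: the law of the random graph on the fixed configuration `η`, with
i.i.d. weights of law `μ` and, given the weights, independent edges. The σ-algebra on the graphs is
generated by the presence of the single edges. -/
noncomputable def quenchedLaw {d : ℕ} (α : ℝ) (μ : Measure ℝ) [IsProbabilityMeasure μ]
    (η : Config d) : Measure (SimpleGraph ℕ) :=
  (markLaw μ).map (spatialGraph α η)

theorem measurable_spatialGraph {d : ℕ} (α : ℝ) (η : Config d) :
    Measurable (spatialGraph α η) := by
  refine measurable_comap_iff.2 (measurable_pi_iff.2 fun i => measurable_pi_iff.2 fun j => ?_)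
  refine measurableSet_setOfPred.1 ?_
  change MeasurableSet ({ω : (ℕ → ℝ) × (Sym2 ℕ → unitInterval) | i ≠ j} ∩
    {ω | (ω.2 s(i, j) : ℝ) < linkProb α (η i) (η j) (ω.1 i) (ω.1 j)})
  refine (MeasurableSet.const _).inter (measurableSet_lt ?_ ?_)
  · fun_prop
  · unfold linkProb
    fun_prop

instance instIsProbabilityMeasureQuenchedLaw {d : ℕ} (α : ℝ) (μ : Measure ℝ)
    [IsProbabilityMeasure μ] (η : Config d) : IsProbabilityMeasure (quenchedLaw α μ η) := by
  have : IsProbabilityMeasure (markLaw μ) := by unfold markLaw; infer_instance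
  exact Measure.isProbabilityMeasure_map (measurable_spatialGraph α η).aemeasurable

/-- The degree of `x` (`0` if `x` has infinitely many neighbours). -/
noncomputable def vertexDegree (G : SimpleGraph ℕ) (x : ℕ) : ℕ := (G.neighborSet x).ncard

/-- The number of triangles of `G` that have `x` as one of their vertices. -/
noncomputable def triangleCount (G : SimpleGraph ℕ) (x : ℕ) : ℕ :=
  {s : Finset ℕ | G.IsNClique 3 s ∧ x ∈ s}.ncard

/-- The local clustering coefficient `2 Δ_x / (D_x (D_x - 1))`; it is `0` if the degree `D_x` is
`0` or `1`, as the denominator vanishes then (and if `D_x` is infinite). -/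
noncomputable def localCC (G : SimpleGraph ℕ) (x : ℕ) : ℝ :=
  2 * (triangleCount G x : ℝ) / ((vertexDegree G x : ℝ) * ((vertexDegree G x : ℝ) - 1))

/-- The box of side-length `n` centred at the origin. -/
def box (d : ℕ) (n : ℝ) : Set (Space d) := {x | ∀ i, |x i| ≤ n / 2}

/-- The vertices of `η` in the box of side-length `n`. -/
def boxVertices {d : ℕ} (η : Config d) (n : ℝ) : Set ℕ := {i | η i ∈ box d n}

/-- The average of the local clustering coefficients of the vertices in the box of side-length
`n`; the local coefficients take all edges of `G` into account. -/
noncomputable def averagedCC {d : ℕ} (η : Config d) (G : SimpleGraph ℕ) (n : ℝ) : ℝ :=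
  (∑ᶠ i ∈ boxVertices η n, localCC G i) / ((boxVertices η n).ncard : ℝ)

/-- The configuration `η ∪ {0}`; the added origin is the vertex `0`. -/
def addOrigin {d : ℕ} (η : Config d) : Config d
  | 0 => 0
  | i + 1 => η i

/-- The expectation of the local clustering coefficient at the origin under the Palm law
`P × P^(η ∪ {0})`. -/
noncomputable def palmCC {d : ℕ} (α : ℝ) (μ : Measure ℝ) [IsProbabilityMeasure μ]
    (P : Measure (Config d)) : ℝ :=
  ∫ η, ∫ G, localCC G 0 ∂(quenchedLaw α μ (addOrigin η)) ∂P

/-!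
# Convergence of the averaged clustering coefficient

The average over the box of side-length `n` is the quotient of two sums over the points of the box:
that of the local clustering coefficients, and that of the constant `1`. Both are sums of a *local
score* (`IsLocalScore`) of the vertices, with values in `[0, 1]`, and both obey a law of large
numbers (`ae_tendsto_sum_sumScore`): divided by `n ^ d` they tend to `ν` times the expected score
of the origin under the Palm law. The quotient therefore tends to the Palm expectation of the
local clustering coefficient.

For the law of large numbers, space is cut into unit cells. The sum `Y` of the scores in a cell has
the right mean by the Mecke formula and translation invariance (`lintegral_sumScore_univ`). It is
approximated by the sum `Z R` in which the scores are computed in the graph on a window of size `R`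
around the cell. The two differ only if an edge leaves the window, and the expected number of such
edges is at most a power of `R` with negative exponent (`exists_lintegral_longEdges_le`): as
`1 - exp (-t) ≤ t ^ s`, an edge of length `r` has probability at most `E[W ^ s] ^ 2 * r ^ (-α s)`,
and the assumptions `α > d` and `α (τ - 1) / d > 1` leave room for an exponent `s ≤ 1` with
`d / α < s < τ - 1`. The variables `Z R` have bounded variances, as they are at most the number of
points in the cell, and for disjoint windows they are uncorrelated, because then they are functions
of independent parts of the Poisson process and of disjoint sets of marks
(`covariance_sumScore`). Along a polynomially growing sequence of boxes the normalized variances and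
approximation errors are summable, and together with monotonicity between these boxes this gives
almost sure convergence (`strong_law_latticeBox`).

A Poisson process is given here by an enumeration of its points, of which only the laws of the
counts are known. Functionals that do not depend on the enumeration are functions of the counts: a
locally finite configuration can be sorted by an injective real-valued key, and the sorted
sequence is determined by the numbers of points with key at most `q`, for rational `q`
(`exists_perm_reconstruct`). The Mecke formula, the uniqueness in law and the independence in
disjoint regions are proved for the counts and transferred in this way
(`lintegral_tsum_removePoint`, `lintegral_symmetric_unique`, `lintegral_mul_of_disjoint`).

The degrees are finite because the expected number of edges from a cell to the outside of its window
is finite. The limit is positive since, under the Palm law, the origin and two points of the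
process span a triangle with positive probability, while the degree of the origin is finite.
-/


open scoped ENNReal NNReal

namespace SpatialClustering

section

/-! ### Moments of the weights and integrability of the connection probabilities -/

theorem one_sub_exp_neg_le_rpow {t s : ℝ} (ht : 0 ≤ t) (hs : 0 < s) (hs1 : s ≤ 1) :
    1 - Real.exp (-t) ≤ t ^ s := by
  rcases le_or_gt t 1 with h | h
  · rcases ht.eq_or_lt with rfl | h0
    · simp [Real.zero_rpow hs.ne']
    · calc 1 - Real.exp (-t) ≤ t := by linarith [Real.add_one_le_exp (-t)]
        _ = t ^ (1 : ℝ) := (Real.rpow_one t).symm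
        _ ≤ t ^ s := Real.rpow_le_rpow_of_exponent_ge h0 h hs1
  · calc 1 - Real.exp (-t) ≤ 1 := by linarith [Real.exp_pos (-t)]
      _ ≤ t ^ s := Real.one_le_rpow h.le hs.le

/-- Along powers of `2`, a regularly varying tail decays at any rate below its exponent: only the
defining limit of the slowly varying factor at the scale `2` is needed. -/
theorem exists_tail_two_pow_le {μ : Measure ℝ} [IsProbabilityMeasure μ] {τ q : ℝ}
    (hτ : HasRegularlyVaryingTail μ τ) (hq : q < τ - 1) :
    ∃ x₀ : ℝ, 0 < x₀ ∧ ∀ k : ℕ, μ.real (Ioi (2 ^ k * x₀)) ≤ ((2 : ℝ) ^ (-q)) ^ k := by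
  obtain ⟨L, ⟨hLpos, hL⟩, htail⟩ := hτ
  have h2 : (2 : ℝ) ^ (-(τ - 1)) < 2 ^ (-q) :=
    Real.rpow_lt_rpow_of_exponent_lt one_lt_two (by linarith)
  have hlim : Tendsto (fun x => (2 : ℝ) ^ (-(τ - 1)) * (L (2 * x) / L x)) atTop
      (𝓝 (2 ^ (-(τ - 1)) * 1)) := (hL 2 two_pos).const_mul _
  rw [mul_one] at hlim
  obtain ⟨x₀, hx₀⟩ := eventually_atTop.1
    ((hlim.eventually (gt_mem_nhds h2)).and (hLpos.and (eventually_gt_atTop 0)))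
  have hstep : ∀ x, x₀ ≤ x → μ.real (Ioi (2 * x)) ≤ 2 ^ (-q) * μ.real (Ioi x) := by
    intro x hx
    obtain ⟨h1, hLx, hx0⟩ := hx₀ x hx
    rw [htail x hx0, htail (2 * x) (by positivity), Real.mul_rpow two_pos.le hx0.le]
    have hxr : 0 < x ^ (-(τ - 1)) := Real.rpow_pos_of_pos hx0 _
    have : L (2 * x) = L (2 * x) / L x * L x := by field_simp
    rw [this]
    calc (2 : ℝ) ^ (-(τ - 1)) * x ^ (-(τ - 1)) * (L (2 * x) / L x * L x)
        = (2 ^ (-(τ - 1)) * (L (2 * x) / L x)) * (x ^ (-(τ - 1)) * L x) := by ring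
      _ ≤ _ := mul_le_mul_of_nonneg_right h1.le (by positivity)
  have hpos : 0 < x₀ := (hx₀ x₀ le_rfl).2.2
  refine ⟨x₀, hpos, fun k => ?_⟩
  induction k with
  | zero => simp
  | succ k ih =>
    have h1 : x₀ ≤ 2 ^ k * x₀ := le_mul_of_one_le_left hpos.le (one_le_pow₀ one_le_two)
    calc μ.real (Ioi (2 ^ (k + 1) * x₀)) = μ.real (Ioi (2 * (2 ^ k * x₀))) := by ring_nf
      _ ≤ 2 ^ (-q) * μ.real (Ioi (2 ^ k * x₀)) := hstep _ h1
      _ ≤ 2 ^ (-q) * (2 ^ (-q)) ^ k := by gcongr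
      _ = _ := by ring

/-- The weights have finite moments of every order below the tail exponent, by summing the tail over
dyadic scales. -/
theorem lintegral_rpow_lt_top_of_tail {μ : Measure ℝ} [IsProbabilityMeasure μ] {τ s : ℝ}
    (hτ : HasRegularlyVaryingTail μ τ) (hs0 : 0 < s) (hs : s < τ - 1) :
    ∫⁻ w, ENNReal.ofReal w ^ s ∂μ < ∞ := by
  -- The tail decays with the rate `q`, so the dyadic scales contribute a geometric series of ratio
  -- `2 ^ (s - q)`.
  obtain ⟨q, hsq, hq⟩ := exists_between hs
  obtain ⟨x₀, hx₀, htail⟩ := exists_tail_two_pow_le hτ hq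
  have hbound : ∀ w : ℝ, ENNReal.ofReal w ^ s ≤ ENNReal.ofReal ((2 * x₀) ^ s) +
      ∑' k : ℕ, (Ioi (2 ^ k * x₀)).indicator
        (fun _ => ENNReal.ofReal ((2 ^ (k + 2) * x₀) ^ s)) w := by
    intro w
    rcases le_or_gt w (2 * x₀) with h | h
    · refine le_add_right ?_
      rw [← ENNReal.ofReal_rpow_of_nonneg (by positivity) hs0.le]
      gcongr
    · obtain ⟨n, hn1, hn2⟩ := exists_nat_pow_near (x := w / (2 * x₀)) (y := 2)
        ((one_le_div (by positivity)).2 h.le) one_lt_two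
      rw [le_div_iff₀ (by positivity)] at hn1
      rw [div_lt_iff₀ (by positivity)] at hn2
      have hmem : w ∈ Ioi (2 ^ n * x₀) := by
        have : 0 < 2 ^ n * x₀ := by positivity
        change 2 ^ n * x₀ < w
        linarith
      refine le_add_left (le_trans ?_ (ENNReal.le_tsum n))
      rw [indicator_of_mem hmem, ← ENNReal.ofReal_rpow_of_nonneg (by positivity) hs0.le]
      gcongr
      calc w ≤ 2 ^ (n + 1) * (2 * x₀) := hn2.le
        _ = _ := by ring
  have hr : (2 : ℝ) ^ (s - q) < 1 := Real.rpow_lt_one_of_one_lt_of_neg one_lt_two (by linarith)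
  have hterm : ∀ k : ℕ, ∫⁻ w, (Ioi (2 ^ k * x₀)).indicator
        (fun _ => ENNReal.ofReal ((2 ^ (k + 2) * x₀) ^ s)) w ∂μ ≤
      ENNReal.ofReal ((4 * x₀) ^ s * (2 ^ (s - q)) ^ k) := by
    intro k
    rw [lintegral_indicator_const measurableSet_Ioi, ← ofReal_measureReal,
      ← ENNReal.ofReal_mul (by positivity)]
    refine ENNReal.ofReal_le_ofReal ?_
    calc ((2 : ℝ) ^ (k + 2) * x₀) ^ s * μ.real (Ioi (2 ^ k * x₀))
        ≤ ((2 : ℝ) ^ (k + 2) * x₀) ^ s * (2 ^ (-q)) ^ k := by gcongr; exact htail k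
      _ = (4 * x₀) ^ s * (2 ^ (s - q)) ^ k := by
        have : (2 : ℝ) ^ (k + 2) * x₀ = 2 ^ k * (4 * x₀) := by ring
        rw [this, Real.mul_rpow (by positivity) (by positivity), sub_eq_add_neg,
          Real.rpow_add two_pos, mul_pow, ← Real.rpow_natCast, ← Real.rpow_natCast (2 ^ s),
          ← Real.rpow_mul two_pos.le, ← Real.rpow_mul two_pos.le, mul_comm (k : ℝ) s]
        ring
  calc ∫⁻ w, ENNReal.ofReal w ^ s ∂μ
      ≤ ∫⁻ w, (ENNReal.ofReal ((2 * x₀) ^ s) + ∑' k : ℕ, (Ioi (2 ^ k * x₀)).indicator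
        (fun _ => ENNReal.ofReal ((2 ^ (k + 2) * x₀) ^ s)) w) ∂μ := lintegral_mono hbound
    _ = ENNReal.ofReal ((2 * x₀) ^ s) + ∑' k : ℕ, ∫⁻ w, (Ioi (2 ^ k * x₀)).indicator
        (fun _ => ENNReal.ofReal ((2 ^ (k + 2) * x₀) ^ s)) w ∂μ := by
      rw [lintegral_add_left measurable_const, lintegral_const, measure_univ, mul_one,
        lintegral_tsum fun k => (measurable_const.indicator measurableSet_Ioi).aemeasurable]
    _ ≤ ENNReal.ofReal ((2 * x₀) ^ s) +
        ∑' k : ℕ, ENNReal.ofReal ((4 * x₀) ^ s * (2 ^ (s - q)) ^ k) := by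
      gcongr with k
      exact hterm k
    _ < ∞ := by
      refine ENNReal.add_lt_top.2 ⟨ENNReal.ofReal_lt_top, ?_⟩
      refine Summable.tsum_ofReal_lt_top ?_
      exact (summable_geometric_of_lt_one (by positivity) hr).mul_left _

/-- The tail of the integral of `‖y‖ ^ (-b)`, `b > d`, decays like a power. -/
theorem exists_lintegral_norm_rpow_le {d : ℕ} {b : ℝ} (hb : (d : ℝ) < b) :
    ∃ ε : ℝ, 0 < ε ∧ ∃ C : ℝ, 0 ≤ C ∧ ∀ R : ℝ, 1 ≤ R →
      ∫⁻ y in {y : Space d | R ≤ ‖y‖}, ENNReal.ofReal (‖y‖ ^ (-b)) ≤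
        ENNReal.ofReal (C * R ^ (-ε)) := by
  -- Of the exponent `b`, the part `q > d` is kept for the integrability at infinity and the rest
  -- gives the rate in `R`.
  obtain ⟨q, hdq, hqb⟩ := exists_between hb
  have hfin : ∫⁻ y : Space d, ENNReal.ofReal ((1 + ‖y‖) ^ (-q)) < ∞ :=
    finite_integral_one_add_norm (by simpa using hdq)
  have hq0 : 0 < q := lt_of_le_of_lt (Nat.cast_nonneg d) hdq
  refine ⟨b - q, by linarith, 2 ^ q * (∫⁻ y : Space d, ENNReal.ofReal ((1 + ‖y‖) ^ (-q))).toReal,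
    by positivity, fun R hR => ?_⟩
  have hpt : ∀ y ∈ {y : Space d | R ≤ ‖y‖}, ENNReal.ofReal (‖y‖ ^ (-b)) ≤
      ENNReal.ofReal (2 ^ q * R ^ (-(b - q))) * ENNReal.ofReal ((1 + ‖y‖) ^ (-q)) := by
    intro y hy
    have hy1 : R ≤ ‖y‖ := hy
    have hy0 : 0 < ‖y‖ := by linarith
    rw [← ENNReal.ofReal_mul (by positivity)]
    refine ENNReal.ofReal_le_ofReal ?_
    have h1 : ‖y‖ ^ (-b) = ‖y‖ ^ (-(b - q)) * ‖y‖ ^ (-q) := by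
      rw [← Real.rpow_add hy0]; ring_nf
    have h2 : ‖y‖ ^ (-(b - q)) ≤ R ^ (-(b - q)) :=
      Real.rpow_le_rpow_of_nonpos (by linarith) hy1 (by linarith)
    have h3 : ‖y‖ ^ (-q) ≤ 2 ^ q * (1 + ‖y‖) ^ (-q) := by
      have h4 : (2 * ‖y‖) ^ (-q) ≤ (1 + ‖y‖) ^ (-q) :=
        Real.rpow_le_rpow_of_nonpos (by linarith) (by linarith) (by linarith)
      rw [Real.mul_rpow two_pos.le hy0.le] at h4
      calc ‖y‖ ^ (-q) = 2 ^ q * (2 ^ (-q) * ‖y‖ ^ (-q)) := by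
            rw [← mul_assoc, ← Real.rpow_add two_pos]; simp
        _ ≤ _ := by gcongr
    rw [h1]
    calc ‖y‖ ^ (-(b - q)) * ‖y‖ ^ (-q) ≤ R ^ (-(b - q)) * (2 ^ q * (1 + ‖y‖) ^ (-q)) := by gcongr
      _ = _ := by ring
  calc ∫⁻ y in {y : Space d | R ≤ ‖y‖}, ENNReal.ofReal (‖y‖ ^ (-b))
      ≤ ∫⁻ y in {y : Space d | R ≤ ‖y‖},
        ENNReal.ofReal (2 ^ q * R ^ (-(b - q))) * ENNReal.ofReal ((1 + ‖y‖) ^ (-q)) :=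
        setLIntegral_mono' (measurableSet_le measurable_const measurable_norm) hpt
    _ ≤ ∫⁻ y : Space d,
        ENNReal.ofReal (2 ^ q * R ^ (-(b - q))) * ENNReal.ofReal ((1 + ‖y‖) ^ (-q)) :=
        setLIntegral_le_lintegral _ _
    _ = ENNReal.ofReal (2 ^ q * R ^ (-(b - q))) *
        ∫⁻ y : Space d, ENNReal.ofReal ((1 + ‖y‖) ^ (-q)) := by
        rw [lintegral_const_mul' _ _ ENNReal.ofReal_ne_top]
    _ = _ := by
        nth_rewrite 1 [← ENNReal.ofReal_toReal hfin.ne]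
        rw [← ENNReal.ofReal_mul (by positivity)]
        ring_nf

end

section

/-! ### Local scores of vertices, in particular the local clustering coefficient -/

/-- The graph `G` with all edges deleted that have an endpoint outside of `A`. -/
def within (G : SimpleGraph ℕ) (A : Set ℕ) : SimpleGraph ℕ where
  Adj i j := G.Adj i j ∧ i ∈ A ∧ j ∈ A
  symm := ⟨fun _ _ h => ⟨h.1.symm, h.2.2, h.2.1⟩⟩
  loopless := ⟨fun _ h => h.1.ne rfl⟩

/-- A score in `[0, 1]` of the vertices of a graph that does not depend on the labels of the
vertices, and that at `i` depends only on the graph induced on `i` and its neighbours. The values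
are extended nonnegative reals, so that sums and expectations need no integrability. -/
structure IsLocalScore (ψ : SimpleGraph ℕ → ℕ → ℝ≥0∞) : Prop where
  measurable : ∀ i, Measurable fun G => ψ G i
  le_one : ∀ G i, ψ G i ≤ 1
  comap : ∀ (G : SimpleGraph ℕ) (σ : Equiv.Perm ℕ) (i : ℕ), ψ (G.comap σ) i = ψ G (σ i)
  within : ∀ (G : SimpleGraph ℕ) (A : Set ℕ) (i : ℕ), i ∈ A → G.neighborSet i ⊆ A →
    ψ (within G A) i = ψ G i

theorem isLocalScore_one : IsLocalScore fun _ _ => 1 :=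
  ⟨fun _ => measurable_const, fun _ _ => le_rfl, fun _ _ _ => rfl, fun _ _ _ _ _ => rfl⟩

theorem measurable_neighborSet (x : ℕ) :
    Measurable fun G : SimpleGraph ℕ => G.neighborSet x := by
  refine measurable_set_iff.2 fun y => ?_
  change Measurable fun G : SimpleGraph ℕ => G.Adj x y
  fun_prop

theorem measurable_vertexDegree (x : ℕ) : Measurable fun G => vertexDegree G x :=
  measurable_ncard.comp (measurable_neighborSet x)

theorem measurable_triangleCount (x : ℕ) : Measurable fun G => triangleCount G x := by
  refine measurable_ncard.comp (measurable_set_iff.2 fun s => ?_)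
  simp only [mem_ofPred_eq, SimpleGraph.isNClique_iff, SimpleGraph.IsClique, Set.Pairwise]
  fun_prop

theorem measurable_localCC (x : ℕ) : Measurable fun G => localCC G x := by
  have h1 := measurable_vertexDegree x
  have h2 := measurable_triangleCount x
  have h3 : Measurable fun G => (vertexDegree G x : ℝ) := Measurable.of_discrete.comp h1
  have h4 : Measurable fun G => (triangleCount G x : ℝ) := Measurable.of_discrete.comp h2
  unfold localCC
  fun_prop

theorem vertexDegree_comap (G : SimpleGraph ℕ) (σ : Equiv.Perm ℕ) (i : ℕ) :
    vertexDegree (G.comap σ) i = vertexDegree G (σ i) := by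
  have : G.neighborSet (σ i) = σ '' (G.comap σ).neighborSet i := by
    ext j
    refine ⟨fun h => ⟨σ.symm j, ?_, σ.apply_symm_apply j⟩, ?_⟩
    · simpa using h
    · rintro ⟨k, hk, rfl⟩
      exact hk
  rw [vertexDegree, vertexDegree, this, ncard_image_of_injective _ σ.injective]

theorem triangleCount_comap (G : SimpleGraph ℕ) (σ : Equiv.Perm ℕ) (i : ℕ) :
    triangleCount (G.comap σ) i = triangleCount G (σ i) := by
  have key : ∀ s : Finset ℕ, ((G.comap σ).IsNClique 3 s ∧ i ∈ s) ↔
      (G.IsNClique 3 (s.map σ.toEmbedding) ∧ σ i ∈ s.map σ.toEmbedding) := by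
    intro s
    simp only [SimpleGraph.isNClique_iff, SimpleGraph.IsClique, Finset.card_map,
      Finset.mem_map_equiv, Equiv.symm_apply_apply, Finset.coe_map, Equiv.coe_toEmbedding,
      σ.injective.injOn.pairwise_image]
    rfl
  have : {s : Finset ℕ | G.IsNClique 3 s ∧ σ i ∈ s} =
      Finset.map σ.toEmbedding '' {s | (G.comap σ).IsNClique 3 s ∧ i ∈ s} := by
    ext s
    constructor
    · intro h
      have hs : (s.map σ.symm.toEmbedding).map σ.toEmbedding = s := by
        rw [Finset.map_map]; simp
      exact ⟨s.map σ.symm.toEmbedding, (key _).2 (by rw [hs]; exact h), hs⟩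
    · rintro ⟨t, ht, rfl⟩
      exact (key t).1 ht
  rw [triangleCount, triangleCount, this, ncard_image_of_injective _ (Finset.map_injective _)]

theorem localCC_comap (G : SimpleGraph ℕ) (σ : Equiv.Perm ℕ) (i : ℕ) :
    localCC (G.comap σ) i = localCC G (σ i) := by
  rw [localCC, localCC, vertexDegree_comap, triangleCount_comap]

theorem localCC_within (G : SimpleGraph ℕ) (A : Set ℕ) (i : ℕ) (hi : i ∈ A)
    (hA : G.neighborSet i ⊆ A) : localCC (within G A) i = localCC G i := by
  have h1 : (within G A).neighborSet i = G.neighborSet i := by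
    ext j
    exact ⟨fun h => h.1, fun h => ⟨h, hi, hA h⟩⟩
  have h2 : {s : Finset ℕ | (within G A).IsNClique 3 s ∧ i ∈ s} =
      {s | G.IsNClique 3 s ∧ i ∈ s} := by
    ext s
    simp only [mem_ofPred_eq, SimpleGraph.isNClique_iff, SimpleGraph.IsClique, Set.Pairwise]
    refine and_congr_left fun his => and_congr_left fun _ => ?_
    refine ⟨fun h a ha b hb hab => (h ha hb hab).1, fun h a ha b hb hab => ?_⟩
    have hmem : ∀ c ∈ s, c ∈ A := fun c hc => by
      rcases eq_or_ne i c with rfl | hne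
      · exact hi
      · exact hA (h his hc hne)
    exact ⟨h ha hb hab, hmem a ha, hmem b hb⟩
  rw [localCC, localCC, vertexDegree, vertexDegree, triangleCount, triangleCount, h1, h2]

theorem localCC_eq_zero_of_infinite {G : SimpleGraph ℕ} {x : ℕ}
    (h : (G.neighborSet x).Infinite) : localCC G x = 0 := by
  simp [localCC, vertexDegree, h.ncard]

/-- A triangle at `x` is determined by the pair of its other vertices, which are neighbours
of `x`. -/
theorem triangles_finite_and_triangleCount_le {G : SimpleGraph ℕ} {x : ℕ}
    (h : (G.neighborSet x).Finite) :
    {s : Finset ℕ | G.IsNClique 3 s ∧ x ∈ s}.Finite ∧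
      triangleCount G x ≤ (vertexDegree G x).choose 2 := by
  set T := {s : Finset ℕ | G.IsNClique 3 s ∧ x ∈ s} with hT
  have hmaps : ∀ s ∈ T, s.erase x ∈ (h.toFinset.powersetCard 2 : Set (Finset ℕ)) := by
    rintro s ⟨hs, hx⟩
    rw [SimpleGraph.isNClique_iff] at hs
    simp only [Finset.mem_coe, Finset.mem_powersetCard]
    refine ⟨fun y hy => ?_, by rw [Finset.card_erase_of_mem hx, hs.2]⟩
    rw [Finset.mem_erase] at hy
    rw [h.mem_toFinset]
    exact hs.1 hx hy.2 hy.1.symm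
  have hinj : InjOn (fun s : Finset ℕ => s.erase x) T := by
    intro s hs t ht hst
    have := congrArg (insert x) hst
    simpa [Finset.insert_erase hs.2, Finset.insert_erase ht.2] using this
  have hfin : T.Finite :=
    Finite.of_injOn (f := fun s : Finset ℕ => s.erase x) hmaps hinj (Finset.finite_toSet _)
  refine ⟨hfin, ?_⟩
  calc triangleCount G x = T.ncard := rfl
    _ ≤ (h.toFinset.powersetCard 2 : Set (Finset ℕ)).ncard :=
      ncard_le_ncard_of_injOn _ hmaps hinj (Finset.finite_toSet _)
    _ = (vertexDegree G x).choose 2 := by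
      rw [ncard_coe_finset, Finset.card_powersetCard, vertexDegree, ncard_eq_toFinset_card _ h]

theorem localCC_nonneg (G : SimpleGraph ℕ) (x : ℕ) : 0 ≤ localCC G x := by
  have : (0 : ℝ) ≤ (vertexDegree G x : ℝ) * ((vertexDegree G x : ℝ) - 1) := by
    rcases Nat.eq_zero_or_pos (vertexDegree G x) with h | h
    · simp [h]
    · have : (1 : ℝ) ≤ vertexDegree G x := by exact_mod_cast h
      exact mul_nonneg (by linarith) (by linarith)
  unfold localCC
  positivity

theorem localCC_le_one (G : SimpleGraph ℕ) (x : ℕ) : localCC G x ≤ 1 := by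
  rcases (G.neighborSet x).finite_or_infinite with h | h
  · have h1 := (triangles_finite_and_triangleCount_le h).2
    have h2 : (2 : ℝ) * triangleCount G x ≤ vertexDegree G x * (vertexDegree G x - 1) := by
      have : (triangleCount G x : ℝ) ≤ (vertexDegree G x).choose 2 := by exact_mod_cast h1
      rw [Nat.cast_choose_two] at this
      linarith
    exact div_le_one_of_le₀ h2 (le_trans (by positivity) h2)
  · rw [localCC_eq_zero_of_infinite h]
    exact zero_le_one

theorem isLocalScore_localCC : IsLocalScore fun G i => ENNReal.ofReal (localCC G i) where
  measurable i := (measurable_localCC i).ennreal_ofReal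
  le_one G i := by simpa using localCC_le_one G i
  comap G σ i := by rw [localCC_comap]
  within G A i hi hA := by rw [localCC_within G A i hi hA]

theorem localCC_pos_of_triangle {G : SimpleGraph ℕ} {x y z : ℕ}
    (h : (G.neighborSet x).Finite) (hxy : G.Adj x y) (hxz : G.Adj x z) (hyz : G.Adj y z) :
    0 < localCC G x := by
  obtain ⟨hfin, hle⟩ := triangles_finite_and_triangleCount_le h
  have h1 : 0 < triangleCount G x := by
    refine (ncard_pos hfin).2 ⟨{x, y, z}, ?_, by simp⟩
    exact SimpleGraph.is3Clique_triple_iff.2 ⟨hxy, hxz, hyz⟩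
  have h2 : 2 ≤ vertexDegree G x := by
    by_contra hlt
    rw [Nat.choose_eq_zero_of_lt (by lia)] at hle
    lia
  have h3 : (2 : ℝ) ≤ vertexDegree G x := by exact_mod_cast h2
  have h4 : (0 : ℝ) < triangleCount G x := by exact_mod_cast h1
  exact div_pos (by linarith) (mul_pos (by linarith) (by linarith))

end

section

/-! ### A strong law for weakly dependent sums over lattice boxes -/

/-- The lattice points of the box `[-m, m)^d`. -/
noncomputable def latticeBox (d m : ℕ) : Finset (Fin d → ℤ) :=
  Fintype.piFinset fun _ => Finset.Ico (-(m : ℤ)) m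

theorem mem_latticeBox {d m : ℕ} {z : Fin d → ℤ} :
    z ∈ latticeBox d m ↔ ∀ i, -(m : ℤ) ≤ z i ∧ z i < m := by
  simp [latticeBox, Fintype.mem_piFinset]

theorem card_latticeBox (d m : ℕ) : (latticeBox d m).card = (2 * m) ^ d := by
  rw [latticeBox, Fintype.card_piFinset]
  simp only [Int.card_Ico, Finset.prod_const, Finset.card_univ, Fintype.card_fin]
  congr 1
  lia

theorem latticeBox_mono (d : ℕ) : Monotone (latticeBox d) := by
  intro m n hmn z hz
  rw [mem_latticeBox] at hz ⊢
  intro i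
  have := hz i
  lia

/-- Convergence of normalized monotone sequences follows from convergence along a subsequence
with quotients tending to `1`. -/
theorem tendsto_div_pow_of_monotone {T : ℕ → ℝ} (hT : Monotone T) (hT0 : ∀ m, 0 ≤ T m) {c : ℝ}
    (d : ℕ) {a : ℕ → ℕ} (ha : StrictMono a) (ha0 : 0 < a 0)
    (hratio : Tendsto (fun k => (a (k + 1) : ℝ) / a k) atTop (𝓝 1))
    (hlim : Tendsto (fun k => T (a k) / (2 * (a k : ℝ)) ^ d) atTop (𝓝 c)) :
    Tendsto (fun m : ℕ => T m / (2 * (m : ℝ)) ^ d) atTop (𝓝 c) := by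
  have hapos : ∀ k, (0 : ℝ) < a k := fun k => by
    exact_mod_cast ha0.trans_le (ha.monotone (Nat.zero_le k))
  have hex : ∀ m : ℕ, ∃ k, a 0 < m → a k < m ∧ m ≤ a (k + 1) := by
    intro m
    by_cases hm : a 0 < m
    · obtain ⟨k, hk⟩ := ha.exists_between_of_tendsto_atTop ha.tendsto_atTop hm
      exact ⟨k, fun _ => hk⟩
    · exact ⟨0, fun h => absurd h hm⟩
  choose k hk using hex
  have hkt : Tendsto k atTop atTop := by
    refine tendsto_atTop.2 fun N => ?_
    filter_upwards [eventually_gt_atTop (a 0), eventually_gt_atTop (a N)] with m h0 hN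
    have := ha.lt_iff_lt.1 (hN.trans_le (hk m h0).2)
    lia
  have hratio' := (hratio.comp hkt).pow d
  have hratio_inv := ((hratio.comp hkt).inv₀ one_ne_zero).pow d
  have hup := ((hlim.comp (tendsto_add_atTop_nat 1)).comp hkt).mul hratio'
  have hlow := (hlim.comp hkt).mul hratio_inv
  simp only [one_pow, mul_one, inv_one] at hup hlow
  refine tendsto_of_tendsto_of_tendsto_of_le_of_le' hlow hup ?_ ?_
  · filter_upwards [eventually_gt_atTop (a 0)] with m h0
    obtain ⟨h1, h2⟩ := hk m h0
    have hk0 := hapos (k m)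
    have hk1 := hapos (k m + 1)
    have hm0 : (0 : ℝ) < m := by exact_mod_cast (Nat.zero_le _).trans_lt h0
    simp only [Function.comp_apply]
    calc T (a (k m)) / (2 * (a (k m) : ℝ)) ^ d * ((a (k m + 1) : ℝ) / a (k m))⁻¹ ^ d
        = T (a (k m)) / (2 * (a (k m + 1) : ℝ)) ^ d := by
          rw [inv_div, div_pow, mul_pow, mul_pow]
          field_simp
      _ ≤ T m / (2 * (m : ℝ)) ^ d := by
          have hle : (m : ℝ) ≤ a (k m + 1) := by exact_mod_cast h2
          have := hT0 (a (k m))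
          have := hT h1.le
          gcongr
          exact hT0 m
  · filter_upwards [eventually_gt_atTop (a 0)] with m h0
    obtain ⟨h1, h2⟩ := hk m h0
    have hk0 := hapos (k m)
    have hk1 := hapos (k m + 1)
    have hm0 : (0 : ℝ) < m := by exact_mod_cast (Nat.zero_le _).trans_lt h0
    simp only [Function.comp_apply]
    calc T m / (2 * (m : ℝ)) ^ d ≤ T (a (k m + 1)) / (2 * (a (k m) : ℝ)) ^ d := by
          have hle : (a (k m) : ℝ) ≤ m := by exact_mod_cast h1.le
          have := hT h2
          have := hT0 (a (k m + 1))
          gcongr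
      _ = _ := by
          rw [div_pow, mul_pow, mul_pow]
          field_simp

/-- Nonnegative variables with summable means tend to `0` almost surely, as their sum has a finite
mean. -/
theorem ae_tendsto_zero_of_summable_integral {Ω : Type*} [MeasurableSpace Ω] {Q : Measure Ω}
    {g : ℕ → Ω → ℝ} (hg0 : ∀ k ω, 0 ≤ g k ω) (hg : ∀ k, Integrable (g k) Q)
    (hsum : Summable fun k => ∫ ω, g k ω ∂Q) :
    ∀ᵐ ω ∂Q, Tendsto (fun k => g k ω) atTop (𝓝 0) := by
  have hfin : ∫⁻ ω, ∑' k, ENNReal.ofReal (g k ω) ∂Q ≠ ∞ := by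
    rw [lintegral_tsum fun k => (hg k).aestronglyMeasurable.aemeasurable.ennreal_ofReal]
    simp_rw [← ofReal_integral_eq_lintegral_ofReal (hg _) (ae_of_all _ (hg0 _))]
    exact hsum.tsum_ofReal_lt_top.ne
  filter_upwards [ae_lt_top' (AEMeasurable.tsum fun k =>
    (hg k).aestronglyMeasurable.aemeasurable.ennreal_ofReal) hfin] with ω hω
  have h := ENNReal.tendsto_atTop_zero_of_tsum_ne_top hω.ne
  have h' := (ENNReal.tendsto_toReal ENNReal.zero_ne_top).comp h
  simpa [Function.comp_def, ENNReal.toReal_ofReal (hg0 _ ω)] using h'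

theorem covariance_le_of_variance_le {Ω : Type*} [MeasurableSpace Ω] {Q : Measure Ω}
    [IsProbabilityMeasure Q] {X Y : Ω → ℝ} (hX : MemLp X 2 Q) (hY : MemLp Y 2 Q) {K : ℝ}
    (hXK : Var[X; Q] ≤ K) (hYK : Var[Y; Q] ≤ K) : cov[X, Y; Q] ≤ K := by
  -- `0 ≤ Var (X - Y) = Var X + Var Y - 2 * cov (X, Y)`
  have h := variance_nonneg (X - Y) Q
  rw [variance_sub hX hY] at h
  linarith

/-- The variance of a sum over a lattice box of random variables with bounded variances and
vanishing covariances at distances larger than `r`. -/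
theorem variance_sum_latticeBox_le {Ω : Type*} [MeasurableSpace Ω] {Q : Measure Ω}
    [IsProbabilityMeasure Q] {d : ℕ} {Z : (Fin d → ℤ) → Ω → ℝ} (hZ : ∀ z, MemLp (Z z) 2 Q)
    {K : ℝ} (hK0 : 0 ≤ K) (hK : ∀ z, Var[Z z; Q] ≤ K) (r : ℕ)
    (hcov : ∀ z z', (∃ i, (r : ℤ) < |z i - z' i|) → cov[Z z, Z z'; Q] = 0) (m : ℕ) :
    Var[∑ z ∈ latticeBox d m, Z z; Q] ≤ (2 * (m : ℝ)) ^ d * ((2 * (r : ℝ) + 1) ^ d * K) := by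
  classical
  rw [variance_sum' fun z _ => hZ z]
  have hrow : ∀ z ∈ latticeBox d m, ∑ z' ∈ latticeBox d m, cov[Z z, Z z'; Q] ≤
      (2 * (r : ℝ) + 1) ^ d * K := by
    intro z _
    set near : Finset (Fin d → ℤ) := Fintype.piFinset fun i => Finset.Icc (z i - r) (z i + r)
    have hcard : near.card = (2 * r + 1) ^ d := by
      simp only [near, Fintype.card_piFinset, Int.card_Icc]
      rw [Finset.prod_congr rfl fun i _ => show (z i + r + 1 - (z i - r)).toNat = 2 * r + 1 by lia]
      simp
    calc ∑ z' ∈ latticeBox d m, cov[Z z, Z z'; Q]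
        ≤ ∑ z' ∈ latticeBox d m, (if z' ∈ near then K else 0) := by
          refine Finset.sum_le_sum fun z' _ => ?_
          split_ifs with h
          · exact covariance_le_of_variance_le (hZ z) (hZ z') (hK z) (hK z')
          · refine (hcov z z' ?_).le
            by_contra hcon
            push Not at hcon
            refine h (Fintype.mem_piFinset.2 fun i => Finset.mem_Icc.2 ?_)
            have := abs_le.1 (hcon i)
            lia
      _ ≤ ∑ z' ∈ near, K := by
          rw [← Finset.sum_filter]
          exact Finset.sum_le_sum_of_subset_of_nonneg
            (fun z' hz' => (Finset.mem_filter.1 hz').2) fun _ _ _ => hK0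
      _ = (2 * (r : ℝ) + 1) ^ d * K := by
          rw [Finset.sum_const, hcard, nsmul_eq_mul]
          push_cast
          ring
  calc ∑ z ∈ latticeBox d m, ∑ z' ∈ latticeBox d m, cov[Z z, Z z'; Q]
      ≤ ∑ z ∈ latticeBox d m, (2 * (r : ℝ) + 1) ^ d * K := Finset.sum_le_sum hrow
    _ = _ := by
      rw [Finset.sum_const, card_latticeBox, nsmul_eq_mul]
      push_cast
      ring

theorem summable_const_mul_inv_succ_pow (C : ℝ) {p : ℕ} (hp : 2 ≤ p) :
    Summable fun k : ℕ => C * (((k : ℝ) + 1) ^ p)⁻¹ := by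
  refine Summable.mul_left _ ?_
  have h := (summable_nat_add_iff 1).2 (Real.summable_nat_pow_inv.2 (show 1 < p by lia))
  simpa using h

/-- A strong law of large numbers for a nonnegative field `Y` on `ℤ^d` that is approximated in
`L¹`, with a power rate, by fields `Z R` with bounded variances and range of dependence
proportional to `R`. -/
theorem strong_law_latticeBox {Ω : Type*} [MeasurableSpace Ω] {Q : Measure Ω}
    [IsProbabilityMeasure Q] {d : ℕ} (hd : 1 ≤ d) {Y : (Fin d → ℤ) → Ω → ℝ}
    {Z : ℕ → (Fin d → ℤ) → Ω → ℝ} (hY0 : ∀ z ω, 0 ≤ Y z ω) (hY : ∀ z, Integrable (Y z) Q)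
    {c : ℝ} (hc : ∀ z, ∫ ω, Y z ω ∂Q = c) (hZ : ∀ R z, MemLp (Z R z) 2 Q)
    {K : ℝ} (hK0 : 0 ≤ K) (hK : ∀ R z, Var[Z R z; Q] ≤ K) (κ : ℕ)
    (hcov : ∀ R, 1 ≤ R → ∀ z z', (∃ i, ((κ * R : ℕ) : ℤ) < |z i - z' i|) →
      cov[Z R z, Z R z'; Q] = 0)
    {C ε : ℝ} (hC : 0 ≤ C) (hε : 0 < ε)
    (happrox : ∀ R : ℕ, 1 ≤ R → ∀ z, ∫ ω, |Y z ω - Z R z ω| ∂Q ≤ C * (R : ℝ) ^ (-ε)) :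
    ∀ᵐ ω ∂Q, Tendsto (fun m : ℕ => (∑ z ∈ latticeBox d m, Y z ω) / (2 * (m : ℝ)) ^ d)
      atTop (𝓝 c) := by
  -- At the range `R = (k + 1) ^ p`, with `p ≥ 2 / ε`, the approximation errors are summable in `k`.
  -- In the box of size `m = R ^ 2` the normalized variance is of order `(R / m) ^ d = R ^ (-d)`,
  -- which is summable as `d ≥ 1` and `p ≥ 2`. The quotients of successive sizes tend to `1`, so that
  -- convergence along them suffices by monotonicity.
  obtain ⟨p, hp⟩ : ∃ p : ℕ, 2 ≤ p ∧ 2 ≤ p * ε := by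
    refine ⟨⌈2 / ε⌉₊ + 2, by lia, ?_⟩
    have h1 : 2 / ε ≤ ⌈2 / ε⌉₊ := Nat.le_ceil _
    rw [div_le_iff₀ hε] at h1
    push_cast
    nlinarith
  set R : ℕ → ℕ := fun k => (k + 1) ^ p with hR
  set a : ℕ → ℕ := fun k => R k ^ 2 with ha
  have hR1 : ∀ k, 1 ≤ R k := fun k => Nat.one_le_pow _ _ (by lia)
  have hR1' : ∀ k, (1 : ℝ) ≤ R k := fun k => by exact_mod_cast hR1 k
  have ha_pos : ∀ k, (0 : ℝ) < a k := fun k => by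
    have := hR1' k
    simp only [ha]; push_cast; positivity
  have hM : ∀ k, 0 < (2 * (a k : ℝ)) ^ d := fun k => by have := ha_pos k; positivity
  have hint : ∀ k, Integrable (fun ω => ∑ z ∈ latticeBox d (a k), Z (R k) z ω) Q := fun k =>
    integrable_finsetSum _ fun z _ => (hZ _ z).integrable one_le_two
  have hYint : ∀ k, Integrable (fun ω => ∑ z ∈ latticeBox d (a k), Y z ω) Q := fun k =>
    integrable_finsetSum _ fun z _ => hY z
  have hL2 : ∀ k, MemLp (∑ z ∈ latticeBox d (a k), Z (R k) z) 2 Q := fun k =>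
    memLp_finsetSum' _ fun z _ => hZ _ z
  set E : ℕ → ℝ := fun k => ∫ ω, ∑ z ∈ latticeBox d (a k), Z (R k) z ω ∂Q with hE
  -- the squared fluctuations of `Z` and the approximation errors, both normalized
  set g₁ : ℕ → Ω → ℝ := fun k ω =>
    ((∑ z ∈ latticeBox d (a k), Z (R k) z ω - E k) / (2 * (a k : ℝ)) ^ d) ^ 2 with hg₁
  set g₂ : ℕ → Ω → ℝ := fun k ω =>
    |∑ z ∈ latticeBox d (a k), Y z ω - ∑ z ∈ latticeBox d (a k), Z (R k) z ω| /
      (2 * (a k : ℝ)) ^ d with hg₂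
  have hg₂_int : ∀ k, Integrable (g₂ k) Q := fun k =>
    ((hYint k).sub (hint k)).abs.div_const _
  have hg₂_le : ∀ k, ∫ ω, g₂ k ω ∂Q ≤ C * (R k : ℝ) ^ (-ε) := by
    intro k
    have hdiff : ∀ z, Integrable (fun ω => |Y z ω - Z (R k) z ω|) Q := fun z =>
      ((hY z).sub ((hZ _ z).integrable one_le_two)).abs
    calc ∫ ω, g₂ k ω ∂Q
        ≤ ∫ ω, (∑ z ∈ latticeBox d (a k), |Y z ω - Z (R k) z ω|) / (2 * (a k : ℝ)) ^ d ∂Q := by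
          refine integral_mono (hg₂_int k)
            ((integrable_finsetSum _ fun z _ => hdiff z).div_const _) fun ω => ?_
          simp only [hg₂]
          rw [← Finset.sum_sub_distrib]
          exact div_le_div_of_nonneg_right (Finset.abs_sum_le_sum_abs _ _) (hM k).le
      _ = (∑ z ∈ latticeBox d (a k), ∫ ω, |Y z ω - Z (R k) z ω| ∂Q) / (2 * (a k : ℝ)) ^ d := by
          rw [integral_div, integral_finsetSum _ fun z _ => hdiff z]
      _ ≤ (∑ z ∈ latticeBox d (a k), C * (R k : ℝ) ^ (-ε)) / (2 * (a k : ℝ)) ^ d := by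
          gcongr with z
          exact happrox _ (hR1 k) z
      _ = C * (R k : ℝ) ^ (-ε) := by
          rw [Finset.sum_const, card_latticeBox, nsmul_eq_mul]
          push_cast
          rw [mul_div_cancel_left₀ _ (hM k).ne']
  have hR_rpow : ∀ k, C * (R k : ℝ) ^ (-ε) ≤ C * (((k : ℝ) + 1) ^ 2)⁻¹ := by
    intro k
    gcongr
    have hk : (1 : ℝ) ≤ (k : ℝ) + 1 := by linarith [Nat.cast_nonneg (α := ℝ) k]
    simp only [hR]
    push_cast
    rw [← Real.rpow_natCast, ← Real.rpow_mul (by linarith), ← Real.rpow_natCast,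
      ← Real.rpow_neg (by linarith)]
    refine Real.rpow_le_rpow_of_exponent_le hk ?_
    push_cast
    linarith [hp.2]
  have hg₂0 : ∀ k ω, 0 ≤ g₂ k ω := fun k ω => div_nonneg (abs_nonneg _) (hM k).le
  have hsum₂ : Summable fun k => ∫ ω, g₂ k ω ∂Q :=
    Summable.of_nonneg_of_le (fun k => integral_nonneg (hg₂0 k))
      (fun k => (hg₂_le k).trans (hR_rpow k)) (summable_const_mul_inv_succ_pow C le_rfl)
  have hsum₁ : Summable fun k => ∫ ω, g₁ k ω ∂Q := by
    refine Summable.of_nonneg_of_le (fun k => integral_nonneg fun ω => sq_nonneg _) (fun k => ?_)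
      (summable_const_mul_inv_succ_pow ((2 * κ + 1) ^ d * K) hp.1)
    have hvar : ∫ ω, g₁ k ω ∂Q =
        Var[∑ z ∈ latticeBox d (a k), Z (R k) z; Q] / ((2 * (a k : ℝ)) ^ d) ^ 2 := by
      rw [variance_eq_integral (hL2 k).aemeasurable]
      simp only [hg₁, div_pow, Finset.sum_apply, hE]
      rw [integral_div]
    rw [hvar]
    have hle := variance_sum_latticeBox_le (hZ (R k)) hK0 (hK (R k)) (κ * R k)
      (hcov (R k) (hR1 k)) (a k)
    have hRk := hR1' k
    have h1 : 2 * ((κ * R k : ℕ) : ℝ) + 1 ≤ (2 * κ + 1) * R k := by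
      push_cast
      nlinarith
    have h2 : ((k : ℝ) + 1) ^ p ≤ (2 * (R k : ℝ)) ^ d := by
      calc ((k : ℝ) + 1) ^ p = R k := by simp [hR]
        _ ≤ 2 * R k := by linarith
        _ ≤ (2 * (R k : ℝ)) ^ d := le_self_pow₀ (by linarith) (by lia)
    have hpow : 0 < ((k : ℝ) + 1) ^ p := by positivity
    calc Var[∑ z ∈ latticeBox d (a k), Z (R k) z; Q] / ((2 * (a k : ℝ)) ^ d) ^ 2
        ≤ (2 * (a k : ℝ)) ^ d * (((2 * κ + 1) * R k) ^ d * K) / ((2 * (a k : ℝ)) ^ d) ^ 2 := by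
          gcongr
          refine hle.trans ?_
          gcongr
      _ = (2 * κ + 1) ^ d * K * ((2 * (R k : ℝ)) ^ d)⁻¹ := by
          simp only [ha]
          push_cast
          field_simp
          rw [mul_pow, mul_pow, mul_pow]
          ring
      _ ≤ (2 * κ + 1) ^ d * K * (((k : ℝ) + 1) ^ p)⁻¹ := by gcongr
  have hg₁_int : ∀ k, Integrable (g₁ k) Q := by
    intro k
    have h := (((hL2 k).sub (memLp_const (E k))).integrable_sq).div_const
      (((2 * (a k : ℝ)) ^ d) ^ 2)
    refine h.congr (ae_of_all _ fun ω => ?_)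
    simp [hg₁, div_pow]
  have hE_lim : Tendsto (fun k => E k / (2 * (a k : ℝ)) ^ d) atTop (𝓝 c) := by
    refine tendsto_iff_dist_tendsto_zero.2 (squeeze_zero (fun _ => dist_nonneg) (fun k => ?_)
      hsum₂.tendsto_atTop_zero)
    have h1 : ∫ ω, ∑ z ∈ latticeBox d (a k), Y z ω ∂Q = (2 * (a k : ℝ)) ^ d * c := by
      rw [integral_finsetSum _ fun z _ => hY z]
      simp only [hc, Finset.sum_const, card_latticeBox, nsmul_eq_mul]
      push_cast
      ring
    have h2 : c - E k / (2 * (a k : ℝ)) ^ d =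
        ∫ ω, (∑ z ∈ latticeBox d (a k), Y z ω - ∑ z ∈ latticeBox d (a k), Z (R k) z ω) /
          (2 * (a k : ℝ)) ^ d ∂Q := by
      rw [integral_div, integral_sub (hYint k) (hint k), h1, sub_div,
        mul_div_cancel_left₀ _ (hM k).ne']
    rw [dist_comm, Real.dist_eq, h2]
    refine (abs_integral_le_integral_abs).trans (le_of_eq ?_)
    simp only [hg₂, abs_div, abs_of_pos (hM k)]
  filter_upwards [ae_tendsto_zero_of_summable_integral (fun k ω => sq_nonneg _) hg₁_int hsum₁,
    ae_tendsto_zero_of_summable_integral hg₂0 hg₂_int hsum₂] with ω h₁ h₂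
  refine tendsto_div_pow_of_monotone (a := a) ?_ (fun m => Finset.sum_nonneg fun z _ => hY0 z ω)
    d ?_ ?_ ?_ ?_
  · exact fun m n hmn => Finset.sum_le_sum_of_subset_of_nonneg (latticeBox_mono d hmn)
      fun z _ _ => hY0 z ω
  · refine strictMono_nat_of_lt_succ fun k => ?_
    simp only [ha, hR]
    have : 0 < p := by lia
    gcongr
    lia
  · simp [ha, hR]
  · have h : Tendsto (fun k : ℕ => 1 + 1 / ((k : ℝ) + 1)) atTop (𝓝 (1 + 0)) :=
      tendsto_one_div_add_atTop_nhds_zero_nat.const_add 1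
    have h' := (h.pow p).pow 2
    simp only [add_zero, one_pow] at h'
    refine h'.congr fun k => ?_
    have hk : (0 : ℝ) < (k : ℝ) + 1 := by positivity
    simp only [ha, hR]
    push_cast
    rw [← div_pow, ← div_pow]
    congr 2
    field_simp
  · have h₁' : Tendsto (fun k => (∑ z ∈ latticeBox d (a k), Z (R k) z ω - E k) /
        (2 * (a k : ℝ)) ^ d) atTop (𝓝 0) := by
      rw [tendsto_zero_iff_abs_tendsto_zero]
      have := h₁.sqrt
      simpa [hg₁, Function.comp_def, Real.sqrt_sq_eq_abs] using this
    have h₂' : Tendsto (fun k => (∑ z ∈ latticeBox d (a k), Y z ω -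
        ∑ z ∈ latticeBox d (a k), Z (R k) z ω) / (2 * (a k : ℝ)) ^ d) atTop (𝓝 0) := by
      rw [tendsto_zero_iff_abs_tendsto_zero]
      refine h₂.congr fun k => ?_
      simp [hg₂, abs_div]
    have h := (h₂'.add h₁').add hE_lim
    simp only [zero_add] at h
    refine h.congr fun k => ?_
    rw [← add_div, ← add_div]
    congr 1
    ring

end

section

/-! ### Point counts of a Poisson process and the reduced Mecke formula for them -/

variable {d : ℕ}

theorem measurable_pointCount {A : Set (Space d)} (hA : MeasurableSet A) :
    Measurable (pointCount A) := by
  refine measurable_encard.comp (measurable_set_iff.2 fun i => ?_)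
  exact hA.mem.comp (measurable_pi_apply i)

theorem toENNReal_pointCount (A : Set (Space d)) (η : Config d) :
    (pointCount A η : ℝ≥0∞) = ∑' i, A.indicator (fun _ => 1) (η i) := by
  rw [pointCount, ← ENNReal.tsum_set_one, tsum_subtype {i | η i ∈ A} fun _ => (1 : ℝ≥0∞)]
  rfl

theorem pointCount_comp_perm (A : Set (Space d)) (η : Config d) (σ : Equiv.Perm ℕ) :
    pointCount A (η ∘ σ) = pointCount A η := by
  rw [← ENat.toENNReal_inj, toENNReal_pointCount, toENNReal_pointCount]
  exact σ.tsum_eq fun i => A.indicator (fun _ => (1 : ℝ≥0∞)) (η i)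

/-- The configuration `η ∪ {x}`; the added point is the vertex `0`. -/
def consPoint (x : Space d) (η : Config d) : Config d
  | 0 => x
  | i + 1 => η i

/-- The configuration `η` without the point `η i`. -/
def removePoint (i : ℕ) (η : Config d) : Config d := fun j => η (Equiv.swap 0 i (j + 1))

theorem addOrigin_eq_consPoint (η : Config d) : addOrigin η = consPoint 0 η := by
  ext j; cases j <;> rfl

theorem consPoint_removePoint (i : ℕ) (η : Config d) :
    consPoint (η i) (removePoint i η) = η ∘ Equiv.swap 0 i := by
  funext j
  cases j with
  | zero => simp [consPoint]
  | succ j => rfl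

theorem measurable_consPoint :
    Measurable fun p : Space d × Config d => consPoint p.1 p.2 := by
  refine measurable_pi_iff.2 fun j => ?_
  cases j with
  | zero => exact measurable_fst
  | succ j => exact (measurable_pi_apply j).comp measurable_snd

theorem measurable_removePoint (i : ℕ) :
    Measurable (removePoint i : Config d → Config d) :=
  measurable_pi_iff.2 fun _ => measurable_pi_apply _

open Classical in
theorem pointCount_consPoint (A : Set (Space d)) (x : Space d) (η : Config d) :
    pointCount A (consPoint x η) = pointCount A η + if x ∈ A then 1 else 0 := by
  rw [← ENat.toENNReal_inj, ENat.toENNReal_add, toENNReal_pointCount, toENNReal_pointCount,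
    tsum_eq_zero_add' ENNReal.summable, add_comm]
  congr 1
  change A.indicator (fun _ => 1) x = _
  by_cases h : x ∈ A <;> simp [h]

open Classical in
theorem pointCount_eq_removePoint (A : Set (Space d)) (i : ℕ) (η : Config d) :
    pointCount A η = pointCount A (removePoint i η) + if η i ∈ A then 1 else 0 := by
  rw [← pointCount_consPoint, consPoint_removePoint, pointCount_comp_perm]

/-- The numbers of points of `η` in the sets of a family. -/
noncomputable def countVec {T : Type*} (B : T → Set (Space d)) (η : Config d) : T → ℕ∞ :=
  fun t => pointCount (B t) η

theorem measurable_countVec {T : Type*} {B : T → Set (Space d)}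
    (hB : ∀ t, MeasurableSet (B t)) : Measurable (countVec B) :=
  measurable_pi_iff.2 fun t => measurable_pointCount (hB t)

/-- The points that lie in exactly those sets of the family `B` that are listed in `s`. -/
def atom {ι : Type*} (B : ι → Set (Space d)) (s : Finset ι) : Set (Space d) :=
  {x | ∀ i, x ∈ B i ↔ i ∈ s}

section Atoms

variable {ι : Type*} {B : ι → Set (Space d)}

theorem pairwise_disjoint_atom : Pairwise fun s t => Disjoint (atom B s) (atom B t) := by
  intro s t hst
  refine disjoint_left.2 fun x hs ht => hst ?_
  ext i
  rw [← hs i, ← ht i]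

theorem atom_subset {s : Finset ι} {i : ι} (hi : i ∈ s) : atom B s ⊆ B i :=
  fun _ hx => (hx i).2 hi

theorem measurableSet_atom [Countable ι] (hB : ∀ i, MeasurableSet (B i)) (s : Finset ι) :
    MeasurableSet (atom B s) := by
  have : atom B s = ⋂ i, {x | x ∈ B i ↔ i ∈ s} := by ext; simp [atom]
  rw [this]
  refine MeasurableSet.iInter fun i => ?_
  by_cases h : i ∈ s
  · simpa [h] using hB i
  · have : {x | x ∈ B i ↔ i ∈ s} = (B i)ᶜ := by ext; simp [h]
    exact this ▸ (hB i).compl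

variable [Fintype ι]

open Classical in
theorem indicator_eq_sum_atom (i : ι) (x : Space d) :
    (B i).indicator (fun _ => (1 : ℝ≥0∞)) x =
      ∑ s : {s : Finset ι // s.Nonempty},
        if i ∈ s.1 then (atom B s.1).indicator (fun _ => 1) x else 0 := by
  by_cases hx : x ∈ B i
  · set s₀ : Finset ι := Finset.univ.filter fun j => x ∈ B j with hs₀
    have hi : i ∈ s₀ := by simp [hs₀, hx]
    have hmem : x ∈ atom B s₀ := fun j => by simp [hs₀]
    rw [Finset.sum_eq_single (⟨s₀, i, hi⟩ : {s : Finset ι // s.Nonempty})]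
    · simp [hx, hi, hmem]
    · intro t _ ht
      have : x ∉ atom B t.1 := fun h =>
        disjoint_left.1 (pairwise_disjoint_atom fun h' => ht (Subtype.ext h')) h hmem
      simp [this]
    · simp
  · rw [indicator_of_notMem hx]
    symm
    refine Finset.sum_eq_zero fun s _ => ?_
    split_ifs with h
    · exact indicator_of_notMem (fun h' => hx (atom_subset h h')) _
    · rfl

open Classical in
theorem pointCount_eq_sum_atom (i : ι) (η : Config d) :
    pointCount (B i) η = ∑ s : {s : Finset ι // s.Nonempty},
      if i ∈ s.1 then pointCount (atom B s.1) η else 0 := by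
  rw [← ENat.toENNReal_inj, toENNReal_pointCount]
  have hcoe : ∀ f : {s : Finset ι // s.Nonempty} → ℕ∞,
      ((∑ s, f s : ℕ∞) : ℝ≥0∞) = ∑ s, (f s : ℝ≥0∞) := fun f => by
    induction (Finset.univ : Finset {s : Finset ι // s.Nonempty}) using Finset.induction_on with
    | empty => simp
    | insert a t ha ih => rw [Finset.sum_insert ha, Finset.sum_insert ha, ENat.toENNReal_add, ih]
  rw [hcoe]
  simp_rw [indicator_eq_sum_atom i]
  rw [Summable.tsum_finsetSum fun _ _ => ENNReal.summable]
  refine Finset.sum_congr rfl fun s _ => ?_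
  split_ifs with h
  · rw [toENNReal_pointCount]
  · simp

open Classical in
/-- The counts of a finite family as a function of the counts of its atoms. -/
noncomputable def sumAtoms (ι : Type*) [Fintype ι] (v : {s : Finset ι // s.Nonempty} → ℕ∞) :
    ι → ℕ∞ :=
  fun i => ∑ s, if i ∈ s.1 then v s else 0

theorem measurable_sumAtoms : Measurable (sumAtoms ι) := by
  refine measurable_pi_iff.2 fun i => Finset.measurable_sum _ fun s _ => ?_
  split_ifs <;> fun_prop

theorem countVec_eq_sumAtoms :
    countVec B = sumAtoms ι ∘ countVec fun s : {s : Finset ι // s.Nonempty} => atom B s.1 := by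
  funext η i
  exact pointCount_eq_sum_atom i η

end Atoms

variable {ν : ℝ} {P : Measure (Config d)}

/-- The law on `ℕ∞` of the number of points in a set of volume `v`. -/
noncomputable def poissonCount (ν v : ℝ) : Measure ℕ∞ :=
  (poissonMeasure (ν * v).toNNReal).map (fun k : ℕ => (k : ℕ∞))

instance (ν v : ℝ) : IsProbabilityMeasure (poissonCount ν v) :=
  Measure.isProbabilityMeasure_map (Measurable.of_discrete.aemeasurable)

theorem poissonCount_natCast (ν v : ℝ) (k : ℕ) :
    poissonCount ν v {(k : ℕ∞)} = poissonMeasure (ν * v).toNNReal {k} := by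
  rw [poissonCount, Measure.map_apply Measurable.of_discrete (measurableSet_singleton _)]
  congr 1
  ext j
  simp

theorem poissonCount_top (ν v : ℝ) : poissonCount ν v {⊤} = 0 := by
  rw [poissonCount, Measure.map_apply Measurable.of_discrete (measurableSet_singleton _)]
  convert measure_empty (μ := poissonMeasure (ν * v).toNNReal)
  ext j
  simp

theorem succ_mul_poissonCount_succ {ν v : ℝ} (h : 0 ≤ ν * v) (k : ℕ∞) :
    ((k + 1 : ℕ∞) : ℝ≥0∞) * poissonCount ν v {k + 1} =
      ENNReal.ofReal (ν * v) * poissonCount ν v {k} := by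
  induction k using ENat.recTopCoe with
  | top => simp [poissonCount_top]
  | coe k =>
    rw [show ((k : ℕ∞) + 1) = ((k + 1 : ℕ) : ℕ∞) by push_cast; rfl, poissonCount_natCast,
      poissonCount_natCast, poissonMeasure_singleton, poissonMeasure_singleton,
      ENat.toENNReal_coe, ← ENNReal.ofReal_natCast, ← ENNReal.ofReal_mul (by positivity),
      ← ENNReal.ofReal_mul h, Real.coe_toNNReal _ h]
    congr 1
    rw [Nat.factorial_succ]
    push_cast
    have : ((k : ℝ) + 1) ≠ 0 := by positivity
    field_simp
    ring

theorem map_pointCount (hP : IsPoissonPointProcess ν P) {A : Set (Space d)}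
    (hA : MeasurableSet A) (hvol : volume A ≠ ∞) :
    P.map (pointCount A) = poissonCount ν (volume.real A) := by
  have := hP.isProbabilityMeasure
  have hm := measurable_pointCount hA
  have := Measure.isProbabilityMeasure_map (μ := P) hm.aemeasurable
  have hnat : ∀ k : ℕ, P.map (pointCount A) {(k : ℕ∞)} =
      poissonCount ν (volume.real A) {(k : ℕ∞)} := fun k => by
    rw [Measure.map_apply hm (measurableSet_singleton _), poissonCount_natCast,
      ← hP.poisson A hA hvol k]
    rfl
  have hcompl : ∀ m : Measure ℕ∞, m ({⊤}ᶜ : Set ℕ∞) = ∑' k : ℕ, m {(k : ℕ∞)} := by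
    intro m
    rw [← measure_iUnion (fun i j hij => by simpa using hij) fun _ => measurableSet_singleton _]
    congr 1
    ext j
    induction j using ENat.recTopCoe <;> simp
  refine Measure.ext_of_singleton fun k => ?_
  induction k using ENat.recTopCoe with
  | coe k => exact hnat k
  | top =>
    have h1 := prob_compl_eq_one_sub (μ := P.map (pointCount A)) (measurableSet_singleton ⊤).compl
    have h2 := prob_compl_eq_one_sub (μ := poissonCount ν (volume.real A))
      (measurableSet_singleton ⊤).compl
    rw [compl_compl] at h1 h2
    rw [h1, h2, hcompl, hcompl]
    simp_rw [hnat]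

theorem ae_pointCount_ne_top (hP : IsPoissonPointProcess ν P) {A : Set (Space d)}
    (hA : MeasurableSet A) (hvol : volume A ≠ ∞) : ∀ᵐ η ∂P, pointCount A η ≠ ⊤ := by
  have h := poissonCount_top ν (volume.real A)
  rw [← map_pointCount hP hA hvol, Measure.map_apply (measurable_pointCount hA)
    (measurableSet_singleton _)] at h
  exact measure_eq_zero_iff_ae_notMem.1 h

theorem iIndepFun_pointCount (hP : IsPoissonPointProcess ν P) {S : Type*} [Finite S]
    {C : S → Set (Space d)} (hC : ∀ s, MeasurableSet (C s))
    (hdisj : Pairwise fun s t => Disjoint (C s) (C t)) :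
    iIndepFun (fun s => pointCount (C s)) P := by
  obtain ⟨n, ⟨e⟩⟩ := Finite.exists_equiv_fin S
  have h := (hP.indep n (fun i => C (e.symm i)) (fun i => hC _)
    fun i j hij => hdisj (e.symm.injective.ne hij)).precomp e.injective
  simpa using h

theorem map_countVec_of_disjoint (hP : IsPoissonPointProcess ν P) {S : Type*} [Fintype S]
    {C : S → Set (Space d)} (hC : ∀ s, MeasurableSet (C s)) (hvol : ∀ s, volume (C s) ≠ ∞)
    (hdisj : Pairwise fun s t => Disjoint (C s) (C t)) :
    P.map (countVec C) = Measure.pi fun s => poissonCount ν (volume.real (C s)) := by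
  have := hP.isProbabilityMeasure
  have h := (iIndepFun_iff_map_fun_eq_pi_map
    (fun s => (measurable_pointCount (hC s)).aemeasurable)).1 (iIndepFun_pointCount hP hC hdisj)
  simp_rw [map_pointCount hP (hC _) (hvol _)] at h
  exact h

/-- For disjoint sets, the reduced Mecke formula is the identity
`(k + 1) * π (k + 1) = λ * π k` for the Poisson weights. -/
theorem lintegral_removePoint_singleton (hP : IsPoissonPointProcess ν P) (hν : 0 < ν)
    {S : Type*} [Fintype S] {C : S → Set (Space d)} (hC : ∀ s, MeasurableSet (C s))
    (hvol : ∀ s, volume (C s) ≠ ∞) (hdisj : Pairwise fun s t => Disjoint (C s) (C t))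
    (s₀ : S) (k : S → ℕ∞) :
    ∫⁻ η, ∑' i, (C s₀).indicator (fun _ => 1) (η i) *
        ({k} : Set (S → ℕ∞)).indicator (fun _ => 1) (countVec C (removePoint i η)) ∂P =
      ENNReal.ofReal (ν * volume.real (C s₀)) * P.map (countVec C) {k} := by
  classical
  have := hP.isProbabilityMeasure
  set k' : S → ℕ∞ := Function.update k s₀ (k s₀ + 1) with hk'
  have hpt : ∀ η : Config d, ∑' i, (C s₀).indicator (fun _ => (1 : ℝ≥0∞)) (η i) *
        ({k} : Set (S → ℕ∞)).indicator (fun _ => 1) (countVec C (removePoint i η)) =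
      (countVec C ⁻¹' {k'}).indicator (fun _ => ((k s₀ + 1 : ℕ∞) : ℝ≥0∞)) η := by
    intro η
    have hterm : ∀ i, (C s₀).indicator (fun _ => (1 : ℝ≥0∞)) (η i) *
        ({k} : Set (S → ℕ∞)).indicator (fun _ => 1) (countVec C (removePoint i η)) =
        (C s₀).indicator (fun _ => (1 : ℝ≥0∞)) (η i) *
          (countVec C ⁻¹' {k'}).indicator (fun _ => 1) η := by
      intro i
      by_cases hi : η i ∈ C s₀
      · have hiff : countVec C (removePoint i η) = k ↔ countVec C η = k' := by
          rw [funext_iff, funext_iff]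
          refine forall_congr' fun s => ?_
          have hs := pointCount_eq_removePoint (C s) i η
          change pointCount (C s) (removePoint i η) = k s ↔ pointCount (C s) η = k' s
          rw [hs]
          rcases eq_or_ne s s₀ with rfl | hne
          · simp only [hi, if_true, hk', Function.update_self]
            exact (WithTop.add_right_inj ENat.one_ne_top).symm
          · have : η i ∉ C s := fun h => disjoint_left.1 (hdisj hne) h hi
            simp [this, hk', hne]
        have : ({k} : Set (S → ℕ∞)).indicator (fun _ => (1 : ℝ≥0∞))
            (countVec C (removePoint i η)) = (countVec C ⁻¹' {k'}).indicator (fun _ => 1) η := by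
          by_cases h : countVec C η = k'
          · rw [indicator_of_mem (by exact hiff.2 h), indicator_of_mem (by exact h)]
          · rw [indicator_of_notMem (by exact fun h' => h (hiff.1 h')),
              indicator_of_notMem (by exact h)]
        rw [this]
      · simp [hi]
    simp_rw [hterm]
    rw [ENNReal.tsum_mul_right, ← toENNReal_pointCount]
    by_cases h : countVec C η = k'
    · rw [indicator_of_mem (by exact h), indicator_of_mem (by exact h), mul_one]
      have := congrFun h s₀
      simp only [hk', Function.update_self] at this
      rw [← this]
      rfl
    · rw [indicator_of_notMem (by exact h), indicator_of_notMem (by exact h), mul_zero]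
  have hmeas := measurable_countVec hC
  simp_rw [hpt]
  rw [lintegral_indicator_const (hmeas (measurableSet_singleton _)),
    ← Measure.map_apply hmeas (measurableSet_singleton _),
    map_countVec_of_disjoint hP hC hvol hdisj, Measure.pi_singleton, Measure.pi_singleton,
    ← Finset.mul_prod_erase _ _ (Finset.mem_univ s₀),
    ← Finset.mul_prod_erase _ (fun s => poissonCount ν (volume.real (C s)) {k s})
      (Finset.mem_univ s₀), ← mul_assoc, ← mul_assoc]
  congr 1
  · simp only [hk', Function.update_self]
    exact succ_mul_poissonCount_succ (mul_nonneg hν.le measureReal_nonneg) _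
  · refine Finset.prod_congr rfl fun s hs => ?_
    rw [hk', Function.update_of_ne (Finset.ne_of_mem_erase hs)]

end

section

/-! ### The reduced Mecke formula and the joint law of all counts -/

variable {d : ℕ} {ν : ℝ} {P : Measure (Config d)}

/-- The measure `F ↦ E (∑ i, 1 (η i ∈ A) * 1 (X (η without η i) ∈ F))`. -/
noncomputable def reducedCampbell (P : Measure (Config d)) (A : Set (Space d))
    {E : Type*} [MeasurableSpace E] (X : Config d → E) : Measure E :=
  Measure.sum fun i => (P.restrict {η | η i ∈ A}).map (X ∘ removePoint i)

theorem measurableSet_eval_mem {A : Set (Space d)} (hA : MeasurableSet A) (i : ℕ) :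
    MeasurableSet {η : Config d | η i ∈ A} := measurable_pi_apply i hA

section ReducedCampbell

variable {E E' : Type*} [MeasurableSpace E] [MeasurableSpace E'] {X : Config d → E}

theorem reducedCampbell_apply {A : Set (Space d)} (hA : MeasurableSet A) (hX : Measurable X)
    {F : Set E} (hF : MeasurableSet F) :
    reducedCampbell P A X F = ∫⁻ η, ∑' i, A.indicator (fun _ => 1) (η i) *
        F.indicator (fun _ => 1) (X (removePoint i η)) ∂P := by
  have hmeas : ∀ i, Measurable fun η : Config d => A.indicator (fun _ => (1 : ℝ≥0∞)) (η i) *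
      F.indicator (fun _ => 1) (X (removePoint i η)) := fun i =>
    ((measurable_const.indicator hA).comp (measurable_pi_apply i)).mul
      ((measurable_const.indicator hF).comp (hX.comp (measurable_removePoint i)))
  rw [reducedCampbell, Measure.sum_apply _ hF, lintegral_tsum fun i => (hmeas i).aemeasurable]
  refine tsum_congr fun i => ?_
  have hm := hX.comp (measurable_removePoint i)
  rw [Measure.map_apply hm hF, Measure.restrict_apply (hm hF),
    ← lintegral_indicator_one ((hm hF).inter (measurableSet_eval_mem hA i))]
  refine lintegral_congr fun η => ?_
  by_cases h1 : η i ∈ A <;> by_cases h2 : X (removePoint i η) ∈ F <;>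
    simp [indicator, h1, h2]

theorem reducedCampbell_comp {A : Set (Space d)} (hX : Measurable X)
    {φ : E → E'} (hφ : Measurable φ) :
    reducedCampbell P A (φ ∘ X) = (reducedCampbell P A X).map φ := by
  rw [reducedCampbell, reducedCampbell, Measure.map_sum hφ.aemeasurable]
  congr 1
  funext i
  rw [Measure.map_map hφ (hX.comp (measurable_removePoint i))]
  rfl

end ReducedCampbell

theorem reducedCampbell_countVec_of_disjoint (hP : IsPoissonPointProcess ν P) (hν : 0 < ν)
    {S : Type*} [Fintype S] {C : S → Set (Space d)} (hC : ∀ s, MeasurableSet (C s))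
    (hvol : ∀ s, volume (C s) ≠ ∞) (hdisj : Pairwise fun s t => Disjoint (C s) (C t))
    (s₀ : S) :
    reducedCampbell P (C s₀) (countVec C) =
      (ENNReal.ofReal ν * volume (C s₀)) • P.map (countVec C) := by
  refine Measure.ext_of_singleton fun k => ?_
  rw [reducedCampbell_apply (hC s₀) (measurable_countVec hC) (measurableSet_singleton k),
    lintegral_removePoint_singleton hP hν hC hvol hdisj, Measure.smul_apply, smul_eq_mul,
    ENNReal.ofReal_mul hν.le, ofReal_measureReal (hvol s₀)]

theorem volume_eq_sum_atom {ι : Type*} [Fintype ι] [DecidableEq ι] {B : ι → Set (Space d)}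
    (hB : ∀ i, MeasurableSet (B i)) (i : ι) :
    volume (B i) = ∑ s : {s : Finset ι // s.Nonempty},
      if i ∈ s.1 then volume (atom B s.1) else 0 := by
  rw [← lintegral_indicator_one (hB i)]
  have h := fun x => indicator_eq_sum_atom (B := B) i x
  change ∫⁻ x, (B i).indicator (fun _ => (1 : ℝ≥0∞)) x = _
  simp_rw [h]
  have hm : ∀ s : {s : Finset ι // s.Nonempty}, Measurable fun x : Space d =>
      (atom B s.1).indicator (fun _ => (1 : ℝ≥0∞)) x := fun s =>
    measurable_const.indicator (measurableSet_atom hB s.1)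
  rw [lintegral_finsetSum]
  · refine Finset.sum_congr rfl fun s _ => ?_
    by_cases h : i ∈ s.1
    · simp only [h, if_true]
      exact lintegral_indicator_one (measurableSet_atom hB s.1)
    · simp [h]
  · intro s _
    by_cases h : i ∈ s.1
    · simpa only [h, if_true] using hm s
    · simp [h]

theorem volume_atom_ne_top {ι : Type*} {B : ι → Set (Space d)}
    (hvol : ∀ i, volume (B i) ≠ ∞) (s : {s : Finset ι // s.Nonempty}) :
    volume (atom B s.1) ≠ ∞ := by
  obtain ⟨i, hi⟩ := s.2
  exact ne_top_of_le_ne_top (hvol i) (measure_mono (atom_subset hi))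

theorem pairwise_disjoint_nonempty_atom {ι : Type*} (B : ι → Set (Space d)) :
    Pairwise fun s t : {s : Finset ι // s.Nonempty} => Disjoint (atom B s.1) (atom B t.1) :=
  fun _ _ hst => pairwise_disjoint_atom fun h => hst (Subtype.ext h)

/-- The reduced Mecke formula for the counts of finitely many sets, which are sums of the counts of
the disjoint atoms. -/
theorem reducedCampbell_countVec_of_fintype (hP : IsPoissonPointProcess ν P) (hν : 0 < ν)
    {ι : Type*} [Fintype ι] {B : ι → Set (Space d)} (hB : ∀ i, MeasurableSet (B i))
    (hvol : ∀ i, volume (B i) ≠ ∞) (i₀ : ι) :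
    reducedCampbell P (B i₀) (countVec B) =
      (ENNReal.ofReal ν * volume (B i₀)) • P.map (countVec B) := by
  classical
  set C : {s : Finset ι // s.Nonempty} → Set (Space d) := fun s => atom B s.1 with hC
  have hCm : ∀ s, MeasurableSet (C s) := fun s => measurableSet_atom hB s.1
  have hX := measurable_countVec hCm
  rw [countVec_eq_sumAtoms, reducedCampbell_comp hX measurable_sumAtoms,
    ← Measure.map_map measurable_sumAtoms hX, ← Measure.map_smul]
  congr 1
  ext F hF
  rw [reducedCampbell_apply (hB i₀) hX hF]
  have hone : ∀ s, ∫⁻ η, ∑' i, (C s).indicator (fun _ => 1) (η i) *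
        F.indicator (fun _ => 1) (countVec C (removePoint i η)) ∂P =
      ENNReal.ofReal ν * volume (C s) * P.map (countVec C) F := by
    intro s
    rw [← reducedCampbell_apply (hCm s) hX hF, reducedCampbell_countVec_of_disjoint hP hν hCm
      (volume_atom_ne_top hvol) (pairwise_disjoint_nonempty_atom B) s]
    rfl
  have hterm : ∀ (s : {s : Finset ι // s.Nonempty}) (i : ℕ), Measurable fun η : Config d =>
      (C s).indicator (fun _ => (1 : ℝ≥0∞)) (η i) *
        F.indicator (fun _ => 1) (countVec C (removePoint i η)) := fun s i =>
    ((measurable_const.indicator (hCm s)).comp (measurable_pi_apply i)).mul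
      ((measurable_const.indicator hF).comp (hX.comp (measurable_removePoint i)))
  have hpt : ∀ η : Config d, ∑' i, (B i₀).indicator (fun _ => (1 : ℝ≥0∞)) (η i) *
        F.indicator (fun _ => 1) (countVec C (removePoint i η)) =
      ∑ s, if i₀ ∈ s.1 then ∑' i, (C s).indicator (fun _ => (1 : ℝ≥0∞)) (η i) *
        F.indicator (fun _ => 1) (countVec C (removePoint i η)) else 0 := by
    intro η
    simp_rw [indicator_eq_sum_atom i₀, Finset.sum_mul]
    rw [Summable.tsum_finsetSum fun _ _ => ENNReal.summable]
    refine Finset.sum_congr rfl fun s _ => ?_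
    by_cases h : i₀ ∈ s.1 <;> simp [h, hC]
  simp_rw [hpt]
  rw [lintegral_finsetSum, Measure.smul_apply, smul_eq_mul, volume_eq_sum_atom hB i₀,
    Finset.mul_sum, Finset.sum_mul]
  · refine Finset.sum_congr rfl fun s _ => ?_
    by_cases h : i₀ ∈ s.1
    · simp only [h, if_true]
      exact hone s
    · simp [h]
  · intro s _
    by_cases h : i₀ ∈ s.1
    · simpa only [h, if_true] using Measurable.tsum (hterm s)
    · simp [h]

/-- The reduced Mecke formula for the counts of an arbitrary family of sets. -/
theorem reducedCampbell_countVec (hP : IsPoissonPointProcess ν P) (hν : 0 < ν)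
    {T : Type*} {B : T → Set (Space d)} (hB : ∀ t, MeasurableSet (B t))
    (hvol : ∀ t, volume (B t) ≠ ∞) {A : Set (Space d)} (hA : MeasurableSet A)
    (hAvol : volume A ≠ ∞) :
    reducedCampbell P A (countVec B) = (ENNReal.ofReal ν * volume A) • P.map (countVec B) := by
  have := hP.isProbabilityMeasure
  have hX := measurable_countVec hB
  have := Measure.isProbabilityMeasure_map (μ := P) hX.aemeasurable
  have hfin : IsFiniteMeasure ((ENNReal.ofReal ν * volume A) • P.map (countVec B)) :=
    Measure.smul_finite _ (ENNReal.mul_ne_top ENNReal.ofReal_ne_top hAvol)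
  refine IsProjectiveLimit.unique (P := fun I : Finset T =>
    ((ENNReal.ofReal ν * volume A) • P.map (countVec B)).map I.restrict) (fun I => ?_)
    fun I => rfl
  have hIm : Measurable (I.restrict : (T → ℕ∞) → _) := Finset.measurable_restrict I
  set B' : Option I → Set (Space d) := fun o => o.elim A fun t => B t.1 with hB'
  have hB'm : ∀ o, MeasurableSet (B' o) := by
    rintro (_ | t)
    · exact hA
    · exact hB t.1
  have hB'vol : ∀ o, volume (B' o) ≠ ∞ := by
    rintro (_ | t)
    · exact hAvol
    · exact hvol t.1
  set φ : (Option I → ℕ∞) → (I → ℕ∞) := fun v t => v (some t) with hφ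
  have hφm : Measurable φ := measurable_pi_iff.2 fun t => measurable_pi_apply _
  have hcomp : I.restrict ∘ countVec B = φ ∘ countVec B' := rfl
  have key := reducedCampbell_countVec_of_fintype hP hν hB'm hB'vol none
  beta_reduce
  rw [Measure.map_smul, Measure.map_map hIm hX, ← reducedCampbell_comp hX hIm, hcomp,
    reducedCampbell_comp (measurable_countVec hB'm) hφm, ← Measure.map_map hφm
    (measurable_countVec hB'm), ← Measure.map_smul]
  exact congrArg _ key

/-- The intensity and the independence properties determine the joint law of all counts. -/
theorem map_countVec_unique {P' : Measure (Config d)} (hP : IsPoissonPointProcess ν P)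
    (hP' : IsPoissonPointProcess ν P') {T : Type*} {B : T → Set (Space d)}
    (hB : ∀ t, MeasurableSet (B t)) (hvol : ∀ t, volume (B t) ≠ ∞) :
    P.map (countVec B) = P'.map (countVec B) := by
  have := hP.isProbabilityMeasure
  have := hP'.isProbabilityMeasure
  have hX := measurable_countVec hB
  have := Measure.isProbabilityMeasure_map (μ := P') hX.aemeasurable
  refine IsProjectiveLimit.unique (P := fun I : Finset T =>
    (P'.map (countVec B)).map I.restrict) (fun I => ?_) fun I => rfl
  have hIm : Measurable (I.restrict : (T → ℕ∞) → _) := Finset.measurable_restrict I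
  have hBI : ∀ t : I, MeasurableSet (B t) := fun t => hB t
  have hCm : ∀ s : {s : Finset I // s.Nonempty}, MeasurableSet (atom (fun t : I => B t) s.1) :=
    fun s => measurableSet_atom hBI s.1
  have hcomp : I.restrict ∘ countVec B = countVec fun t : I => B t := rfl
  beta_reduce
  rw [Measure.map_map hIm hX, Measure.map_map hIm hX, hcomp, countVec_eq_sumAtoms,
    ← Measure.map_map measurable_sumAtoms (measurable_countVec hCm),
    ← Measure.map_map measurable_sumAtoms (measurable_countVec hCm),
    map_countVec_of_disjoint hP hCm (volume_atom_ne_top fun t => hvol t)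
      (pairwise_disjoint_nonempty_atom _),
    map_countVec_of_disjoint hP' hCm (volume_atom_ne_top fun t => hvol t)
      (pairwise_disjoint_nonempty_atom _)]

/-- The counts in subsets of a set are independent of the counts in subsets of a disjoint set. -/
theorem indepFun_countVec (hP : IsPoissonPointProcess ν P) {T T' : Type*}
    {B : T → Set (Space d)} {B' : T' → Set (Space d)} (hB : ∀ t, MeasurableSet (B t))
    (hB' : ∀ t, MeasurableSet (B' t)) {A A' : Set (Space d)} (hA : ∀ t, B t ⊆ A)
    (hA' : ∀ t, B' t ⊆ A') (hdisj : Disjoint A A') :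
    IndepFun (countVec B) (countVec B') P := by
  classical
  have := hP.isProbabilityMeasure
  refine IndepFun.process_indepFun_process (fun t => measurable_pointCount (hB t))
    (fun t => measurable_pointCount (hB' t)) fun I J => ?_
  set b : I → Set (Space d) := fun t => B t
  set b' : J → Set (Space d) := fun t => B' t
  set S := {s : Finset I // s.Nonempty}
  set S' := {s : Finset J // s.Nonempty}
  set C : S ⊕ S' → Set (Space d) := Sum.elim (fun s => atom b s.1) fun s => atom b' s.1 with hC
  have hCm : ∀ s, MeasurableSet (C s) := by
    rintro (s | s)
    · exact measurableSet_atom (fun t : I => hB t) s.1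
    · exact measurableSet_atom (fun t : J => hB' t) s.1
  have hsub : ∀ s : S, atom b s.1 ⊆ A := fun s => by
    obtain ⟨t, ht⟩ := s.2
    exact (atom_subset ht).trans (hA t)
  have hsub' : ∀ s : S', atom b' s.1 ⊆ A' := fun s => by
    obtain ⟨t, ht⟩ := s.2
    exact (atom_subset ht).trans (hA' t)
  have hCd : Pairwise fun s t => Disjoint (C s) (C t) := by
    rintro (s | s) (t | t) hst
    · exact pairwise_disjoint_nonempty_atom b fun h => hst (by rw [h])
    · exact hdisj.mono (hsub s) (hsub' t)
    · exact (hdisj.mono (hsub t) (hsub' s)).symm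
    · exact pairwise_disjoint_nonempty_atom b' fun h => hst (by rw [h])
  have hind := (iIndepFun_pointCount hP hCm hCd).indepFun_finset
    (Finset.univ.map Function.Embedding.inl) (Finset.univ.map Function.Embedding.inr)
    (by simp [Finset.disjoint_left]) fun s => measurable_pointCount (hCm s)
  have hfin := hind.comp
    (φ := fun v => sumAtoms I fun s : S => v ⟨Sum.inl s, by simp⟩)
    (ψ := fun v => sumAtoms J fun s : S' => v ⟨Sum.inr s, by simp⟩)
    (measurable_sumAtoms.comp (measurable_pi_iff.2 fun s => measurable_pi_apply _))
    (measurable_sumAtoms.comp (measurable_pi_iff.2 fun s => measurable_pi_apply _))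
  have h1 : (fun (η : Config d) (t : I) => countVec B η t) = countVec b := rfl
  have h2 : (fun (η : Config d) (t : J) => countVec B' η t) = countVec b' := rfl
  change IndepFun (fun (η : Config d) (t : I) => countVec B η t)
    (fun (η : Config d) (t : J) => countVec B' η t) P
  rw [h1, h2, countVec_eq_sumAtoms (B := b), countVec_eq_sumAtoms (B := b')]
  exact hfin

theorem measure_ext_of_volume_ne_top {m₁ m₂ : Measure (Space d)}
    (h : ∀ A, MeasurableSet A → volume A ≠ ∞ → m₁ A = m₂ A) : m₁ = m₂ := by
  ext A hA
  have hU : A = ⋃ n : ℕ, A ∩ Metric.closedBall 0 n := by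
    rw [← inter_iUnion, Metric.iUnion_closedBall_nat, inter_univ]
  have hmono : Monotone fun n : ℕ => A ∩ Metric.closedBall (0 : Space d) n := fun m n hmn =>
    inter_subset_inter_right _ (Metric.closedBall_subset_closedBall (by exact_mod_cast hmn))
  rw [hU, hmono.measure_iUnion, hmono.measure_iUnion]
  congr 1
  funext n
  exact h _ (hA.inter measurableSet_closedBall)
    (ne_top_of_le_ne_top measure_closedBall_lt_top.ne (measure_mono inter_subset_right))

/-- The reduced Mecke formula as an identity of measures: the law of a point together with the
counts of the other points is a product measure. -/
theorem sum_map_point_countVec (hP : IsPoissonPointProcess ν P) (hν : 0 < ν)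
    {T : Type*} {B : T → Set (Space d)} (hB : ∀ t, MeasurableSet (B t))
    (hvol : ∀ t, volume (B t) ≠ ∞) :
    Measure.sum (fun i => P.map fun η => (η i, countVec B (removePoint i η))) =
      (ENNReal.ofReal ν • (volume : Measure (Space d))).prod (P.map (countVec B)) := by
  have := hP.isProbabilityMeasure
  have hX := measurable_countVec hB
  have := Measure.isProbabilityMeasure_map (μ := P) hX.aemeasurable
  set M := Measure.sum fun i => P.map fun η => (η i, countVec B (removePoint i η)) with hM
  have hmap : ∀ i, Measurable fun η : Config d => (η i, countVec B (removePoint i η)) := fun i =>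
    (measurable_pi_apply i).prodMk (hX.comp (measurable_removePoint i))
  have hrect : ∀ s t, MeasurableSet s → MeasurableSet t →
      M (s ×ˢ t) = reducedCampbell P s (countVec B) t := by
    intro s t hs ht
    rw [hM, Measure.sum_apply _ (hs.prod ht), reducedCampbell, Measure.sum_apply _ ht]
    refine tsum_congr fun i => ?_
    have hm := hX.comp (measurable_removePoint i)
    rw [Measure.map_apply (hmap i) (hs.prod ht), Measure.map_apply hm ht,
      Measure.restrict_apply (hm ht)]
    congr 1
    ext η
    exact and_comm
  have : SigmaFinite (ENNReal.ofReal ν • (volume : Measure (Space d))) :=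
    inferInstanceAs (SigmaFinite (ν.toNNReal • (volume : Measure (Space d))))
  symm
  refine Measure.prod_eq fun s t hs ht => ?_
  -- The rectangles are known for `s` of finite volume only; as measures of `s`, with `t` fixed, both
  -- sides are determined by these.
  have hslice : (M.restrict (univ ×ˢ t)).map Prod.fst =
      P.map (countVec B) t • ENNReal.ofReal ν • (volume : Measure (Space d)) := by
    refine measure_ext_of_volume_ne_top fun A hA hAvol => ?_
    rw [Measure.map_apply measurable_fst hA, Measure.restrict_apply (measurable_fst hA)]
    have : Prod.fst ⁻¹' A ∩ univ ×ˢ t = A ×ˢ t := by ext; simp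
    rw [this, hrect A t hA ht, reducedCampbell_countVec hP hν hB hvol hA hAvol]
    simp only [Measure.smul_apply, smul_eq_mul]
    ring
  have h := congrArg (fun m => m s) hslice
  simp only [Measure.map_apply measurable_fst hs, Measure.restrict_apply (measurable_fst hs)] at h
  have : Prod.fst ⁻¹' s ∩ univ ×ˢ t = s ×ˢ t := by ext; simp
  rw [this] at h
  rw [h]
  simp only [Measure.smul_apply, smul_eq_mul]
  ring

end

section

/-! ### Symmetric functionals of a configuration as functions of its counts -/

variable {d : ℕ} {ν : ℝ} {P : Measure (Config d)}

/-- A sequence can be sorted if only finitely many of its terms come before a given one; ties are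
broken by the index. -/
theorem exists_perm_monotone {β : Type*} [LinearOrder β] (κ : ℕ → β)
    (h : ∀ i, {j | κ j < κ i ∨ (κ j = κ i ∧ j < i)}.Finite) :
    ∃ σ : Equiv.Perm ℕ, Monotone (κ ∘ σ) := by
  set D : ℕ → Finset ℕ := fun i => (h i).toFinset with hD
  have hmem : ∀ i j, j ∈ D i ↔ κ j < κ i ∨ (κ j = κ i ∧ j < i) := fun i j => by simp [hD]
  -- `r i` is the rank of `i`; it is a bijection, whose inverse sorts the sequence.
  set r : ℕ → ℕ := fun i => (D i).card with hr
  have hlt : ∀ i j, j ∈ D i → r j < r i := by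
    intro i j hj
    refine Finset.card_lt_card ⟨fun k hk => ?_, fun hsub => ?_⟩
    · rw [hmem] at hj hk ⊢
      rcases hj with hj | ⟨hj, hj'⟩ <;> rcases hk with hk | ⟨hk, hk'⟩
      · exact Or.inl (hk.trans hj)
      · exact Or.inl (hk ▸ hj)
      · exact Or.inl (hj ▸ hk)
      · exact Or.inr ⟨hk.trans hj, hk'.trans hj'⟩
    · have := (hmem j j).1 (hsub hj)
      simp at this
  have hinj : Function.Injective r := by
    intro i j hij
    by_contra hne
    have : i ∈ D j ∨ j ∈ D i := by
      rw [hmem, hmem]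
      rcases lt_trichotomy (κ i) (κ j) with hκ | hκ | hκ
      · exact Or.inl (Or.inl hκ)
      · rcases lt_or_gt_of_ne hne with hl | hl
        · exact Or.inl (Or.inr ⟨hκ, hl⟩)
        · exact Or.inr (Or.inr ⟨hκ.symm, hl⟩)
      · exact Or.inr (Or.inl hκ)
    rcases this with h' | h'
    · exact (hlt _ _ h').ne hij
    · exact (hlt _ _ h').ne hij.symm
  have hdown : ∀ i n, n < r i → n ∈ range r := by
    intro i n hn
    have himg : (D i).image r = Finset.range (r i) := by
      refine Finset.eq_of_subset_of_card_le (fun k hk => ?_) ?_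
      · obtain ⟨j, hj, rfl⟩ := Finset.mem_image.1 hk
        exact Finset.mem_range.2 (hlt i j hj)
      · rw [Finset.card_range, Finset.card_image_of_injective _ hinj]
    have : n ∈ (D i).image r := himg ▸ Finset.mem_range.2 hn
    obtain ⟨j, -, hj⟩ := Finset.mem_image.1 this
    exact ⟨j, hj⟩
  have hsurj : Function.Surjective r := by
    intro n
    obtain ⟨m, ⟨i, rfl⟩, hm⟩ := (infinite_range_of_injective hinj).exists_gt n
    exact hdown i n hm
  refine ⟨(Equiv.ofBijective r ⟨hinj, hsurj⟩).symm, fun a b hab => ?_⟩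
  set e := Equiv.ofBijective r ⟨hinj, hsurj⟩
  by_contra hcon
  have h1 : e.symm b ∈ D (e.symm a) := (hmem _ _).2 (Or.inl (not_le.1 hcon))
  have h2 := hlt _ _ h1
  have h3 : ∀ c, r (e.symm c) = c := fun c => e.apply_symm_apply c
  rw [h3, h3] at h2
  exact absurd hab (not_le.2 h2)

/-- An injective measurable real-valued function on `ℝ^d` whose sublevel sets are bounded; sorting
points by it enumerates a configuration in a way that depends only on its counts. -/
noncomputable def sortKey (x : Space d) : ℝ :=
  (⌊‖x‖⌋₊ : ℝ) + Real.sigmoid (embeddingReal (Space d) x)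

theorem measurable_sortKey : Measurable (sortKey : Space d → ℝ) := by
  have h1 : Measurable fun x : Space d => ((⌊‖x‖⌋₊ : ℕ) : ℝ) :=
    Measurable.of_discrete.comp (Nat.measurable_floor.comp measurable_norm)
  have h2 : Measurable Real.sigmoid := by unfold Real.sigmoid; fun_prop
  exact h1.add (h2.comp (measurableEmbedding_embeddingReal _).measurable)

theorem norm_lt_sortKey_add_one (x : Space d) : ‖x‖ < sortKey x + 1 := by
  have h1 := Nat.lt_floor_add_one ‖x‖
  have h2 := Real.sigmoid_pos (embeddingReal (Space d) x)
  unfold sortKey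
  linarith

theorem sortKey_injective : Function.Injective (sortKey : Space d → ℝ) := by
  have hfl : ∀ x : Space d, ⌊sortKey x⌋ = (⌊‖x‖⌋₊ : ℤ) := by
    intro x
    have h2 := Real.sigmoid_pos (embeddingReal (Space d) x)
    have h3 := Real.sigmoid_lt_one (embeddingReal (Space d) x)
    rw [Int.floor_eq_iff]
    unfold sortKey
    push_cast
    exact ⟨by linarith, by linarith⟩
  intro x y hxy
  have h1 : (⌊‖x‖⌋₊ : ℤ) = ⌊‖y‖⌋₊ := by rw [← hfl, ← hfl, hxy]
  have h2 : ⌊‖x‖⌋₊ = ⌊‖y‖⌋₊ := by exact_mod_cast h1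
  unfold sortKey at hxy
  rw [h2, add_right_inj] at hxy
  exact (measurableEmbedding_embeddingReal _).injective (Real.sigmoid_injective hxy)

theorem measurableEmbedding_sortKey : MeasurableEmbedding (sortKey : Space d → ℝ) :=
  measurable_sortKey.measurableEmbedding sortKey_injective

/-- The points of `A` with sorting key at most `q`. -/
def keySet (A : Set (Space d)) (q : ℚ) : Set (Space d) := {x | x ∈ A ∧ sortKey x ≤ q}

theorem measurableSet_keySet {A : Set (Space d)} (hA : MeasurableSet A) (q : ℚ) :
    MeasurableSet (keySet A q) :=
  hA.inter (measurableSet_le measurable_sortKey measurable_const)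

theorem volume_keySet_ne_top (A : Set (Space d)) (q : ℚ) : volume (keySet A q) ≠ ∞ := by
  refine ne_top_of_le_ne_top (measure_closedBall_lt_top (x := (0 : Space d)) (r := q + 1)).ne
    (measure_mono fun x hx => ?_)
  rw [mem_closedBall_zero_iff]
  have := norm_lt_sortKey_add_one x
  have := hx.2
  linarith

/-- The `i`-th smallest sorting key of a point, if the number of points with key at most `q` is
`N q`; it is `⊤` if there are at most `i` points. -/
noncomputable def nthKey (N : ℚ → ℕ∞) (i : ℕ) : EReal :=
  ⨅ q : ℚ, {N : ℚ → ℕ∞ | (i : ℕ∞) + 1 ≤ N q}.piecewise (fun _ => ((q : ℝ) : EReal))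
    (fun _ => ⊤) N

open Classical in
/-- A configuration with the counts `N`, with `p` in place of missing points. -/
noncomputable def reconstruct (p : Space d) (N : ℚ → ℕ∞) : Config d := fun i =>
  if nthKey N i = ⊤ then p else measurableEmbedding_sortKey.invFun (nthKey N i).toReal

theorem measurable_nthKey (i : ℕ) : Measurable fun N => nthKey N i := by
  classical
  refine Measurable.iInf fun q => Measurable.piecewise ?_ measurable_const measurable_const
  have h : MeasurableSet {n : ℕ∞ | (i : ℕ∞) + 1 ≤ n} := MeasurableSet.of_discrete
  exact measurable_pi_apply (X := fun _ : ℚ => ℕ∞) q h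

theorem measurable_reconstruct (p : Space d) : Measurable (reconstruct p) := by
  refine measurable_pi_iff.2 fun i => Measurable.ite ?_ measurable_const ?_
  · exact measurable_nthKey i (measurableSet_singleton ⊤)
  · exact measurableEmbedding_sortKey.measurable_invFun.comp
      (measurable_ereal_toReal.comp (measurable_nthKey i))

open Classical in
/-- The configuration `η` with all points outside of `A` moved to `p`. -/
noncomputable def maskOutside (A : Set (Space d)) (p : Space d) (η : Config d) : Config d :=
  fun i => if η i ∈ A then η i else p

theorem maskOutside_univ (p : Space d) (η : Config d) : maskOutside univ p η = η := by
  funext i; simp [maskOutside]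

theorem mem_of_isLowerSet_iff {S : Set ℕ} (hS : IsLowerSet S) (i : ℕ) :
    i ∈ S ↔ (i : ℕ∞) + 1 ≤ S.encard := by
  constructor
  · intro hi
    have hsub : ((Finset.range (i + 1) : Finset ℕ) : Set ℕ) ⊆ S := fun j hj =>
      hS (Nat.lt_succ_iff.1 (Finset.mem_range.1 hj)) hi
    have := encard_le_encard hsub
    rw [encard_coe_eq_coe_finsetCard, Finset.card_range] at this
    exact_mod_cast this
  · intro h
    by_contra hi
    have hsub : S ⊆ ((Finset.range i : Finset ℕ) : Set ℕ) := fun j hj => by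
      simp only [Finset.coe_range, mem_Iio]
      by_contra hij
      exact hi (hS (not_lt.1 hij) hj)
    have := h.trans (encard_le_encard hsub)
    rw [encard_coe_eq_coe_finsetCard, Finset.card_range] at this
    have h' : i + 1 ≤ i := by exact_mod_cast this
    lia

theorem iInf_rat_ge_eq (x : EReal) :
    ⨅ q : ℚ, (open Classical in if x ≤ ((q : ℝ) : EReal) then ((q : ℝ) : EReal) else ⊤) = x := by
  classical
  refine le_antisymm (le_of_forall_gt fun b hb => ?_) (le_iInf fun q => ?_)
  · obtain ⟨q, hq1, hq2⟩ := EReal.lt_iff_exists_rat_btwn.1 hb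
    refine lt_of_le_of_lt (iInf_le _ q) ?_
    rw [if_pos hq1.le]
    exact hq2
  · split_ifs with h
    · exact h
    · exact le_top

/-- From the counts of the points in `A` the configuration of these points is recovered, up to
the order of the points. The hypotheses say that the points in `A` can be sorted by their keys, and
that they are finitely many unless all points are in `A`. -/
theorem exists_perm_reconstruct (A : Set (Space d)) (p : Space d) (η : Config d)
    (h1 : ∀ i, {j | η j ∈ A ∧ sortKey (η j) ≤ sortKey (η i)}.Finite)
    (h2 : (∃ i, η i ∉ A) → {j | η j ∈ A}.Finite) :
    ∃ σ : Equiv.Perm ℕ, reconstruct p (countVec (keySet A) η) = maskOutside A p η ∘ σ := by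
  classical
  set κ : ℕ → EReal := fun i => if η i ∈ A then ((sortKey (η i) : ℝ) : EReal) else ⊤ with hκ
  have hκA : ∀ i, η i ∈ A → κ i = ((sortKey (η i) : ℝ) : EReal) := fun i hi => if_pos hi
  have hκA' : ∀ i, η i ∉ A → κ i = ⊤ := fun i hi => if_neg hi
  obtain ⟨σ, hσ⟩ := exists_perm_monotone κ fun i => by
    by_cases hi : η i ∈ A
    · refine (h1 i).subset fun j hj => ?_
      have hle : κ j ≤ κ i := by
        rcases hj with hj | hj
        · exact hj.le
        · exact hj.1.le
      rw [hκA i hi] at hle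
      by_cases hj : η j ∈ A
      · rw [hκA j hj] at hle
        exact ⟨hj, EReal.coe_le_coe_iff.1 hle⟩
      · rw [hκA' j hj] at hle
        exact absurd hle (not_le.2 (EReal.coe_lt_top _))
    · refine ((h2 ⟨i, hi⟩).union (finite_lt_nat i)).subset fun j hj => ?_
      by_cases hjA : η j ∈ A
      · exact Or.inl hjA
      · refine Or.inr (hj.resolve_left ?_).2
        rw [hκA' i hi, hκA' j hjA]
        exact lt_irrefl _
  refine ⟨σ, ?_⟩
  have hcount : ∀ q : ℚ, countVec (keySet A) η q =
      {i | κ (σ i) ≤ ((q : ℝ) : EReal)}.encard := by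
    intro q
    have hset : {i | η i ∈ keySet A q} = σ '' {i | κ (σ i) ≤ ((q : ℝ) : EReal)} := by
      have himg : σ '' {i | κ (σ i) ≤ ((q : ℝ) : EReal)} = {i | κ i ≤ ((q : ℝ) : EReal)} := by
        ext i
        constructor
        · rintro ⟨j, hj, rfl⟩; exact hj
        · intro hi; exact ⟨σ.symm i, by simpa using hi, by simp⟩
      rw [himg]
      ext i
      by_cases hi : η i ∈ A
      · change (η i ∈ A ∧ sortKey (η i) ≤ q) ↔ κ i ≤ _
        rw [hκA i hi, EReal.coe_le_coe_iff]
        simp [hi]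
      · change (η i ∈ A ∧ sortKey (η i) ≤ q) ↔ κ i ≤ _
        rw [hκA' i hi]
        simp [hi]
    change {i | η i ∈ keySet A q}.encard = _
    rw [hset, σ.injective.encard_image]
  have hkey : ∀ i, nthKey (countVec (keySet A) η) i = κ (σ i) := by
    intro i
    rw [← iInf_rat_ge_eq (κ (σ i)), nthKey]
    refine iInf_congr fun q => ?_
    have hiff : (i : ℕ∞) + 1 ≤ countVec (keySet A) η q ↔ κ (σ i) ≤ ((q : ℝ) : EReal) := by
      rw [hcount]
      exact (mem_of_isLowerSet_iff (S := {i | κ (σ i) ≤ ((q : ℝ) : EReal)})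
        (fun a b hba ha => (hσ hba).trans ha) i).symm
    by_cases h : κ (σ i) ≤ ((q : ℝ) : EReal)
    · rw [if_pos h, piecewise_eq_of_mem _ _ _ (by exact hiff.2 h)]
    · rw [if_neg h, piecewise_eq_of_notMem _ _ _ (by exact fun h' => h (hiff.1 h'))]
  funext i
  rw [reconstruct, hkey, Function.comp_apply, maskOutside]
  by_cases h : η (σ i) ∈ A
  · rw [hκA _ h, if_neg (EReal.coe_ne_top _), if_pos h, EReal.toReal_coe]
    exact measurableEmbedding_sortKey.leftInverse_invFun _
  · rw [hκA' _ h, if_pos rfl, if_neg h]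

/-- Only finitely many points of `η` lie in every bounded set. -/
def IsLocallyFinite (η : Config d) : Prop := ∀ n : ℕ, {i | ‖η i‖ ≤ n}.Finite

theorem finite_of_pointCount_ne_top {A : Set (Space d)} {η : Config d}
    (h : pointCount A η ≠ ⊤) : {i | η i ∈ A}.Finite := encard_ne_top_iff.1 h

theorem ae_isLocallyFinite (hP : IsPoissonPointProcess ν P) : ∀ᵐ η ∂P, IsLocallyFinite η := by
  refine ae_all_iff.2 fun n => ?_
  filter_upwards [ae_pointCount_ne_top hP (measurableSet_closedBall (x := (0 : Space d))
    (ε := (n : ℝ))) measure_closedBall_lt_top.ne] with η hη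
  simpa using finite_of_pointCount_ne_top hη

theorem IsLocallyFinite.finite_of_bounded {η : Config d} (hη : IsLocallyFinite η)
    {A : Set (Space d)} {r : ℝ} (hA : ∀ x ∈ A, ‖x‖ ≤ r) : {i | η i ∈ A}.Finite := by
  obtain ⟨n, hn⟩ := exists_nat_ge r
  exact (hη n).subset fun i hi => (hA _ hi).trans hn

theorem IsLocallyFinite.removePoint {η : Config d} (hη : IsLocallyFinite η) (i : ℕ) :
    IsLocallyFinite (removePoint i η) := fun n =>
  (hη n).preimage (f := fun j => Equiv.swap 0 i (j + 1))
    (fun a _ b _ hab => by simpa using hab)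

/-- A symmetric functional of a locally finite configuration is a function of its counts. -/
theorem apply_eq_reconstruct {β : Type*} {f : Config d → β}
    (hf : ∀ η (σ : Equiv.Perm ℕ), f (η ∘ σ) = f η) {η : Config d} (hη : IsLocallyFinite η) :
    f η = f (reconstruct 0 (countVec (keySet univ) η)) := by
  have hfin : ∀ i, {j | η j ∈ univ ∧ sortKey (η j) ≤ sortKey (η i)}.Finite := fun i =>
    hη.finite_of_bounded (A := {x | x ∈ univ ∧ sortKey x ≤ sortKey (η i)})
      (r := sortKey (η i) + 1) fun x hx => by
        have := norm_lt_sortKey_add_one x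
        have := hx.2
        linarith
  obtain ⟨σ, hσ⟩ := exists_perm_reconstruct univ 0 η hfin fun ⟨i, hi⟩ => (hi (mem_univ _)).elim
  rw [hσ, hf, maskOutside_univ]

/-- A symmetric functional of the finitely many points in `A` is a function of the counts of the
subsets of `A`. -/
theorem apply_eq_reconstruct_of_maskOutside {β : Type*} {f : Config d → β}
    (hf : ∀ η (σ : Equiv.Perm ℕ), f (η ∘ σ) = f η) {A : Set (Space d)} {p : Space d}
    (hfA : ∀ η, f (maskOutside A p η) = f η) {η : Config d} (hη : {i | η i ∈ A}.Finite) :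
    f η = f (reconstruct p (countVec (keySet A) η)) := by
  obtain ⟨σ, hσ⟩ := exists_perm_reconstruct A p η (fun i => hη.subset fun j hj => hj.1)
    fun _ => hη
  rw [hσ, hf, hfA]

theorem measurable_countVec_keySet {A : Set (Space d)} (hA : MeasurableSet A) :
    Measurable (countVec (keySet A)) := measurable_countVec (measurableSet_keySet hA)

/-- The expectation of a symmetric functional is the same for all Poisson processes of the same
intensity, however their points are enumerated. -/
theorem lintegral_symmetric_unique {P' : Measure (Config d)} (hP : IsPoissonPointProcess ν P)
    (hP' : IsPoissonPointProcess ν P') {f : Config d → ℝ≥0∞} (hfm : Measurable f)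
    (hf : ∀ η (σ : Equiv.Perm ℕ), f (η ∘ σ) = f η) : ∫⁻ η, f η ∂P = ∫⁻ η, f η ∂P' := by
  have hX := measurable_countVec_keySet (d := d) MeasurableSet.univ
  have key : ∀ Q : Measure (Config d), IsPoissonPointProcess ν Q → ∫⁻ η, f η ∂Q =
      ∫⁻ N, f (reconstruct 0 N) ∂(Q.map (countVec (keySet univ))) := by
    intro Q hQ
    rw [lintegral_map (f := fun N => f (reconstruct 0 N))
      (hfm.comp (measurable_reconstruct 0)) hX]
    exact lintegral_congr_ae ((ae_isLocallyFinite hQ).mono fun η hη => apply_eq_reconstruct hf hη)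
  rw [key P hP, key P' hP', map_countVec_unique hP hP'
    (measurableSet_keySet MeasurableSet.univ) (volume_keySet_ne_top univ)]

/-- The reduced Mecke formula for functionals that are symmetric in the configuration. -/
theorem lintegral_tsum_removePoint (hP : IsPoissonPointProcess ν P) (hν : 0 < ν)
    {F : Space d → Config d → ℝ≥0∞} (hFm : Measurable fun p : Space d × Config d => F p.1 p.2)
    (hF : ∀ x η (σ : Equiv.Perm ℕ), F x (η ∘ σ) = F x η) :
    ∫⁻ η, ∑' i, F (η i) (removePoint i η) ∂P =
      ENNReal.ofReal ν * ∫⁻ x, ∫⁻ η, F x η ∂P := by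
  have := hP.isProbabilityMeasure
  have hX := measurable_countVec_keySet (d := d) MeasurableSet.univ
  have := Measure.isProbabilityMeasure_map (μ := P) hX.aemeasurable
  set f : Space d × (ℚ → ℕ∞) → ℝ≥0∞ := fun p => F p.1 (reconstruct 0 p.2) with hf
  have hfm : Measurable f :=
    hFm.comp (measurable_fst.prodMk ((measurable_reconstruct 0).comp measurable_snd))
  have hmap : ∀ i, Measurable fun η : Config d =>
      (η i, countVec (keySet univ) (removePoint i η)) := fun i =>
    (measurable_pi_apply i).prodMk (hX.comp (measurable_removePoint i))
  have hσ : SigmaFinite (ENNReal.ofReal ν • (volume : Measure (Space d))) :=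
    inferInstanceAs (SigmaFinite (ν.toNNReal • (volume : Measure (Space d))))
  calc ∫⁻ η, ∑' i, F (η i) (removePoint i η) ∂P
      = ∫⁻ η, ∑' i, f (η i, countVec (keySet univ) (removePoint i η)) ∂P := by
        refine lintegral_congr_ae ((ae_isLocallyFinite hP).mono fun η hη => ?_)
        exact tsum_congr fun i => apply_eq_reconstruct (hF (η i)) (hη.removePoint i)
    _ = ∑' i, ∫⁻ η, f (η i, countVec (keySet univ) (removePoint i η)) ∂P :=
        lintegral_tsum fun i => (hfm.comp (hmap i)).aemeasurable
    _ = ∫⁻ p, f p ∂(Measure.sum fun i => P.map fun η =>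
          (η i, countVec (keySet univ) (removePoint i η))) := by
        rw [lintegral_sum_measure]
        exact tsum_congr fun i => (lintegral_map hfm (hmap i)).symm
    _ = ENNReal.ofReal ν * ∫⁻ x, ∫⁻ N, f (x, N) ∂(P.map (countVec (keySet univ))) := by
        rw [sum_map_point_countVec hP hν (measurableSet_keySet MeasurableSet.univ)
          (volume_keySet_ne_top univ), lintegral_prod _ hfm.aemeasurable, lintegral_smul_measure,
          smul_eq_mul]
    _ = _ := by
        congr 1
        refine lintegral_congr fun x => ?_
        rw [lintegral_map (f := fun N => f (x, N)) (hfm.comp measurable_prodMk_left) hX]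
        exact lintegral_congr_ae ((ae_isLocallyFinite hP).mono fun η hη =>
          (apply_eq_reconstruct (hF x) hη).symm)

/-- Symmetric functionals of the points in disjoint sets are independent. -/
theorem lintegral_mul_of_disjoint (hP : IsPoissonPointProcess ν P) {A A' : Set (Space d)}
    (hA : MeasurableSet A) (hA' : MeasurableSet A') (hAvol : volume A ≠ ∞)
    (hAvol' : volume A' ≠ ∞) (hdisj : Disjoint A A') {f g : Config d → ℝ≥0∞}
    (hfm : Measurable f) (hgm : Measurable g) (hf : ∀ η (σ : Equiv.Perm ℕ), f (η ∘ σ) = f η)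
    (hg : ∀ η (σ : Equiv.Perm ℕ), g (η ∘ σ) = g η) {p p' : Space d}
    (hfA : ∀ η, f (maskOutside A p η) = f η) (hgA : ∀ η, g (maskOutside A' p' η) = g η) :
    ∫⁻ η, f η * g η ∂P = (∫⁻ η, f η ∂P) * ∫⁻ η, g η ∂P := by
  have h1 : f =ᵐ[P] fun η => f (reconstruct p (countVec (keySet A) η)) :=
    (ae_pointCount_ne_top hP hA hAvol).mono fun η hη =>
      apply_eq_reconstruct_of_maskOutside hf hfA (finite_of_pointCount_ne_top hη)
  have h2 : g =ᵐ[P] fun η => g (reconstruct p' (countVec (keySet A') η)) :=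
    (ae_pointCount_ne_top hP hA' hAvol').mono fun η hη =>
      apply_eq_reconstruct_of_maskOutside hg hgA (finite_of_pointCount_ne_top hη)
  have hind := (indepFun_countVec hP (measurableSet_keySet hA) (measurableSet_keySet hA')
    (fun q x hx => hx.1) (fun q x hx => hx.1) hdisj).comp
    (hfm.comp (measurable_reconstruct p)) (hgm.comp (measurable_reconstruct p'))
  exact lintegral_mul_eq_lintegral_mul_lintegral_of_indepFun'' hfm.aemeasurable hgm.aemeasurable
    (hind.congr h1.symm h2.symm)

/-- The law of a translated Poisson process. -/
theorem isPoissonPointProcess_map_sub (hP : IsPoissonPointProcess ν P) (x : Space d) :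
    IsPoissonPointProcess ν (P.map fun η i => η i - x) := by
  have hm : Measurable fun (η : Config d) (i : ℕ) => η i - x :=
    measurable_pi_iff.2 fun i => (measurable_pi_apply (X := fun _ : ℕ => Space d) i).sub_const x
  have hpre : ∀ A : Set (Space d), MeasurableSet A →
      MeasurableSet ((fun y => y - x) ⁻¹' A) := fun A hA => measurable_id.sub_const x hA
  have hvol : ∀ A : Set (Space d), volume ((fun y => y - x) ⁻¹' A) = volume A := fun A => by
    simp_rw [sub_eq_add_neg]
    exact measure_preimage_add_right _ _ _
  have := hP.isProbabilityMeasure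
  refine ⟨Measure.isProbabilityMeasure_map hm.aemeasurable, fun A hA hAvol k => ?_,
    fun n A hA hdisj => ?_⟩
  · have hS : MeasurableSet {η : Config d | pointCount A η = k} :=
      measurable_pointCount hA (measurableSet_singleton (k : ℕ∞))
    rw [Measure.map_apply hm hS]
    have h := hP.poisson _ (hpre A hA) (by rwa [hvol]) k
    rw [measureReal_def, hvol] at h
    exact h
  · have := Measure.isProbabilityMeasure_map (μ := P) hm.aemeasurable
    have hind := (iIndepFun_iff_map_fun_eq_pi_map
      fun i => (measurable_pointCount (hpre _ (hA i))).aemeasurable).1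
      (hP.indep n (fun i => (fun y => y - x) ⁻¹' A i) (fun i => hpre _ (hA i))
        fun i j hij => (hdisj hij).preimage _)
    rw [iIndepFun_iff_map_fun_eq_pi_map fun i => (measurable_pointCount (hA i)).aemeasurable,
      Measure.map_map (measurable_pi_iff.2 fun i => measurable_pointCount (hA i)) hm]
    simp_rw [Measure.map_map (measurable_pointCount (hA _)) hm]
    exact hind

end

section

/-! ### The quenched marks: relabelling, independence and edge probabilities -/

variable {d : ℕ}

/-- The weights of the vertices and the uniform variables of the pairs of vertices. -/
abbrev Marks : Type := (ℕ → ℝ) × (Sym2 ℕ → unitInterval)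

instance (μ : Measure ℝ) [IsProbabilityMeasure μ] : IsProbabilityMeasure (markLaw μ) := by
  unfold markLaw; infer_instance

theorem measurable_spatialGraph_joint (α : ℝ) :
    Measurable fun p : Config d × Marks => spatialGraph α p.1 p.2 := by
  refine SimpleGraph.measurable_iff_adj.2 fun i j => ?_
  refine measurableSet_setOfPred.1 ?_
  change MeasurableSet ({p : Config d × Marks | i ≠ j} ∩ {p : Config d × Marks |
    (p.2.2 s(i, j) : ℝ) < linkProb α (p.1 i) (p.1 j) (p.2.1 i) (p.2.1 j)})
  refine (MeasurableSet.const _).inter (measurableSet_lt ?_ ?_)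
  · fun_prop
  · unfold linkProb
    fun_prop

/-- The spatial graph with only those edges that have both endpoints in `A`. -/
noncomputable def windowGraph (α : ℝ) (A : Set (Space d)) (η : Config d) (ω : Marks) :
    SimpleGraph ℕ := within (spatialGraph α η ω) {i | η i ∈ A}

theorem measurable_windowGraph_joint (α : ℝ) {A : Set (Space d)} (hA : MeasurableSet A) :
    Measurable fun p : Config d × Marks => windowGraph α A p.1 p.2 := by
  refine SimpleGraph.measurable_iff_adj.2 fun i j => ?_
  have h := SimpleGraph.measurable_iff_adj.1 (measurable_spatialGraph_joint (d := d) α) i j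
  have hi : ∀ i : ℕ, Measurable fun p : Config d × Marks => p.1 i ∈ A := fun i =>
    hA.mem.comp ((measurable_pi_apply i).comp measurable_fst)
  exact h.and ((hi i).and (hi j))

theorem windowGraph_univ (α : ℝ) (η : Config d) (ω : Marks) :
    windowGraph α univ η ω = spatialGraph α η ω := by
  ext i j
  simp [windowGraph, within]

theorem windowGraph_maskOutside (α : ℝ) {A : Set (Space d)} {p : Space d} (hp : p ∉ A)
    (η : Config d) (ω : Marks) :
    windowGraph α A (maskOutside A p η) ω = windowGraph α A η ω := by
  ext i j
  have hmem : ∀ i, maskOutside A p η i ∈ A ↔ η i ∈ A := fun i => by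
    by_cases h : η i ∈ A <;> simp [maskOutside, h, hp]
  have heq : ∀ i, η i ∈ A → maskOutside A p η i = η i := fun i h => by simp [maskOutside, h]
  constructor
  · rintro ⟨h, hi, hj⟩
    have hi' := (hmem i).1 hi
    have hj' := (hmem j).1 hj
    refine ⟨⟨h.1, ?_⟩, hi', hj'⟩
    have := h.2
    rwa [heq i hi', heq j hj'] at this
  · rintro ⟨h, hi, hj⟩
    refine ⟨⟨h.1, ?_⟩, (hmem i).2 hi, (hmem j).2 hj⟩
    rw [heq i hi, heq j hj]
    exact h.2

/-- The marks after a relabelling of the vertices. -/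
def relabelMarks (σ : Equiv.Perm ℕ) (ω : Marks) : Marks :=
  (fun i => ω.1 (σ i), fun e => ω.2 (e.map σ))

theorem measurePreserving_relabelMarks (μ : Measure ℝ) [IsProbabilityMeasure μ]
    (σ : Equiv.Perm ℕ) : MeasurePreserving (relabelMarks σ) (markLaw μ) (markLaw μ) := by
  have h1 : MeasurePreserving (fun (w : ℕ → ℝ) (i : ℕ) => w (σ i))
      (Measure.infinitePi fun _ => μ) (Measure.infinitePi fun _ => μ) :=
    ⟨measurable_pi_iff.2 fun i => measurable_pi_apply _,
      Measure.map_infinitePi_infinitePi_of_inj (P := fun _ : ℕ => μ) σ.injective⟩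
  have h2 : MeasurePreserving (fun (u : Sym2 ℕ → unitInterval) (e : Sym2 ℕ) => u (e.map σ))
      (Measure.infinitePi fun _ => volume) (Measure.infinitePi fun _ => volume) :=
    ⟨measurable_pi_iff.2 fun i => measurable_pi_apply _,
      Measure.map_infinitePi_infinitePi_of_inj
        (P := fun _ : Sym2 ℕ => (volume : Measure unitInterval)) (Sym2.map.injective σ.injective)⟩
  exact h1.prod h2

theorem spatialGraph_relabel (α : ℝ) (η : Config d) (σ : Equiv.Perm ℕ) (ω : Marks) :
    spatialGraph α (η ∘ σ) (relabelMarks σ ω) = (spatialGraph α η ω).comap σ := by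
  ext i j
  change (i ≠ j ∧ _) ↔ (σ i ≠ σ j ∧ _)
  rw [σ.injective.ne_iff]
  rfl

theorem windowGraph_relabel (α : ℝ) (A : Set (Space d)) (η : Config d) (σ : Equiv.Perm ℕ)
    (ω : Marks) :
    windowGraph α A (η ∘ σ) (relabelMarks σ ω) = (windowGraph α A η ω).comap σ := by
  rw [windowGraph, spatialGraph_relabel]
  rfl

section Scores

variable (α : ℝ) (μ : Measure ℝ) [IsProbabilityMeasure μ]
  {ψ : SimpleGraph ℕ → ℕ → ℝ≥0∞}

/-- The quenched expectation of the score of the vertex `i`, computed in the graph on the window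
`A`. -/
noncomputable def meanScore (ψ : SimpleGraph ℕ → ℕ → ℝ≥0∞) (A : Set (Space d)) (η : Config d)
    (i : ℕ) : ℝ≥0∞ := ∫⁻ ω, ψ (windowGraph α A η ω) i ∂(markLaw μ)

/-- The sum of the scores of the vertices in `S`, computed in the graph on the window `A`. -/
noncomputable def sumScore (ψ : SimpleGraph ℕ → ℕ → ℝ≥0∞) (A S : Set (Space d)) (η : Config d)
    (ω : Marks) : ℝ≥0∞ :=
  ∑' i, S.indicator (fun _ => 1) (η i) * ψ (windowGraph α A η ω) i

variable {α}

theorem measurable_score_joint (hψ : IsLocalScore ψ) {A : Set (Space d)} (hA : MeasurableSet A)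
    (i : ℕ) : Measurable fun p : Config d × Marks => ψ (windowGraph α A p.1 p.2) i :=
  (hψ.measurable i).comp (measurable_windowGraph_joint α hA)

theorem measurable_sumScore_joint (hψ : IsLocalScore ψ) {A S : Set (Space d)}
    (hA : MeasurableSet A) (hS : MeasurableSet S) :
    Measurable fun p : Config d × Marks => sumScore α ψ A S p.1 p.2 :=
  Measurable.tsum fun i => (((measurable_const.indicator hS).comp
    ((measurable_pi_apply i).comp measurable_fst)).mul (measurable_score_joint hψ hA i))

theorem measurable_meanScore (hψ : IsLocalScore ψ) {A : Set (Space d)} (hA : MeasurableSet A)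
    (i : ℕ) : Measurable fun η => meanScore α μ ψ A η i :=
  (measurable_score_joint hψ hA i).lintegral_prod_right'

theorem sumScore_le (hψ : IsLocalScore ψ) (A S : Set (Space d)) (η : Config d) (ω : Marks) :
    sumScore α ψ A S η ω ≤ pointCount S η := by
  rw [toENNReal_pointCount]
  refine ENNReal.tsum_le_tsum fun i => ?_
  exact mul_le_of_le_one_right' (hψ.le_one _ _)

theorem meanScore_relabel (hψ : IsLocalScore ψ) {A : Set (Space d)} (hA : MeasurableSet A)
    (η : Config d) (σ : Equiv.Perm ℕ) (i : ℕ) :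
    meanScore α μ ψ A (η ∘ σ) i = meanScore α μ ψ A η (σ i) := by
  have hm : Measurable fun ω => ψ (windowGraph α A (η ∘ σ) ω) i :=
    (measurable_score_joint hψ hA i).comp measurable_prodMk_left
  rw [meanScore, ← (measurePreserving_relabelMarks μ σ).lintegral_comp hm, meanScore]
  refine lintegral_congr fun ω => ?_
  rw [windowGraph_relabel, hψ.comap]

theorem lintegral_sumScore (hψ : IsLocalScore ψ) {A : Set (Space d)} (hA : MeasurableSet A)
    (S : Set (Space d)) (η : Config d) :
    ∫⁻ ω, sumScore α ψ A S η ω ∂(markLaw μ) =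
      ∑' i, S.indicator (fun _ => 1) (η i) * meanScore α μ ψ A η i := by
  have hm : ∀ i, Measurable fun ω => ψ (windowGraph α A η ω) i := fun i =>
    (measurable_score_joint hψ hA i).comp measurable_prodMk_left
  simp only [sumScore]
  rw [lintegral_tsum fun i => ((hm i).const_mul _).aemeasurable]
  exact tsum_congr fun i => lintegral_const_mul _ (hm i)

theorem lintegral_sumScore_comp_perm (hψ : IsLocalScore ψ) {A : Set (Space d)}
    (hA : MeasurableSet A) (S : Set (Space d)) (η : Config d) (σ : Equiv.Perm ℕ) :
    ∫⁻ ω, sumScore α ψ A S (η ∘ σ) ω ∂(markLaw μ) =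
      ∫⁻ ω, sumScore α ψ A S η ω ∂(markLaw μ) := by
  rw [lintegral_sumScore μ hψ hA, lintegral_sumScore μ hψ hA]
  simp_rw [meanScore_relabel μ hψ hA]
  exact σ.tsum_eq fun i => S.indicator (fun _ => 1) (η i) * meanScore α μ ψ A η i

theorem sumScore_maskOutside {A S : Set (Space d)} (hSA : S ⊆ A) {p : Space d} (hp : p ∉ A)
    (η : Config d) (ω : Marks) :
    sumScore α ψ A S (maskOutside A p η) ω = sumScore α ψ A S η ω := by
  refine tsum_congr fun i => ?_
  rw [windowGraph_maskOutside α hp]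
  congr 1
  by_cases h : η i ∈ A
  · simp [maskOutside, h]
  · have h1 : η i ∉ S := fun h' => h (hSA h')
    have h2 : p ∉ S := fun h' => hp (hSA h')
    simp [maskOutside, h, h1, h2]

end Scores

section Independence

theorem lintegral_infinitePi_mul_of_dependsOn {ι : Type*} {X : ι → Type*}
    [∀ i, MeasurableSpace (X i)] (m : ∀ i, Measure (X i)) [∀ i, IsProbabilityMeasure (m i)]
    {f g : (∀ i, X i) → ℝ≥0∞} (hf : Measurable f) (hg : Measurable g) {S S' : Finset ι}
    (hdisj : Disjoint S S') (hfS : DependsOn f S) (hgS : DependsOn g S') :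
    ∫⁻ x, f x * g x ∂(Measure.infinitePi m) =
      (∫⁻ x, f x ∂(Measure.infinitePi m)) * ∫⁻ x, g x ∂(Measure.infinitePi m) := by
  classical
  have hne : Nonempty (∀ i, X i) := (Measure.infinitePi m).nonempty_of_neZero
  obtain ⟨x₀⟩ := hne
  have key : ∀ (h : (∀ i, X i) → ℝ≥0∞) (T : Finset ι), DependsOn h T →
      h = (fun y => h (Function.updateFinset x₀ T y)) ∘ fun x (i : T) => x i := by
    intro h T hT
    funext x
    refine hT fun i hi => ?_
    have hi' : i ∈ T := hi
    simp [Function.updateFinset, hi']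
  have hind := (iIndepFun_infinitePi (P := m) (X := fun _ x => x)
    fun i => measurable_id).indepFun_finset S S' hdisj fun i => measurable_pi_apply i
  have hind' := hind.comp (φ := fun y => f (Function.updateFinset x₀ S y))
    (ψ := fun y => g (Function.updateFinset x₀ S' y)) (hf.comp measurable_updateFinset)
    (hg.comp measurable_updateFinset)
  rw [← key f S hfS, ← key g S' hgS] at hind'
  exact lintegral_mul_eq_lintegral_mul_lintegral_of_indepFun'' hf.aemeasurable hg.aemeasurable
    hind'

/-- Functions of the marks of disjoint finite sets of vertices are independent. -/
theorem lintegral_markLaw_mul (μ : Measure ℝ) [IsProbabilityMeasure μ] {f g : Marks → ℝ≥0∞}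
    (hf : Measurable f) (hg : Measurable g) {I J : Finset ℕ} (hdisj : Disjoint I J)
    (hfI : ∀ ω ω' : Marks, (∀ i ∈ I, ω.1 i = ω'.1 i) → (∀ e ∈ I.sym2, ω.2 e = ω'.2 e) →
      f ω = f ω')
    (hgJ : ∀ ω ω' : Marks, (∀ i ∈ J, ω.1 i = ω'.1 i) → (∀ e ∈ J.sym2, ω.2 e = ω'.2 e) →
      g ω = g ω') :
    ∫⁻ ω, f ω * g ω ∂(markLaw μ) = (∫⁻ ω, f ω ∂(markLaw μ)) * ∫⁻ ω, g ω ∂(markLaw μ) := by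
  have hsym : Disjoint I.sym2 J.sym2 := by
    refine Finset.disjoint_left.2 fun e he he' => ?_
    induction e with
    | _ a b =>
      rw [Finset.mk_mem_sym2_iff] at he he'
      exact Finset.disjoint_left.1 hdisj he.1 he'.1
  rw [markLaw, lintegral_prod (fun ω => f ω * g ω) (hf.mul hg).aemeasurable,
    lintegral_prod _ hf.aemeasurable, lintegral_prod _ hg.aemeasurable]
  have hinner : ∀ w : ℕ → ℝ, ∫⁻ u, f (w, u) * g (w, u) ∂(Measure.infinitePi fun _ => volume) =
      (∫⁻ u, f (w, u) ∂(Measure.infinitePi fun _ => volume)) *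
        ∫⁻ u, g (w, u) ∂(Measure.infinitePi fun _ => volume) := fun w =>
    lintegral_infinitePi_mul_of_dependsOn (fun _ : Sym2 ℕ => (volume : Measure unitInterval))
      (hf.comp measurable_prodMk_left) (hg.comp measurable_prodMk_left) hsym
      (fun u u' huu' => hfI _ _ (fun _ _ => rfl) huu')
      (fun u u' huu' => hgJ _ _ (fun _ _ => rfl) huu')
  simp_rw [hinner]
  exact lintegral_infinitePi_mul_of_dependsOn (fun _ : ℕ => μ)
    hf.lintegral_prod_right' hg.lintegral_prod_right' hdisj
    (fun w w' hww' => lintegral_congr fun u => hfI _ _ hww' fun _ _ => rfl)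
    (fun w w' hww' => lintegral_congr fun u => hgJ _ _ hww' fun _ _ => rfl)

theorem windowGraph_congr (α : ℝ) (A : Set (Space d)) (η : Config d) {I : Finset ℕ}
    (hI : ∀ i, η i ∈ A → i ∈ I) {ω ω' : Marks} (h1 : ∀ i ∈ I, ω.1 i = ω'.1 i)
    (h2 : ∀ e ∈ I.sym2, ω.2 e = ω'.2 e) : windowGraph α A η ω = windowGraph α A η ω' := by
  ext i j
  refine and_congr_left fun hij => and_congr_right fun _ => ?_
  rw [h1 i (hI i hij.1), h1 j (hI j hij.2),
    h2 s(i, j) (Finset.mk_mem_sym2_iff.2 ⟨hI i hij.1, hI j hij.2⟩)]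

/-- For a fixed configuration, the scores in disjoint windows use disjoint sets of marks. -/
theorem lintegral_sumScore_mul (α : ℝ) (μ : Measure ℝ) [IsProbabilityMeasure μ]
    {ψ : SimpleGraph ℕ → ℕ → ℝ≥0∞} (hψ : IsLocalScore ψ) {A A' : Set (Space d)}
    (hA : MeasurableSet A) (hA' : MeasurableSet A') (hdisj : Disjoint A A')
    {S S' : Set (Space d)} (hS : MeasurableSet S) (hS' : MeasurableSet S') {η : Config d}
    (hη : {i | η i ∈ A}.Finite) (hη' : {i | η i ∈ A'}.Finite) :
    ∫⁻ ω, sumScore α ψ A S η ω * sumScore α ψ A' S' η ω ∂(markLaw μ) =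
      (∫⁻ ω, sumScore α ψ A S η ω ∂(markLaw μ)) *
        ∫⁻ ω, sumScore α ψ A' S' η ω ∂(markLaw μ) := by
  refine lintegral_markLaw_mul μ
    ((measurable_sumScore_joint hψ hA hS).comp measurable_prodMk_left)
    ((measurable_sumScore_joint hψ hA' hS').comp measurable_prodMk_left)
    (I := hη.toFinset) (J := hη'.toFinset) ?_ (fun ω ω' h1 h2 => ?_) (fun ω ω' h1 h2 => ?_)
  · refine Finset.disjoint_left.2 fun i hi hi' => ?_
    rw [Finite.mem_toFinset] at hi hi'
    exact disjoint_left.1 hdisj hi hi'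
  · simp only [sumScore, windowGraph_congr α A η (fun i hi => hη.mem_toFinset.2 hi) h1 h2]
  · simp only [sumScore, windowGraph_congr α A' η (fun i hi => hη'.mem_toFinset.2 hi) h1 h2]

end Independence

section EdgeProbability

theorem volume_coe_lt {p : ℝ} (hp : p ≤ 1) :
    volume {u : unitInterval | (u : ℝ) < p} = ENNReal.ofReal p := by
  rcases le_or_gt p 0 with h | h
  · rw [ENNReal.ofReal_of_nonpos h]
    convert measure_empty (μ := (volume : Measure unitInterval))
    ext u
    have := u.2.1
    simp only [mem_ofPred_eq, mem_empty_iff_false, iff_false, not_lt]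
    linarith
  · exact unitInterval.volume_Iio ⟨p, h.le, hp⟩

theorem linkProb_le_one (α : ℝ) (x y : Space d) (w w' : ℝ) : linkProb α x y w w' ≤ 1 := by
  unfold linkProb
  linarith [Real.exp_pos (-(w * w' / ‖x - y‖ ^ α))]

theorem ofReal_linkProb_le {α s : ℝ} (hs : 0 < s) (hs1 : s ≤ 1) (x y : Space d) {w w' : ℝ}
    (hw : 0 < w) (hw' : 0 < w') : ENNReal.ofReal (linkProb α x y w w') ≤
      ENNReal.ofReal w ^ s * ENNReal.ofReal w' ^ s * ENNReal.ofReal (‖x - y‖ ^ (-(α * s))) := by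
  have hr : 0 ≤ ‖x - y‖ := norm_nonneg _
  rw [ENNReal.ofReal_rpow_of_pos hw, ENNReal.ofReal_rpow_of_pos hw',
    ← ENNReal.ofReal_mul (by positivity), ← ENNReal.ofReal_mul (by positivity)]
  refine ENNReal.ofReal_le_ofReal ((one_sub_exp_neg_le_rpow (by positivity) hs hs1).trans ?_)
  rw [Real.div_rpow (by positivity) (by positivity), Real.mul_rpow hw.le hw'.le,
    ← Real.rpow_mul hr, Real.rpow_neg hr, div_eq_mul_inv]

variable (μ : Measure ℝ) [IsProbabilityMeasure μ]

theorem markLaw_adj (α : ℝ) (η : Config d) {i j : ℕ} (hij : i ≠ j) :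
    markLaw μ {ω | (spatialGraph α η ω).Adj i j} =
      ∫⁻ w, ENNReal.ofReal (linkProb α (η i) (η j) (w i) (w j))
        ∂(Measure.infinitePi fun _ : ℕ => μ) := by
  have hS : MeasurableSet {ω : Marks | (spatialGraph α η ω).Adj i j} :=
    measurableSet_setOfPred.2 (SimpleGraph.measurable_iff_adj.1 (measurable_spatialGraph α η) i j)
  rw [markLaw, Measure.prod_apply hS]
  refine lintegral_congr fun w => ?_
  rw [← volume_coe_lt (linkProb_le_one α (η i) (η j) (w i) (w j)),
    ← (measurePreserving_eval_infinitePi (fun _ : Sym2 ℕ => (volume : Measure unitInterval))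
      s(i, j)).measure_preimage (measurableSet_lt measurable_subtype_coe
        measurable_const).nullMeasurableSet]
  congr 1
  ext u
  simp [spatialGraph, hij]

/-- A moment bound for the probability of an edge, from `1 - exp (-t) ≤ t ^ s`; the weights at the
two endpoints are independent. -/
theorem markLaw_adj_le (hμ : ∀ᵐ w ∂μ, 0 < w) {α s : ℝ} (hs : 0 < s) (hs1 : s ≤ 1)
    (η : Config d) {i j : ℕ} (hij : i ≠ j) :
    markLaw μ {ω | (spatialGraph α η ω).Adj i j} ≤
      (∫⁻ w, ENNReal.ofReal w ^ s ∂μ) ^ 2 * ENNReal.ofReal (‖η i - η j‖ ^ (-(α * s))) := by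
  have hpos : ∀ k : ℕ, ∀ᵐ w ∂(Measure.infinitePi fun _ : ℕ => μ), 0 < w k := fun k =>
    (measurePreserving_eval_infinitePi (fun _ : ℕ => μ) k).quasiMeasurePreserving.ae hμ
  have hm : Measurable fun w : ℝ => ENNReal.ofReal w ^ s := by fun_prop
  rw [markLaw_adj μ α η hij]
  calc _ ≤ ∫⁻ w : ℕ → ℝ, ENNReal.ofReal (w i) ^ s * ENNReal.ofReal (w j) ^ s *
          ENNReal.ofReal (‖η i - η j‖ ^ (-(α * s))) ∂(Measure.infinitePi fun _ : ℕ => μ) := by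
        refine lintegral_mono_ae ?_
        filter_upwards [hpos i, hpos j] with w hi hj
        exact ofReal_linkProb_le hs hs1 _ _ hi hj
    _ = _ := by
        rw [lintegral_mul_const _ (by fun_prop)]
        congr 1
        have h := lintegral_map (μ := Measure.infinitePi fun _ : ℕ => μ)
          (f := fun p : ℝ × ℝ => ENNReal.ofReal p.1 ^ s * ENNReal.ofReal p.2 ^ s)
          (g := fun w : ℕ → ℝ => (w i, w j)) (by fun_prop) (by fun_prop)
        rw [← h, Measure.infinitePi_map_eval_prod (P := fun _ : ℕ => μ) hij,
          lintegral_prod_mul hm.aemeasurable hm.aemeasurable, sq]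

/-- Three distinct points span a triangle with positive probability. -/
theorem markLaw_triangle_pos (hμ : ∀ᵐ w ∂μ, 0 < w) (α : ℝ) (η : Config d)
    (h01 : η 0 ≠ η 1) (h02 : η 0 ≠ η 2) (h12 : η 1 ≠ η 2) :
    0 < markLaw μ {ω | (spatialGraph α η ω).Adj 0 1 ∧ (spatialGraph α η ω).Adj 0 2 ∧
      (spatialGraph α η ω).Adj 1 2} := by
  have hadj : ∀ i j, Measurable fun ω : Marks => (spatialGraph α η ω).Adj i j :=
    SimpleGraph.measurable_iff_adj.1 (measurable_spatialGraph α η)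
  have hS : MeasurableSet {ω : Marks | (spatialGraph α η ω).Adj 0 1 ∧
      (spatialGraph α η ω).Adj 0 2 ∧ (spatialGraph α η ω).Adj 1 2} :=
    measurableSet_setOfPred.2 ((hadj 0 1).and ((hadj 0 2).and (hadj 1 2)))
  have hpos : ∀ᵐ w ∂(Measure.infinitePi fun _ : ℕ => μ), ∀ k, 0 < w k := ae_all_iff.2 fun k =>
    (measurePreserving_eval_infinitePi (fun _ : ℕ => μ) k).quasiMeasurePreserving.ae hμ
  rw [pos_iff_ne_zero, markLaw, Ne, Measure.measure_prod_null hS]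
  intro hzero
  obtain ⟨w, hw0, hw⟩ := (hzero.and hpos).exists
  have hlink : ∀ i j, η i ≠ η j → 0 < linkProb α (η i) (η j) (w i) (w j) := by
    intro i j hne
    have h1 : 0 < ‖η i - η j‖ := norm_pos_iff.2 (sub_ne_zero.2 hne)
    have h2 : 0 < w i * w j / ‖η i - η j‖ ^ α :=
      div_pos (mul_pos (hw i) (hw j)) (Real.rpow_pos_of_pos h1 _)
    unfold linkProb
    have h3 := Real.exp_lt_exp.2 (neg_lt_zero.2 h2)
    rw [Real.exp_zero] at h3
    linarith
  -- With positive weights each of the three edges is present for an interval of values of its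
  -- uniform variable, and these are independent.
  set t : Sym2 ℕ → Set unitInterval := fun e => {u | (u : ℝ) <
    if e = s(0, 1) then linkProb α (η 0) (η 1) (w 0) (w 1) else
    if e = s(0, 2) then linkProb α (η 0) (η 2) (w 0) (w 2) else
    linkProb α (η 1) (η 2) (w 1) (w 2)} with ht
  have hsub : Set.pi ({s(0, 1), s(0, 2), s(1, 2)} : Finset (Sym2 ℕ)) t ⊆
      Prod.mk w ⁻¹' {ω : Marks | (spatialGraph α η ω).Adj 0 1 ∧
        (spatialGraph α η ω).Adj 0 2 ∧ (spatialGraph α η ω).Adj 1 2} := by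
    intro u hu
    have h1 := hu s(0, 1) (by simp)
    have h2 := hu s(0, 2) (by simp)
    have h3 := hu s(1, 2) (by simp)
    simp only [ht, mem_ofPred_eq] at h1 h2 h3
    rw [if_pos trivial] at h1
    rw [if_neg (by decide), if_pos trivial] at h2
    rw [if_neg (by decide), if_neg (by decide)] at h3
    exact ⟨⟨by decide, h1⟩, ⟨by decide, h2⟩, ⟨by decide, h3⟩⟩
  have hm := measure_mono_null hsub hw0
  rw [Measure.infinitePi_pi _ fun e _ => measurableSet_lt measurable_subtype_coe
    measurable_const, Finset.prod_eq_zero_iff] at hm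
  obtain ⟨e, -, he⟩ := hm
  change volume {u : unitInterval | (u : ℝ) < _} = 0 at he
  rw [volume_coe_lt (by split_ifs <;> exact linkProb_le_one _ _ _ _ _),
    ENNReal.ofReal_eq_zero] at he
  split_ifs at he
  · exact absurd he (not_le.2 (hlink 0 1 h01))
  · exact absurd he (not_le.2 (hlink 0 2 h02))
  · exact absurd he (not_le.2 (hlink 1 2 h12))

end EdgeProbability

end

section

/-! ### Moments of a Poisson process -/

variable {d : ℕ} {ν : ℝ} {P : Measure (Config d)}

theorem tsum_removePoint (i : ℕ) (η : Config d) (g : Space d → ℝ≥0∞) :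
    ∑' j, g (removePoint i η j) = ∑' j, if j = i then 0 else g (η j) := by
  rw [← (Equiv.swap 0 i).tsum_eq fun j => if j = i then 0 else g (η j),
    tsum_eq_zero_add' (f := fun c => if Equiv.swap 0 i c = i then 0 else g (η (Equiv.swap 0 i c)))
      ENNReal.summable, if_pos (Equiv.swap_apply_left 0 i), zero_add]
  refine tsum_congr fun j => ?_
  have : Equiv.swap 0 i (j + 1) ≠ i := by
    intro h
    have := (Equiv.swap 0 i).injective (h.trans (Equiv.swap_apply_left 0 i).symm)
    lia
  rw [if_neg this]
  rfl

theorem lintegral_tsum_point (hP : IsPoissonPointProcess ν P) (hν : 0 < ν)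
    {g : Space d → ℝ≥0∞} (hg : Measurable g) :
    ∫⁻ η, ∑' i, g (η i) ∂P = ENNReal.ofReal ν * ∫⁻ x, g x := by
  have := hP.isProbabilityMeasure
  have h := lintegral_tsum_removePoint hP hν (F := fun x _ => g x) (hg.comp measurable_fst)
    fun _ _ _ => rfl
  simpa using h

theorem lintegral_pointCount (hP : IsPoissonPointProcess ν P) (hν : 0 < ν) {S : Set (Space d)}
    (hS : MeasurableSet S) :
    ∫⁻ η, (pointCount S η : ℝ≥0∞) ∂P = ENNReal.ofReal ν * volume S := by
  simp_rw [toENNReal_pointCount]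
  rw [lintegral_tsum_point hP hν (measurable_const.indicator hS)]
  congr 1
  exact lintegral_indicator_one hS

/-- The second factorial moment measure of a Poisson process is the product of the intensities. -/
theorem lintegral_tsum_pairs (hP : IsPoissonPointProcess ν P) (hν : 0 < ν)
    {h : Space d → Space d → ℝ≥0∞} (hh : Measurable fun p : Space d × Space d => h p.1 p.2) :
    ∫⁻ η, ∑' i, ∑' j, (if j = i then 0 else h (η i) (η j)) ∂P =
      ENNReal.ofReal ν ^ 2 * ∫⁻ x, ∫⁻ y, h x y := by
  have hF := lintegral_tsum_removePoint hP hν (F := fun x η => ∑' j, h x (η j))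
    (Measurable.tsum fun j => hh.comp
      (measurable_fst.prodMk ((measurable_pi_apply j).comp measurable_snd)))
    fun x η σ => σ.tsum_eq fun j => h x (η j)
  simp_rw [tsum_removePoint _ _ (h _)] at hF
  rw [hF]
  rw [lintegral_congr fun x => lintegral_tsum_point hP hν (g := h x)
    (hh.comp measurable_prodMk_left)]
  rw [lintegral_const_mul' _ _ ENNReal.ofReal_ne_top, sq, mul_assoc]

theorem lintegral_pointCount_sq (hP : IsPoissonPointProcess ν P) (hν : 0 < ν) {S : Set (Space d)}
    (hS : MeasurableSet S) :
    ∫⁻ η, (pointCount S η : ℝ≥0∞) ^ 2 ∂P =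
      ENNReal.ofReal ν * volume S + (ENNReal.ofReal ν * volume S) ^ 2 := by
  have hind : Measurable (S.indicator fun _ => (1 : ℝ≥0∞)) := measurable_const.indicator hS
  have hpt : ∀ η : Config d, (pointCount S η : ℝ≥0∞) ^ 2 = (pointCount S η : ℝ≥0∞) +
      ∑' i, ∑' j, (if j = i then 0 else
        S.indicator (fun _ => (1 : ℝ≥0∞)) (η i) * S.indicator (fun _ => (1 : ℝ≥0∞)) (η j)) := by
    intro η
    rw [sq, toENNReal_pointCount, ← ENNReal.tsum_add, ← ENNReal.tsum_mul_right]
    refine tsum_congr fun i => ?_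
    rw [ENNReal.tsum_eq_add_tsum_ite i, mul_add, ← ENNReal.tsum_mul_left]
    congr 1
    · by_cases h : η i ∈ S <;> simp [h]
    · exact tsum_congr fun j => by split_ifs <;> simp
  have hm : Measurable fun η : Config d => (pointCount S η : ℝ≥0∞) := by
    simp_rw [toENNReal_pointCount]
    exact Measurable.tsum fun i => hind.comp (measurable_pi_apply i)
  simp_rw [hpt]
  rw [lintegral_add_left hm, lintegral_pointCount hP hν hS,
    lintegral_tsum_pairs hP hν (h := fun x y => S.indicator (fun _ => (1 : ℝ≥0∞)) x *
      S.indicator (fun _ => (1 : ℝ≥0∞)) y)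
      ((hind.comp measurable_fst).mul (hind.comp measurable_snd))]
  congr 1
  simp_rw [lintegral_const_mul _ hind]
  rw [lintegral_mul_const _ hind, show ∫⁻ y, S.indicator (fun _ => (1 : ℝ≥0∞)) y = volume S from
    lintegral_indicator_one hS]
  ring

theorem ae_point_ne (hd : 1 ≤ d) (hP : IsPoissonPointProcess ν P) (hν : 0 < ν) (x : Space d) :
    ∀ᵐ η ∂P, ∀ i, η i ≠ x := by
  have : Nonempty (Fin d) := ⟨⟨0, hd⟩⟩
  have h := lintegral_pointCount hP hν (measurableSet_singleton x)
  rw [measure_singleton, mul_zero] at h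
  have hm : Measurable fun η : Config d => (pointCount {x} η : ℝ≥0∞) :=
    Measurable.of_discrete.comp (measurable_pointCount (measurableSet_singleton x))
  filter_upwards [(lintegral_eq_zero_iff hm).1 h] with η hη i hi
  have h0 : pointCount {x} η = 0 := by simpa using hη
  rw [pointCount, encard_eq_zero] at h0
  exact (h0 ▸ (show i ∈ {i | η i ∈ ({x} : Set (Space d))} from hi) : i ∈ (∅ : Set ℕ))

theorem ae_injective (hd : 1 ≤ d) (hP : IsPoissonPointProcess ν P) (hν : 0 < ν) :
    ∀ᵐ η ∂P, Function.Injective η := by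
  have : Nonempty (Fin d) := ⟨⟨0, hd⟩⟩
  set h : Space d → Space d → ℝ≥0∞ := fun x y => ({x} : Set (Space d)).indicator 1 y
  have hdiag : MeasurableSet {p : Space d × Space d | p.2 = p.1} :=
    measurableSet_eq_fun measurable_snd measurable_fst
  have hh : Measurable fun p : Space d × Space d => h p.1 p.2 := by
    have : (fun p : Space d × Space d => h p.1 p.2) =
        {p : Space d × Space d | p.2 = p.1}.indicator fun _ => 1 := by
      funext p
      by_cases hp : p.2 = p.1 <;> simp [h, indicator, hp]
    rw [this]
    exact measurable_const.indicator hdiag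
  have hzero := lintegral_tsum_pairs hP hν hh
  have h0 : ∀ x, ∫⁻ y, h x y = 0 := fun x => by
    rw [lintegral_indicator_one (measurableSet_singleton x), measure_singleton]
  simp only [h0, lintegral_zero, mul_zero] at hzero
  have hm : Measurable fun η : Config d =>
      ∑' i, ∑' j, (if j = i then 0 else h (η i) (η j)) := by
    refine Measurable.tsum fun i => Measurable.tsum fun j => ?_
    split_ifs
    · exact measurable_const
    · have hij : Measurable fun η : Config d => (η i, η j) := by fun_prop
      exact hh.comp hij
  filter_upwards [(lintegral_eq_zero_iff hm).1 hzero] with η hη i j hij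
  by_contra hne
  have h1 := ENNReal.tsum_eq_zero.1 (ENNReal.tsum_eq_zero.1 hη i) j
  rw [if_neg (Ne.symm hne)] at h1
  simp [h, hij] at h1

/-! ### Cells and windows -/

/-- The half-open unit cube with lower corner `z`. -/
def cell (z : Fin d → ℤ) : Set (Space d) := {x | ∀ i, (z i : ℝ) ≤ x i ∧ x i < z i + 1}

/-- A cube around the cell of `z` whose complement has distance at least `R` from the cell. -/
def window (R : ℕ) (z : Fin d → ℤ) : Set (Space d) := {x | ∀ i, |x i - z i| ≤ R + 1}

theorem cell_eq_preimage (z : Fin d → ℤ) : (cell z : Set (Space d)) =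
    WithLp.ofLp ⁻¹' Set.pi univ fun i => Ico (z i : ℝ) (z i + 1) := by
  ext x; simp [cell]

theorem window_eq_preimage (R : ℕ) (z : Fin d → ℤ) : (window R z : Set (Space d)) =
    WithLp.ofLp ⁻¹' Set.pi univ fun i => Icc ((z i : ℝ) - (R + 1)) (z i + (R + 1)) := by
  ext x
  simp only [window, mem_ofPred_eq, mem_preimage, Set.mem_pi, mem_univ, true_imp_iff, mem_Icc, abs_le]
  refine forall_congr' fun i => ?_
  constructor <;> rintro ⟨h1, h2⟩ <;> constructor <;> linarith

theorem measurableSet_cell (z : Fin d → ℤ) : MeasurableSet (cell z : Set (Space d)) := by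
  rw [cell_eq_preimage]
  exact (PiLp.volume_preserving_ofLp (Fin d)).measurable
    (MeasurableSet.univ_pi fun _ => measurableSet_Ico)

theorem measurableSet_window (R : ℕ) (z : Fin d → ℤ) :
    MeasurableSet (window R z : Set (Space d)) := by
  rw [window_eq_preimage]
  exact (PiLp.volume_preserving_ofLp (Fin d)).measurable
    (MeasurableSet.univ_pi fun _ => measurableSet_Icc)

theorem volume_cell (z : Fin d → ℤ) : volume (cell z : Set (Space d)) = 1 := by
  rw [cell_eq_preimage, (PiLp.volume_preserving_ofLp (Fin d)).measure_preimage
    (MeasurableSet.univ_pi fun _ => measurableSet_Ico).nullMeasurableSet, volume_pi_pi]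
  simp

theorem volume_window_ne_top (R : ℕ) (z : Fin d → ℤ) :
    volume (window R z : Set (Space d)) ≠ ∞ := by
  rw [window_eq_preimage, (PiLp.volume_preserving_ofLp (Fin d)).measure_preimage
    (MeasurableSet.univ_pi fun _ => measurableSet_Icc).nullMeasurableSet, volume_pi_pi]
  exact (ENNReal.prod_lt_top fun _ _ => by simp).ne

theorem cell_subset_window (R : ℕ) (z : Fin d → ℤ) : (cell z : Set (Space d)) ⊆ window R z := by
  intro x hx i
  have := hx i
  rw [abs_le]
  constructor <;> linarith [Nat.cast_nonneg (α := ℝ) R]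

theorem disjoint_window {R : ℕ} (hR : 1 ≤ R) {z z' : Fin d → ℤ}
    (h : ∃ i, ((4 * R : ℕ) : ℤ) < |z i - z' i|) :
    Disjoint (window R z : Set (Space d)) (window R z') := by
  obtain ⟨i, hi⟩ := h
  refine disjoint_left.2 fun x hx hx' => ?_
  have h1 := hx i
  have h2 := hx' i
  have hi' : (4 * R : ℝ) < |(z i : ℝ) - z' i| := by exact_mod_cast hi
  have hR' : (1 : ℝ) ≤ R := by exact_mod_cast hR
  have h3 : |(z i : ℝ) - z' i| ≤ |x i - z i| + |x i - z' i| := by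
    rw [abs_sub_comm (x i) (z i : ℝ)]
    exact abs_sub_le _ _ _
  linarith

theorem exists_notMem_window (hd : 1 ≤ d) (R : ℕ) (z : Fin d → ℤ) :
    ∃ p : Space d, p ∉ window R z := by
  refine ⟨WithLp.toLp 2 fun i => (z i : ℝ) + R + 2, fun h => ?_⟩
  have h1 := h ⟨0, hd⟩
  have h2 := (abs_le.1 h1).2
  simp only at h2
  linarith

theorem le_norm_sub_of_notMem_window {R : ℕ} {z : Fin d → ℤ} {x y : Space d} (hx : x ∈ cell z)
    (hy : y ∉ window R z) : (R : ℝ) ≤ ‖x - y‖ := by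
  simp only [window, mem_ofPred_eq, not_forall, not_le] at hy
  obtain ⟨i, hi⟩ := hy
  have h1 := hx i
  have h2 : ‖(x - y) i‖ ≤ ‖x - y‖ := PiLp.norm_apply_le (x - y) i
  rw [PiLp.sub_apply, Real.norm_eq_abs] at h2
  have h3 : |y i - z i| ≤ |x i - y i| + |x i - z i| := by
    rw [abs_sub_comm (x i) (y i)]
    exact abs_sub_le _ _ _
  have h4 : |x i - z i| ≤ 1 := abs_le.2 ⟨by linarith, by linarith⟩
  linarith

theorem exists_mem_cell (x : Space d) : ∃ z, x ∈ cell z :=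
  ⟨fun i => ⌊x i⌋, fun _ => ⟨Int.floor_le _, Int.lt_floor_add_one _⟩⟩

theorem IsLocallyFinite.finite_window {η : Config d} (hη : IsLocallyFinite η) (R : ℕ)
    (z : Fin d → ℤ) : {i | η i ∈ window R z}.Finite := by
  have hb : Bornology.IsBounded (window R z : Set (Space d)) := by
    rw [window_eq_preimage]
    exact (PiLp.antilipschitzWith_ofLp 2 fun _ : Fin d => ℝ).isBounded_preimage
      (Bornology.IsBounded.pi fun _ => Metric.isBounded_Icc _ _)
  obtain ⟨r, hr⟩ := hb.subset_closedBall 0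
  exact hη.finite_of_bounded fun x hx => mem_closedBall_zero_iff.1 (hr hx)

end

section

/-! ### The typical score and long edges -/

variable {d : ℕ} {ν : ℝ} {P : Measure (Config d)} {α : ℝ} (μ : Measure ℝ)
  [IsProbabilityMeasure μ] {ψ : SimpleGraph ℕ → ℕ → ℝ≥0∞}

/-- The permutation of `ℕ` that fixes `0` and acts on the positive numbers as `σ`. -/
def consPerm (σ : Equiv.Perm ℕ) : Equiv.Perm ℕ where
  toFun
    | 0 => 0
    | i + 1 => σ i + 1
  invFun
    | 0 => 0
    | i + 1 => σ.symm i + 1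
  left_inv i := by cases i <;> simp
  right_inv i := by cases i <;> simp

theorem consPoint_comp_perm (x : Space d) (η : Config d) (σ : Equiv.Perm ℕ) :
    consPoint x (η ∘ σ) = consPoint x η ∘ consPerm σ := by
  funext j; cases j <;> rfl

theorem spatialGraph_sub (α : ℝ) (η : Config d) (x : Space d) (ω : Marks) :
    spatialGraph α (fun i => η i - x) ω = spatialGraph α η ω := by
  ext i j
  simp [spatialGraph, linkProb]

theorem meanScore_univ_sub (α : ℝ) (η : Config d) (x : Space d) (i : ℕ) :
    meanScore α μ ψ univ (fun i => η i - x) i = meanScore α μ ψ univ η i := by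
  simp only [meanScore, windowGraph_univ, spatialGraph_sub]

/-- The expected score of the origin under the Palm law. -/
noncomputable def palmScore (α : ℝ) (ψ : SimpleGraph ℕ → ℕ → ℝ≥0∞) (P : Measure (Config d)) :
    ℝ≥0∞ :=
  ∫⁻ η, meanScore α μ ψ univ (consPoint 0 η) 0 ∂P

theorem meanScore_consPoint_comp_perm (hψ : IsLocalScore ψ) (x : Space d) (η : Config d)
    (σ : Equiv.Perm ℕ) : meanScore α μ ψ univ (consPoint x (η ∘ σ)) 0 =
      meanScore α μ ψ univ (consPoint x η) 0 := by
  rw [consPoint_comp_perm, meanScore_relabel μ hψ MeasurableSet.univ]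
  rfl

theorem measurable_meanScore_consPoint (hψ : IsLocalScore ψ) :
    Measurable fun p : Space d × Config d => meanScore α μ ψ univ (consPoint p.1 p.2) 0 :=
  (measurable_meanScore μ hψ MeasurableSet.univ 0).comp measurable_consPoint

theorem measurable_meanScore_consPoint_right (hψ : IsLocalScore ψ) (x : Space d) :
    Measurable fun η : Config d => meanScore α μ ψ univ (consPoint x η) 0 := by
  have h : Measurable (consPoint x) := by
    refine measurable_pi_iff.2 fun j => ?_
    cases j with
    | zero => exact measurable_const
    | succ j => exact measurable_pi_apply j
  exact (measurable_meanScore μ hψ MeasurableSet.univ 0).comp h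

/-- By translation invariance, the expected score of an added point does not depend on its
position. -/
theorem lintegral_meanScore_consPoint (hP : IsPoissonPointProcess ν P) (hψ : IsLocalScore ψ)
    (x : Space d) :
    ∫⁻ η, meanScore α μ ψ univ (consPoint x η) 0 ∂P = palmScore μ α ψ P := by
  have hm := measurable_meanScore_consPoint_right (α := α) μ hψ (0 : Space d)
  have hsub : Measurable fun (η : Config d) (i : ℕ) => η i - x :=
    measurable_pi_iff.2 fun i => (measurable_pi_apply (X := fun _ : ℕ => Space d) i).sub_const x
  rw [palmScore, lintegral_symmetric_unique hP (isPoissonPointProcess_map_sub hP x) hm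
    (fun η σ => meanScore_consPoint_comp_perm μ hψ 0 η σ), lintegral_map hm hsub]
  refine lintegral_congr fun η => ?_
  rw [← meanScore_univ_sub μ α (consPoint x η) x]
  congr 1
  funext j
  cases j with
  | zero => simp [consPoint]
  | succ j => rfl

/-- The mean number of points in `S`, weighted with their scores, by the Mecke formula. -/
theorem lintegral_sumScore_univ (hP : IsPoissonPointProcess ν P) (hν : 0 < ν)
    (hψ : IsLocalScore ψ) {S : Set (Space d)} (hS : MeasurableSet S) :
    ∫⁻ p, sumScore α ψ univ S p.1 p.2 ∂(P.prod (markLaw μ)) =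
      ENNReal.ofReal ν * (volume S * palmScore μ α ψ P) := by
  have := hP.isProbabilityMeasure
  have hind : Measurable (S.indicator fun _ => (1 : ℝ≥0∞)) := measurable_const.indicator hS
  have hF := lintegral_tsum_removePoint hP hν
    (F := fun x η => S.indicator (fun _ => 1) x * meanScore α μ ψ univ (consPoint x η) 0)
    ((hind.comp measurable_fst).mul (measurable_meanScore_consPoint μ hψ))
    (fun x η σ => by rw [meanScore_consPoint_comp_perm μ hψ])
  rw [lintegral_prod _ (measurable_sumScore_joint hψ MeasurableSet.univ hS).aemeasurable]
  calc ∫⁻ η, ∫⁻ ω, sumScore α ψ univ S η ω ∂(markLaw μ) ∂P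
      = ∫⁻ η, ∑' i, S.indicator (fun _ => 1) (η i) *
          meanScore α μ ψ univ (consPoint (η i) (removePoint i η)) 0 ∂P := by
        refine lintegral_congr fun η => ?_
        rw [lintegral_sumScore μ hψ MeasurableSet.univ]
        refine tsum_congr fun i => ?_
        rw [consPoint_removePoint, meanScore_relabel μ hψ MeasurableSet.univ,
          Equiv.swap_apply_left]
    _ = _ := hF
    _ = _ := by
        congr 1
        rw [show volume S = ∫⁻ x, S.indicator (fun _ => (1 : ℝ≥0∞)) x from
          (lintegral_indicator_one hS).symm, ← lintegral_mul_const _ hind]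
        refine lintegral_congr fun x => ?_
        rw [lintegral_const_mul _ (measurable_meanScore_consPoint_right μ hψ x), lintegral_meanScore_consPoint μ hP hψ]

open Classical in
/-- The number of edges from a vertex in `S` to a vertex outside of `W`. -/
noncomputable def longEdges (α : ℝ) (S W : Set (Space d)) (η : Config d) (ω : Marks) : ℝ≥0∞ :=
  ∑' i, ∑' j, if η i ∈ S ∧ η j ∉ W ∧ (spatialGraph α η ω).Adj i j then 1 else 0

theorem measurable_longEdges {S W : Set (Space d)} (hS : MeasurableSet S)
    (hW : MeasurableSet W) :
    Measurable fun p : Config d × Marks => longEdges α S W p.1 p.2 := by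
  refine Measurable.tsum fun i => Measurable.tsum fun j => ?_
  have hadj := SimpleGraph.measurable_iff_adj.1 (measurable_spatialGraph_joint (d := d) α) i j
  have h1 : Measurable fun p : Config d × Marks => p.1 i ∈ S :=
    hS.mem.comp ((measurable_pi_apply i).comp measurable_fst)
  have h2 : Measurable fun p : Config d × Marks => p.1 j ∉ W :=
    hW.compl.mem.comp ((measurable_pi_apply j).comp measurable_fst)
  exact Measurable.ite (measurableSet_setOfPred.2 (h1.and (h2.and hadj))) measurable_const
    measurable_const

/-- The expected number of long edges, given the bound on the probability of a single edge. -/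
theorem lintegral_longEdges_le (hP : IsPoissonPointProcess ν P) (hν : 0 < ν)
    (hμ : ∀ᵐ w ∂μ, 0 < w) {s : ℝ} (hs : 0 < s) (hs1 : s ≤ 1) {S W : Set (Space d)}
    (hS : MeasurableSet S) (hW : MeasurableSet W) :
    ∫⁻ p, longEdges α S W p.1 p.2 ∂(P.prod (markLaw μ)) ≤
      ENNReal.ofReal ν ^ 2 * ((∫⁻ w, ENNReal.ofReal w ^ s ∂μ) ^ 2 *
        ∫⁻ x in S, ∫⁻ y in Wᶜ, ENNReal.ofReal (‖x - y‖ ^ (-(α * s)))) := by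
  have := hP.isProbabilityMeasure
  set K := ∫⁻ w, ENNReal.ofReal w ^ s ∂μ
  set h : Space d → Space d → ℝ≥0∞ := fun x y => K ^ 2 * (S.indicator (fun _ => 1) x *
    (Wᶜ.indicator (fun _ => 1) y * ENNReal.ofReal (‖x - y‖ ^ (-(α * s))))) with hh
  have hker : Measurable fun p : Space d × Space d =>
      ENNReal.ofReal (‖p.1 - p.2‖ ^ (-(α * s))) := by fun_prop
  have hindS : Measurable (S.indicator fun _ => (1 : ℝ≥0∞)) := measurable_const.indicator hS
  have hindW : Measurable (Wᶜ.indicator fun _ => (1 : ℝ≥0∞)) :=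
    measurable_const.indicator hW.compl
  have hhm : Measurable fun p : Space d × Space d => h p.1 p.2 :=
    ((hindS.comp measurable_fst).mul ((hindW.comp measurable_snd).mul hker)).const_mul _
  rw [lintegral_prod _ (measurable_longEdges hS hW).aemeasurable]
  calc ∫⁻ η, ∫⁻ ω, longEdges α S W η ω ∂(markLaw μ) ∂P
      ≤ ∫⁻ η, ∑' i, ∑' j, (if j = i then 0 else h (η i) (η j)) ∂P := by
        refine lintegral_mono fun η => ?_
        have hadj : ∀ i j, MeasurableSet {ω : Marks | (spatialGraph α η ω).Adj i j} :=
          fun i j => measurableSet_setOfPred.2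
            (SimpleGraph.measurable_iff_adj.1 (measurable_spatialGraph α η) i j)
        have hterm : ∀ i j, Measurable fun ω : Marks =>
            {ω : Marks | (spatialGraph α η ω).Adj i j}.indicator (fun _ => (1 : ℝ≥0∞)) ω :=
          fun i j => measurable_const.indicator (hadj i j)
        have hrw : ∀ ω, longEdges α S W η ω = ∑' i, ∑' j, S.indicator (fun _ => 1) (η i) *
            Wᶜ.indicator (fun _ => 1) (η j) *
            {ω : Marks | (spatialGraph α η ω).Adj i j}.indicator (fun _ => (1 : ℝ≥0∞)) ω :=
          fun ω => tsum_congr fun i => tsum_congr fun j => by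
            by_cases h1 : η i ∈ S <;> by_cases h2 : η j ∈ W <;>
              by_cases h3 : (spatialGraph α η ω).Adj i j <;> simp [h1, h2, h3]
        simp_rw [hrw]
        rw [lintegral_tsum fun i => (Measurable.tsum fun j =>
          (hterm i j).const_mul _).aemeasurable]
        refine ENNReal.tsum_le_tsum fun i => ?_
        rw [lintegral_tsum fun j => ((hterm i j).const_mul _).aemeasurable]
        refine ENNReal.tsum_le_tsum fun j => ?_
        rw [lintegral_const_mul _ (hterm i j), lintegral_indicator_const (hadj i j), one_mul]
        split_ifs with hij
        · simp [hij]
        · refine (mul_le_mul_right (markLaw_adj_le μ hμ hs hs1 η (Ne.symm hij)) _).trans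
            (le_of_eq ?_)
          simp only [hh]
          ring
    _ = _ := by
        rw [lintegral_tsum_pairs hP hν hhm]
        congr 1
        have hin : ∀ x, ∫⁻ y, h x y = K ^ 2 * S.indicator
            (fun x => ∫⁻ y in Wᶜ, ENNReal.ofReal (‖x - y‖ ^ (-(α * s)))) x := by
          intro x
          have h1 : Measurable fun y => Wᶜ.indicator (fun _ => (1 : ℝ≥0∞)) y *
              ENNReal.ofReal (‖x - y‖ ^ (-(α * s))) :=
            hindW.mul (by fun_prop)
          simp only [hh]
          rw [lintegral_const_mul _ (h1.const_mul _), lintegral_const_mul _ h1]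
          congr 1
          by_cases hx : x ∈ S
          · simp only [hx, indicator_of_mem, one_mul]
            rw [← lintegral_indicator hW.compl]
            refine lintegral_congr fun y => ?_
            by_cases hy : y ∈ Wᶜ <;> simp [hy]
          · simp [hx]
        simp_rw [hin]
        have hout : Measurable fun x : Space d =>
            ∫⁻ y in Wᶜ, ENNReal.ofReal (‖x - y‖ ^ (-(α * s))) := hker.lintegral_prod_right'
        rw [lintegral_const_mul _ (hout.indicator hS), lintegral_indicator hS]

/-- Restricting the graph to a window changes the score of a vertex only if an edge leaves the
window. -/
theorem indicator_score_eq_or_one_le (hψ : IsLocalScore ψ) {S W : Set (Space d)} (hSW : S ⊆ W)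
    (η : Config d) (ω : Marks) (i : ℕ) :
    S.indicator (fun _ => 1) (η i) * ψ (windowGraph α univ η ω) i =
        S.indicator (fun _ => 1) (η i) * ψ (windowGraph α W η ω) i ∨
      1 ≤ ∑' j, open Classical in
        if η i ∈ S ∧ η j ∉ W ∧ (spatialGraph α η ω).Adj i j then (1 : ℝ≥0∞) else 0 := by
  by_cases hi : η i ∈ S
  · by_cases hN : (spatialGraph α η ω).neighborSet i ⊆ {j | η j ∈ W}
    · left
      rw [windowGraph_univ, windowGraph, hψ.within _ _ _ (hSW hi) hN]
    · right
      obtain ⟨j, hj, hjW⟩ := not_subset.1 hN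
      refine le_trans (le_of_eq ?_) (ENNReal.le_tsum j)
      rw [if_pos ⟨hi, hjW, hj⟩]
  · left
    simp [hi]

theorem sumScore_le_add_longEdges (hψ : IsLocalScore ψ) {S W : Set (Space d)} (hSW : S ⊆ W)
    (η : Config d) (ω : Marks) :
    sumScore α ψ univ S η ω ≤ sumScore α ψ W S η ω + longEdges α S W η ω ∧
      sumScore α ψ W S η ω ≤ sumScore α ψ univ S η ω + longEdges α S W η ω := by
  have hle : ∀ (A : Set (Space d)) i,
      S.indicator (fun _ => 1) (η i) * ψ (windowGraph α A η ω) i ≤ 1 := fun A i =>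
    mul_le_one' (indicator_le_self' (fun _ _ => zero_le) (η i)) (hψ.le_one _ _)
  rw [sumScore, sumScore, longEdges, ← ENNReal.tsum_add, ← ENNReal.tsum_add]
  constructor <;> refine ENNReal.tsum_le_tsum fun i => ?_ <;>
    rcases indicator_score_eq_or_one_le hψ hSW η ω i with h | h
  · exact h.le.trans le_self_add
  · exact (hle _ i).trans (h.trans le_add_self)
  · exact h.ge.trans le_self_add
  · exact (hle _ i).trans (h.trans le_add_self)

/-- The expected number of edges from a unit cell to the outside of a window of size `R` decays
like a power of `R`. -/
theorem exists_lintegral_longEdges_le (hd : 1 ≤ d) (hP : IsPoissonPointProcess ν P) (hν : 0 < ν)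
    (hμ : ∀ᵐ w ∂μ, 0 < w) {τ : ℝ} (hτ : HasRegularlyVaryingTail μ τ) (hα : (d : ℝ) < α)
    (hγ : 1 < α * (τ - 1) / d) :
    ∃ ε : ℝ, 0 < ε ∧ ∃ C : ℝ, 0 ≤ C ∧ ∀ R : ℕ, 1 ≤ R → ∀ z : Fin d → ℤ,
      ∫⁻ p, longEdges α (cell z) (window R z) p.1 p.2 ∂(P.prod (markLaw μ)) ≤
        ENNReal.ofReal (C * (R : ℝ) ^ (-ε)) := by
  have hd0 : (0 : ℝ) < d := by exact_mod_cast hd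
  have hα0 : 0 < α := hd0.trans hα
  -- A moment of order `s < τ - 1` is finite, and `α * s > d` makes the edge probabilities
  -- integrable at infinity. Both hypotheses on `α` are used to fit `s` below `1` and `τ - 1`.
  have h1 : d / α < min 1 (τ - 1) := by
    refine lt_min ((div_lt_one hα0).2 hα) ?_
    rw [div_lt_iff₀ hα0, mul_comm]
    exact (one_lt_div hd0).1 hγ
  obtain ⟨s, hs, hs'⟩ := exists_between h1
  have hs0 : 0 < s := (by positivity : 0 < d / α).trans hs
  have hs1 : s < 1 := hs'.trans_le (min_le_left _ _)
  have hb : (d : ℝ) < α * s := by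
    rw [div_lt_iff₀ hα0] at hs
    linarith
  have hK := lintegral_rpow_lt_top_of_tail hτ hs0 (hs'.trans_le (min_le_right _ _))
  obtain ⟨ε, hε, C, hC, hbound⟩ := exists_lintegral_norm_rpow_le hb
  set K := ∫⁻ w, ENNReal.ofReal w ^ s ∂μ
  refine ⟨ε, hε, ν ^ 2 * (K.toReal ^ 2 * C), by positivity, fun R hR z => ?_⟩
  refine (lintegral_longEdges_le μ hP hν hμ hs0 hs1.le (measurableSet_cell z)
    (measurableSet_window R z)).trans ?_
  have hin : ∀ x ∈ (cell z : Set (Space d)),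
      ∫⁻ y in (window R z)ᶜ, ENNReal.ofReal (‖x - y‖ ^ (-(α * s))) ≤
        ENNReal.ofReal (C * (R : ℝ) ^ (-ε)) := by
    intro x hx
    have hT : MeasurableSet {y : Space d | (R : ℝ) ≤ ‖y‖} :=
      measurableSet_le measurable_const measurable_norm
    calc ∫⁻ y in (window R z)ᶜ, ENNReal.ofReal (‖x - y‖ ^ (-(α * s)))
        = ∫⁻ y, (window R z)ᶜ.indicator
            (fun y => ENNReal.ofReal (‖x - y‖ ^ (-(α * s)))) y :=
          (lintegral_indicator (measurableSet_window R z).compl _).symm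
      _ ≤ ∫⁻ y, {y : Space d | (R : ℝ) ≤ ‖y‖}.indicator
            (fun y => ENNReal.ofReal (‖y‖ ^ (-(α * s)))) (x - y) := by
          refine lintegral_mono fun y => ?_
          by_cases hy : y ∈ window R z
          · simp [hy]
          · have : x - y ∈ {y : Space d | (R : ℝ) ≤ ‖y‖} := le_norm_sub_of_notMem_window hx hy
            rw [indicator_of_mem this, indicator_of_mem (by exact hy)]
      _ = ∫⁻ y, {y : Space d | (R : ℝ) ≤ ‖y‖}.indicator
            (fun y => ENNReal.ofReal (‖y‖ ^ (-(α * s)))) y :=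
          lintegral_sub_left_eq_self _ x
      _ = ∫⁻ y in {y : Space d | (R : ℝ) ≤ ‖y‖}, ENNReal.ofReal (‖y‖ ^ (-(α * s))) :=
          lintegral_indicator hT _
      _ ≤ _ := hbound R (by exact_mod_cast hR)
  calc ENNReal.ofReal ν ^ 2 * (K ^ 2 * ∫⁻ x in (cell z : Set (Space d)),
        ∫⁻ y in (window R z)ᶜ, ENNReal.ofReal (‖x - y‖ ^ (-(α * s))))
      ≤ ENNReal.ofReal ν ^ 2 * (K ^ 2 * ∫⁻ _ in (cell z : Set (Space d)),
          ENNReal.ofReal (C * (R : ℝ) ^ (-ε))) := by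
        gcongr _ * (_ * ?_)
        exact setLIntegral_mono' (measurableSet_cell z) hin
    _ = ENNReal.ofReal (ν ^ 2 * (K.toReal ^ 2 * C) * (R : ℝ) ^ (-ε)) := by
        rw [setLIntegral_const, volume_cell, mul_one, ← ENNReal.ofReal_toReal hK.ne,
          ← ENNReal.ofReal_pow hν.le, ← ENNReal.ofReal_pow ENNReal.toReal_nonneg,
          ← ENNReal.ofReal_mul (by positivity), ← ENNReal.ofReal_mul (by positivity),
          ENNReal.toReal_ofReal ENNReal.toReal_nonneg]
        congr 1
        ring

end

section

/-! ### The law of large numbers for scores -/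

variable {d : ℕ} {ν : ℝ} {P : Measure (Config d)} {α : ℝ} (μ : Measure ℝ)
  [IsProbabilityMeasure μ] {ψ : SimpleGraph ℕ → ℕ → ℝ≥0∞}

theorem meanScore_le_one (hψ : IsLocalScore ψ) (A : Set (Space d)) (η : Config d) (i : ℕ) :
    meanScore α μ ψ A η i ≤ 1 := by
  calc meanScore α μ ψ A η i ≤ ∫⁻ _, 1 ∂(markLaw μ) := lintegral_mono fun ω => hψ.le_one _ _
    _ = 1 := by simp

theorem palmScore_le_one (hP : IsPoissonPointProcess ν P) (hψ : IsLocalScore ψ) :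
    palmScore μ α ψ P ≤ 1 := by
  have := hP.isProbabilityMeasure
  calc palmScore μ α ψ P ≤ ∫⁻ _, 1 ∂P := lintegral_mono fun η => meanScore_le_one μ hψ _ _ _
    _ = 1 := by simp

theorem palmScore_eq_zero_iff (hψ : IsLocalScore ψ) : palmScore μ α ψ P = 0 ↔
    ∀ᵐ η ∂P, ∀ᵐ ω ∂(markLaw μ), ψ (spatialGraph α (consPoint 0 η) ω) 0 = 0 := by
  rw [palmScore, lintegral_eq_zero_iff (measurable_meanScore_consPoint_right μ hψ 0)]
  refine eventually_congr (Eventually.of_forall fun η => ?_)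
  have hm : Measurable fun ω => ψ (windowGraph α univ (consPoint (0 : Space d) η) ω) 0 :=
    (measurable_score_joint hψ MeasurableSet.univ 0).comp measurable_prodMk_left
  change ∫⁻ ω, ψ (windowGraph α univ (consPoint 0 η) ω) 0 ∂(markLaw μ) = 0 ↔ _
  rw [lintegral_eq_zero_iff hm]
  simp only [windowGraph_univ]
  rfl

theorem lintegral_pointCount_sq_prod (hP : IsPoissonPointProcess ν P) (hν : 0 < ν)
    {S : Set (Space d)} (hS : MeasurableSet S) :
    ∫⁻ p, (pointCount S p.1 : ℝ≥0∞) ^ 2 ∂(P.prod (markLaw μ)) =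
      ENNReal.ofReal ν * volume S + (ENNReal.ofReal ν * volume S) ^ 2 := by
  have := hP.isProbabilityMeasure
  have hm : Measurable fun η : Config d => (pointCount S η : ℝ≥0∞) ^ 2 :=
    (Measurable.of_discrete (f := fun n : ℕ∞ => (n : ℝ≥0∞) ^ 2)).comp (measurable_pointCount hS)
  have hm' : Measurable fun p : Config d × Marks => (pointCount S p.1 : ℝ≥0∞) ^ 2 :=
    hm.comp measurable_fst
  rw [lintegral_prod _ hm'.aemeasurable]
  simpa using lintegral_pointCount_sq hP hν hS

theorem lintegral_sumScore_sq_le (hP : IsPoissonPointProcess ν P) (hν : 0 < ν)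
    (hψ : IsLocalScore ψ) (A : Set (Space d)) (z : Fin d → ℤ) :
    ∫⁻ p, sumScore α ψ A (cell z) p.1 p.2 ^ 2 ∂(P.prod (markLaw μ)) ≤
      ENNReal.ofReal (ν + ν ^ 2) := by
  calc ∫⁻ p, sumScore α ψ A (cell z) p.1 p.2 ^ 2 ∂(P.prod (markLaw μ))
      ≤ ∫⁻ p, (pointCount (cell z) p.1 : ℝ≥0∞) ^ 2 ∂(P.prod (markLaw μ)) :=
        lintegral_mono fun p => by
          gcongr
          exact sumScore_le hψ _ _ _ _
    _ = ENNReal.ofReal (ν + ν ^ 2) := by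
        rw [lintegral_pointCount_sq_prod μ hP hν (measurableSet_cell z), volume_cell, mul_one,
          ENNReal.ofReal_add hν.le (by positivity), ENNReal.ofReal_pow hν.le]

theorem memLp_two_toReal {Ω : Type*} [MeasurableSpace Ω] {Q : Measure Ω} {f : Ω → ℝ≥0∞}
    (hf : Measurable f) (h : ∫⁻ x, f x ^ 2 ∂Q ≠ ∞) : MemLp (fun x => (f x).toReal) 2 Q := by
  refine (memLp_two_iff_integrable_sq hf.ennreal_toReal.aestronglyMeasurable).2 ?_
  simp_rw [← ENNReal.toReal_pow]
  exact integrable_toReal_of_lintegral_ne_top (hf.pow_const 2).aemeasurable h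

theorem memLp_sumScore (hP : IsPoissonPointProcess ν P) (hν : 0 < ν) (hψ : IsLocalScore ψ)
    {A : Set (Space d)} (hA : MeasurableSet A) (z : Fin d → ℤ) :
    MemLp (fun p : Config d × Marks => (sumScore α ψ A (cell z) p.1 p.2).toReal) 2
      (P.prod (markLaw μ)) :=
  memLp_two_toReal (measurable_sumScore_joint hψ hA (measurableSet_cell z))
    (ne_top_of_le_ne_top ENNReal.ofReal_ne_top (lintegral_sumScore_sq_le μ hP hν hψ A z))

theorem ae_sumScore_lt_top (hP : IsPoissonPointProcess ν P) (hν : 0 < ν) (hψ : IsLocalScore ψ)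
    {A : Set (Space d)} (hA : MeasurableSet A) (z : Fin d → ℤ) :
    ∀ᵐ p ∂(P.prod (markLaw μ)), sumScore α ψ A (cell z) p.1 p.2 < ∞ := by
  have h := ae_lt_top ((measurable_sumScore_joint (α := α) hψ hA
    (measurableSet_cell z)).pow_const 2)
    (ne_top_of_le_ne_top ENNReal.ofReal_ne_top (lintegral_sumScore_sq_le μ hP hν hψ A z))
  filter_upwards [h] with p hp
  by_contra hc
  rw [not_lt_top_iff] at hc
  simp [hc] at hp

theorem variance_sumScore_le (hP : IsPoissonPointProcess ν P) (hν : 0 < ν) (hψ : IsLocalScore ψ)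
    {A : Set (Space d)} (hA : MeasurableSet A) (z : Fin d → ℤ) :
    Var[fun p : Config d × Marks => (sumScore α ψ A (cell z) p.1 p.2).toReal;
      P.prod (markLaw μ)] ≤ ν + ν ^ 2 := by
  have := hP.isProbabilityMeasure
  have hm := measurable_sumScore_joint (α := α) hψ hA (measurableSet_cell z)
  have hle := lintegral_sumScore_sq_le (α := α) μ hP hν hψ A z
  refine (variance_le_expectation_sq hm.ennreal_toReal.aestronglyMeasurable).trans ?_
  have : ∀ p : Config d × Marks,
      ((fun p => (sumScore α ψ A (cell z) p.1 p.2).toReal) ^ 2) p =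
        (sumScore α ψ A (cell z) p.1 p.2 ^ 2).toReal := fun p => by
    rw [ENNReal.toReal_pow]; rfl
  simp_rw [this]
  rw [integral_toReal (hm.pow_const 2).aemeasurable
    (ae_lt_top (hm.pow_const 2) (ne_top_of_le_ne_top ENNReal.ofReal_ne_top hle))]
  exact ENNReal.toReal_le_of_le_ofReal (by positivity) hle

/-- Sums of scores in disjoint windows are independent: given the points the marks used are
disjoint, and the points in disjoint windows are independent. -/
theorem lintegral_sumScore_mul_prod (hd : 1 ≤ d) (hP : IsPoissonPointProcess ν P)
    (hψ : IsLocalScore ψ) (R : ℕ) {z z' : Fin d → ℤ}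
    (hdisj : Disjoint (window R z : Set (Space d)) (window R z')) :
    ∫⁻ p, sumScore α ψ (window R z) (cell z) p.1 p.2 *
        sumScore α ψ (window R z') (cell z') p.1 p.2 ∂(P.prod (markLaw μ)) =
      (∫⁻ p, sumScore α ψ (window R z) (cell z) p.1 p.2 ∂(P.prod (markLaw μ))) *
        ∫⁻ p, sumScore α ψ (window R z') (cell z') p.1 p.2 ∂(P.prod (markLaw μ)) := by
  have := hP.isProbabilityMeasure
  have hm : ∀ z, Measurable fun p : Config d × Marks =>
      sumScore α ψ (window R z) (cell z) p.1 p.2 := fun z =>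
    measurable_sumScore_joint hψ (measurableSet_window R z) (measurableSet_cell z)
  have hmul : Measurable fun p : Config d × Marks => sumScore α ψ (window R z) (cell z) p.1 p.2 *
      sumScore α ψ (window R z') (cell z') p.1 p.2 := (hm z).mul (hm z')
  obtain ⟨p, hp⟩ := exists_notMem_window hd R z
  obtain ⟨p', hp'⟩ := exists_notMem_window hd R z'
  rw [lintegral_prod _ hmul.aemeasurable, lintegral_prod _ (hm z).aemeasurable,
    lintegral_prod _ (hm z').aemeasurable,
    ← lintegral_mul_of_disjoint hP (measurableSet_window R z) (measurableSet_window R z')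
      (volume_window_ne_top R z) (volume_window_ne_top R z') hdisj
      (hm z).lintegral_prod_right' (hm z').lintegral_prod_right'
      (fun η σ => lintegral_sumScore_comp_perm μ hψ (measurableSet_window R z) _ η σ)
      (fun η σ => lintegral_sumScore_comp_perm μ hψ (measurableSet_window R z') _ η σ)
      (p := p) (p' := p')
      (fun η => lintegral_congr fun ω => sumScore_maskOutside (cell_subset_window R z) hp η ω)
      (fun η => lintegral_congr fun ω => sumScore_maskOutside (cell_subset_window R z') hp' η ω)]
  refine lintegral_congr_ae ?_
  filter_upwards [ae_isLocallyFinite hP] with η hη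
  exact lintegral_sumScore_mul α μ hψ (measurableSet_window R z) (measurableSet_window R z')
    hdisj (measurableSet_cell z) (measurableSet_cell z') (hη.finite_window R z)
    (hη.finite_window R z')

theorem covariance_sumScore (hd : 1 ≤ d) (hP : IsPoissonPointProcess ν P) (hν : 0 < ν)
    (hψ : IsLocalScore ψ) (R : ℕ) {z z' : Fin d → ℤ}
    (hdisj : Disjoint (window R z : Set (Space d)) (window R z')) :
    cov[fun p : Config d × Marks => (sumScore α ψ (window R z) (cell z) p.1 p.2).toReal,
      fun p => (sumScore α ψ (window R z') (cell z') p.1 p.2).toReal; P.prod (markLaw μ)] = 0 := by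
  have := hP.isProbabilityMeasure
  have hm : ∀ z, Measurable fun p : Config d × Marks =>
      sumScore α ψ (window R z) (cell z) p.1 p.2 := fun z =>
    measurable_sumScore_joint hψ (measurableSet_window R z) (measurableSet_cell z)
  have hfin := fun z => ae_sumScore_lt_top (α := α) μ hP hν hψ (measurableSet_window R z) z
  rw [covariance_eq_sub (memLp_sumScore μ hP hν hψ (measurableSet_window R z) z)
    (memLp_sumScore μ hP hν hψ (measurableSet_window R z') z'), sub_eq_zero,
    integral_toReal (hm z).aemeasurable (hfin z), integral_toReal (hm z').aemeasurable (hfin z'),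
    ← ENNReal.toReal_mul, ← lintegral_sumScore_mul_prod μ hd hP hψ R hdisj]
  simp only [Pi.mul_apply, ← ENNReal.toReal_mul]
  refine integral_toReal ((hm z).mul (hm z')).aemeasurable ?_
  filter_upwards [hfin z, hfin z'] with p h1 h2
  exact ENNReal.mul_lt_top h1 h2

theorem integral_abs_sumScore_sub_le (hP : IsPoissonPointProcess ν P) (hν : 0 < ν)
    (hψ : IsLocalScore ψ) (R : ℕ) (z : Fin d → ℤ) {c : ℝ} (hc : 0 ≤ c)
    (hL : ∫⁻ p, longEdges α (cell z) (window R z) p.1 p.2 ∂(P.prod (markLaw μ)) ≤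
      ENNReal.ofReal c) :
    ∫ p, |(sumScore α ψ univ (cell z) p.1 p.2).toReal -
        (sumScore α ψ (window R z) (cell z) p.1 p.2).toReal| ∂(P.prod (markLaw μ)) ≤ c := by
  have := hP.isProbabilityMeasure
  have hY := measurable_sumScore_joint (α := α) (d := d) hψ MeasurableSet.univ
    (measurableSet_cell z)
  have hZ := measurable_sumScore_joint (α := α) hψ (measurableSet_window R z)
    (measurableSet_cell z)
  have hm : Measurable fun p : Config d × Marks => |(sumScore α ψ univ (cell z) p.1 p.2).toReal -
      (sumScore α ψ (window R z) (cell z) p.1 p.2).toReal| :=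
    (hY.ennreal_toReal.sub hZ.ennreal_toReal).norm
  rw [integral_eq_lintegral_of_nonneg_ae (ae_of_all _ fun p => abs_nonneg _)
    hm.aestronglyMeasurable]
  refine ENNReal.toReal_le_of_le_ofReal hc (le_trans (lintegral_mono_ae ?_) hL)
  filter_upwards [ae_sumScore_lt_top (α := α) μ hP hν hψ MeasurableSet.univ z,
    ae_sumScore_lt_top (α := α) μ hP hν hψ (measurableSet_window R z) z] with p h1 h2
  obtain ⟨h3, h4⟩ := sumScore_le_add_longEdges (α := α) hψ (cell_subset_window R z) p.1 p.2
  generalize sumScore α ψ univ (cell z) p.1 p.2 = a at *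
  generalize sumScore α ψ (window R z) (cell z) p.1 p.2 = b at *
  generalize longEdges α (cell z) (window R z) p.1 p.2 = l at *
  by_cases hl : l = ∞
  · simp [hl]
  lift a to ℝ≥0 using h1.ne
  lift b to ℝ≥0 using h2.ne
  lift l to ℝ≥0 using hl
  norm_cast at h3 h4
  refine ENNReal.ofReal_le_of_le_toReal (abs_sub_le_iff.2 ⟨?_, ?_⟩)
  · have : (a : ℝ) ≤ l + b := by rw [add_comm]; exact_mod_cast h3
    simpa [sub_le_iff_le_add] using this
  · have : (b : ℝ) ≤ l + a := by rw [add_comm]; exact_mod_cast h4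
    simpa [sub_le_iff_le_add] using this

/-- The law of large numbers for the scores of the points in large lattice boxes. -/
theorem ae_tendsto_sum_sumScore (hd : 1 ≤ d) (hP : IsPoissonPointProcess ν P) (hν : 0 < ν)
    (hψ : IsLocalScore ψ) {ε C : ℝ} (hε : 0 < ε) (hC : 0 ≤ C)
    (hL : ∀ R : ℕ, 1 ≤ R → ∀ z : Fin d → ℤ,
      ∫⁻ p, longEdges α (cell z) (window R z) p.1 p.2 ∂(P.prod (markLaw μ)) ≤
        ENNReal.ofReal (C * (R : ℝ) ^ (-ε))) :
    ∀ᵐ p ∂(P.prod (markLaw μ)), Tendsto (fun m : ℕ =>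
      (∑ z ∈ latticeBox d m, (sumScore α ψ univ (cell z) p.1 p.2).toReal) / (2 * (m : ℝ)) ^ d)
      atTop (𝓝 (ν * (palmScore μ α ψ P).toReal)) := by
  have := hP.isProbabilityMeasure
  refine strong_law_latticeBox hd
    (Y := fun z (p : Config d × Marks) => (sumScore α ψ univ (cell z) p.1 p.2).toReal)
    (Z := fun R z (p : Config d × Marks) => (sumScore α ψ (window R z) (cell z) p.1 p.2).toReal)
    (fun _ _ => ENNReal.toReal_nonneg)
    (fun z => (memLp_sumScore μ hP hν hψ MeasurableSet.univ z).integrable one_le_two)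
    (fun z => ?_) (fun R z => memLp_sumScore μ hP hν hψ (measurableSet_window R z) z)
    (K := ν + ν ^ 2) (by positivity)
    (fun R z => variance_sumScore_le μ hP hν hψ (measurableSet_window R z) z) 4
    (fun R hR z z' h => covariance_sumScore μ hd hP hν hψ R (disjoint_window hR h)) hC hε
    (fun R hR z => integral_abs_sumScore_sub_le μ hP hν hψ R z (by positivity) (hL R hR z))
  rw [integral_toReal (measurable_sumScore_joint hψ MeasurableSet.univ
    (measurableSet_cell z)).aemeasurable (ae_sumScore_lt_top μ hP hν hψ MeasurableSet.univ z),
    lintegral_sumScore_univ μ hP hν hψ (measurableSet_cell z), volume_cell, one_mul,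
    ENNReal.toReal_mul, ENNReal.toReal_ofReal hν.le]

/-! ### Finiteness of the degrees -/

theorem measurableSet_finite_neighborSet (i : ℕ) :
    MeasurableSet {G : SimpleGraph ℕ | (G.neighborSet i).Finite} := by
  have h : Measurable fun G : SimpleGraph ℕ => (G.neighborSet i).encard :=
    measurable_encard.comp (measurable_neighborSet i)
  have : {G : SimpleGraph ℕ | (G.neighborSet i).Finite} =
      (fun G : SimpleGraph ℕ => (G.neighborSet i).encard) ⁻¹' {⊤}ᶜ := by
    ext G
    simp [encard_eq_top_iff]
  rw [this]
  exact h MeasurableSet.of_discrete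

open Classical in
/-- To have infinitely many neighbours is a local score; this transfers the finiteness of the degrees
to the Palm law. -/
theorem isLocalScore_infinite :
    IsLocalScore fun G i => if (G.neighborSet i).Finite then 0 else 1 where
  measurable i := Measurable.ite (measurableSet_finite_neighborSet i) measurable_const
    measurable_const
  le_one G i := by split_ifs <;> simp
  comap G σ i := by
    have : (G.comap σ).neighborSet i = σ ⁻¹' G.neighborSet (σ i) := rfl
    simp only [this, ← Equiv.image_symm_eq_preimage, finite_image_iff σ.symm.injective.injOn]
  within G A i hi hA := by
    have : (within G A).neighborSet i = G.neighborSet i := by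
      ext j
      exact ⟨fun h => h.1, fun h => ⟨h, hi, hA h⟩⟩
    rw [this]

theorem finite_neighborSet_of_longEdges_ne_top {η : Config d} {ω : Marks}
    (hη : IsLocallyFinite η) {R : ℕ} {z : Fin d → ℤ}
    (h : longEdges α (cell z) (window R z) η ω ≠ ∞) {i : ℕ} (hi : η i ∈ cell z) :
    ((spatialGraph α η ω).neighborSet i).Finite := by
  have h1 := ENNReal.finite_const_le_of_tsum_ne_top
    (ne_top_of_le_ne_top h (ENNReal.le_tsum i)) one_ne_zero
  refine ((hη.finite_window R z).union h1).subset fun j hj => ?_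
  by_cases hjW : η j ∈ window R z
  · exact Or.inl hjW
  · right
    rw [mem_ofPred_eq, if_pos ⟨hi, hjW, hj⟩]

/-- Only finitely many edges leave the window of a cell, and the window has finitely many points. -/
theorem ae_finite_neighborSet (hP : IsPoissonPointProcess ν P) {C ε : ℝ}
    (hL : ∀ R : ℕ, 1 ≤ R → ∀ z : Fin d → ℤ,
      ∫⁻ p, longEdges α (cell z) (window R z) p.1 p.2 ∂(P.prod (markLaw μ)) ≤
        ENNReal.ofReal (C * (R : ℝ) ^ (-ε))) :
    ∀ᵐ p ∂(P.prod (markLaw μ)), ∀ i, ((spatialGraph α p.1 p.2).neighborSet i).Finite := by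
  have := hP.isProbabilityMeasure
  have h1 : ∀ᵐ p ∂(P.prod (markLaw μ)), ∀ z : Fin d → ℤ,
      longEdges α (cell z) (window 1 z) p.1 p.2 < ∞ := ae_all_iff.2 fun z =>
    ae_lt_top (measurable_longEdges (measurableSet_cell z) (measurableSet_window 1 z))
      (ne_top_of_le_ne_top ENNReal.ofReal_ne_top (hL 1 le_rfl z))
  have h2 : ∀ᵐ p ∂(P.prod (markLaw μ)), IsLocallyFinite p.1 :=
    measurePreserving_fst.quasiMeasurePreserving.ae (ae_isLocallyFinite hP)
  filter_upwards [h1, h2] with p hp hη i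
  obtain ⟨z, hz⟩ := exists_mem_cell (p.1 i)
  exact finite_neighborSet_of_longEdges_ne_top hη (hp z).ne hz

/-- Under the Palm law the degree of the origin is finite: the expected number of vertices of
infinite degree in a cell vanishes, and it is a multiple of the Palm probability. -/
theorem ae_finite_neighborSet_palm (hP : IsPoissonPointProcess ν P) (hν : 0 < ν) {C ε : ℝ}
    (hL : ∀ R : ℕ, 1 ≤ R → ∀ z : Fin d → ℤ,
      ∫⁻ p, longEdges α (cell z) (window R z) p.1 p.2 ∂(P.prod (markLaw μ)) ≤
        ENNReal.ofReal (C * (R : ℝ) ^ (-ε))) :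
    ∀ᵐ η ∂P, ∀ᵐ ω ∂(markLaw μ),
      ((spatialGraph α (consPoint 0 η) ω).neighborSet 0).Finite := by
  classical
  have hψ := isLocalScore_infinite
  have h0 : ∫⁻ p, sumScore α (fun G i => if (G.neighborSet i).Finite then 0 else 1) univ
      (cell 0 : Set (Space d)) p.1 p.2 ∂(P.prod (markLaw μ)) = 0 := by
    rw [lintegral_eq_zero_iff (measurable_sumScore_joint hψ MeasurableSet.univ
      (measurableSet_cell 0))]
    filter_upwards [ae_finite_neighborSet μ hP hL] with p hp
    simp [sumScore, windowGraph_univ, hp]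
  rw [lintegral_sumScore_univ μ hP hν hψ (measurableSet_cell 0), volume_cell, one_mul,
    mul_eq_zero, or_iff_right (by simpa using hν), palmScore_eq_zero_iff μ hψ] at h0
  filter_upwards [h0] with η hη
  filter_upwards [hη] with ω hω
  by_contra hc
  simp [hc] at hω

/-- The origin and two points of the process form a triangle with positive probability. -/
theorem palmScore_localCC_pos (hd : 1 ≤ d) (hP : IsPoissonPointProcess ν P) (hν : 0 < ν)
    (hμ : ∀ᵐ w ∂μ, 0 < w) {C ε : ℝ}
    (hL : ∀ R : ℕ, 1 ≤ R → ∀ z : Fin d → ℤ,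
      ∫⁻ p, longEdges α (cell z) (window R z) p.1 p.2 ∂(P.prod (markLaw μ)) ≤
        ENNReal.ofReal (C * (R : ℝ) ^ (-ε))) :
    0 < palmScore μ α (fun G i => ENNReal.ofReal (localCC G i)) P := by
  have := hP.isProbabilityMeasure
  rw [pos_iff_ne_zero]
  intro h0
  rw [palmScore_eq_zero_iff μ isLocalScore_localCC] at h0
  obtain ⟨η, hη, hfin, hinj, hne⟩ := (h0.and ((ae_finite_neighborSet_palm μ hP hν hL).and
    ((ae_injective hd hP hν).and (ae_point_ne hd hP hν 0)))).exists
  have htri := markLaw_triangle_pos μ hμ α (consPoint 0 η) (hne 0).symm (hne 1).symm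
    (hinj.ne zero_ne_one)
  refine htri.ne' (measure_mono_null (fun ω hω => ?_) (hη.and hfin))
  intro hc
  have h1 := localCC_pos_of_triangle hc.2 hω.1 hω.2.1 hω.2.2
  exact h1.not_ge (ENNReal.ofReal_eq_zero.1 hc.1)

end

section

/-! ### From cells to boxes -/

variable {d : ℕ} {ν : ℝ} {P : Measure (Config d)} {α : ℝ} {ψ : SimpleGraph ℕ → ℕ → ℝ≥0∞}

/-- The half-open cube that is the union of the cells of `latticeBox d m`. The boxes are squeezed
between such cubes, as they are not unions of cells themselves. -/
def cube (d m : ℕ) : Set (Space d) := {x | ∀ i, -(m : ℝ) ≤ x i ∧ x i < m}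

theorem cube_subset_box (d n : ℕ) : cube d (n / 2) ⊆ box d n := by
  intro x hx i
  have h1 := hx i
  have h2 : ((n / 2 : ℕ) : ℝ) ≤ n / 2 := Nat.cast_div_le
  exact abs_le.2 ⟨by linarith, by linarith⟩

theorem box_subset_cube (d n : ℕ) : box d n ⊆ cube d (n / 2 + 1) := by
  intro x hx i
  have h1 := abs_le.1 (hx i)
  have h2 : (n : ℝ) / 2 < ((n / 2 + 1 : ℕ) : ℝ) := by
    rw [div_lt_iff₀ two_pos]
    exact_mod_cast (by lia : n < (n / 2 + 1) * 2)
  constructor <;> linarith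

theorem indicator_cube (m : ℕ) (x : Space d) : (cube d m).indicator (fun _ => (1 : ℝ≥0∞)) x =
    ∑ z ∈ latticeBox d m, (cell z).indicator (fun _ => (1 : ℝ≥0∞)) x := by
  classical
  have hcell : ∀ z, x ∈ cell z ↔ z = fun i => ⌊x i⌋ := fun z => by
    constructor
    · exact fun h => funext fun i => (Int.floor_eq_iff.2 (h i)).symm
    · rintro rfl i
      exact ⟨Int.floor_le _, Int.lt_floor_add_one _⟩
  have hsum : ∑ z ∈ latticeBox d m, (cell z).indicator (fun _ => (1 : ℝ≥0∞)) x =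
      ∑ z ∈ latticeBox d m, if z = (fun i => ⌊x i⌋) then 1 else 0 :=
    Finset.sum_congr rfl fun z _ => by simp only [indicator_apply, hcell]
  rw [hsum, Finset.sum_ite_eq', indicator_apply]
  congr 1
  rw [mem_latticeBox, eq_iff_iff]
  refine forall_congr' fun i => and_congr ?_ ?_
  · rw [Int.le_floor]; push_cast; rfl
  · rw [Int.floor_lt]; push_cast; rfl

theorem sumScore_cube (α : ℝ) (m : ℕ) (η : Config d) (ω : Marks) :
    sumScore α ψ univ (cube d m) η ω =
      ∑ z ∈ latticeBox d m, sumScore α ψ univ (cell z) η ω := by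
  simp only [sumScore, indicator_cube, Finset.sum_mul]
  exact Summable.tsum_finsetSum fun _ _ => ENNReal.summable

theorem sumScore_mono (α : ℝ) {S S' : Set (Space d)} (h : S ⊆ S') (η : Config d) (ω : Marks) :
    sumScore α ψ univ S η ω ≤ sumScore α ψ univ S' η ω :=
  ENNReal.tsum_le_tsum fun i => by
    gcongr

theorem sumScore_ne_top (hψ : IsLocalScore ψ) {S : Set (Space d)} {η : Config d}
    (h : {i | η i ∈ S}.Finite) (ω : Marks) : sumScore α ψ univ S η ω ≠ ∞ := by
  refine ne_top_of_le_ne_top ?_ (sumScore_le hψ univ S η ω)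
  rw [pointCount, h.encard_eq_coe_toFinset_card]
  simp

theorem IsLocallyFinite.finite_cell {η : Config d} (hη : IsLocallyFinite η) (z : Fin d → ℤ) :
    {i | η i ∈ cell z}.Finite :=
  (hη.finite_window 0 z).subset fun _ hi => cell_subset_window 0 z hi

theorem IsLocallyFinite.finite_cube {η : Config d} (hη : IsLocallyFinite η) (m : ℕ) :
    {i | η i ∈ cube d m}.Finite := by
  refine (hη.finite_window m 0).subset fun j hj i => ?_
  have := hj i
  simp only [Pi.zero_apply, Int.cast_zero, sub_zero]
  exact abs_le.2 ⟨by linarith, by linarith⟩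

theorem IsLocallyFinite.finite_boxVertices {η : Config d} (hη : IsLocallyFinite η) (n : ℕ) :
    (boxVertices η n).Finite :=
  (hη.finite_cube (n / 2 + 1)).subset fun _ hi => box_subset_cube d n hi

/-- Convergence of a normalized sequence that is squeezed between two terms of another one. -/
theorem tendsto_div_pow_of_half {T B : ℕ → ℝ} {c : ℝ} (d : ℕ) (hB : ∀ n, T (n / 2) ≤ B n)
    (hB' : ∀ n, B n ≤ T (n / 2 + 1))
    (hT : Tendsto (fun m : ℕ => T m / (2 * (m : ℝ)) ^ d) atTop (𝓝 c)) :
    Tendsto (fun n : ℕ => B n / (n : ℝ) ^ d) atTop (𝓝 c) := by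
  have hhalf : Tendsto (fun n : ℕ => n / 2) atTop atTop :=
    Nat.tendsto_div_const_atTop two_ne_zero
  have hhalf' : Tendsto (fun n : ℕ => n / 2 + 1) atTop atTop :=
    (tendsto_add_atTop_nat 1).comp hhalf
  have hlim : ∀ e : ℕ, e ≤ 1 →
      Tendsto (fun n : ℕ => (2 * ((n / 2 + e : ℕ) : ℝ)) / n) atTop (𝓝 1) := by
    intro e he
    have h0 := tendsto_const_div_atTop_nhds_zero_nat (2 : ℝ)
    refine tendsto_of_tendsto_of_tendsto_of_le_of_le' (g := fun n : ℕ => 1 - 2 / (n : ℝ))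
      (h := fun n : ℕ => 1 + 2 / (n : ℝ)) (by simpa using h0.const_sub 1)
      (by simpa using h0.const_add 1) ?_ ?_ <;>
      filter_upwards [eventually_gt_atTop 0] with n hn
    · have hn' : (0 : ℝ) < n := by exact_mod_cast hn
      rw [one_sub_div hn'.ne', div_le_div_iff_of_pos_right hn', sub_le_iff_le_add]
      exact_mod_cast (by lia : n ≤ 2 * (n / 2 + e) + 2)
    · have hn' : (0 : ℝ) < n := by exact_mod_cast hn
      rw [one_add_div hn'.ne', div_le_div_iff_of_pos_right hn']
      exact_mod_cast (by lia : 2 * (n / 2 + e) ≤ n + 2)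
  have hmain : ∀ e : ℕ, e ≤ 1 → Tendsto (fun n : ℕ => n / 2 + e) atTop atTop →
      Tendsto (fun n : ℕ => T (n / 2 + e) / (n : ℝ) ^ d) atTop (𝓝 c) := by
    intro e he hte
    have h := (hT.comp hte).mul ((hlim e he).pow d)
    rw [one_pow, mul_one] at h
    refine h.congr' ?_
    filter_upwards [hte.eventually_gt_atTop 0] with n hn
    have : (2 * ((n / 2 + e : ℕ) : ℝ)) ^ d ≠ 0 := by positivity
    simp only [Function.comp_apply]
    rw [div_pow, div_mul_div_cancel₀ this]
  refine tendsto_of_tendsto_of_tendsto_of_le_of_le (hmain 0 zero_le_one hhalf)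
    (hmain 1 le_rfl hhalf') (fun n => ?_) fun n => ?_
  · exact div_le_div_of_nonneg_right (hB n) (by positivity)
  · exact div_le_div_of_nonneg_right (hB' n) (by positivity)

theorem tendsto_sumScore_box (hψ : IsLocalScore ψ) {η : Config d} (hη : IsLocallyFinite η)
    {ω : Marks} {c : ℝ} (h : Tendsto (fun m : ℕ =>
      (∑ z ∈ latticeBox d m, (sumScore α ψ univ (cell z) η ω).toReal) / (2 * (m : ℝ)) ^ d)
      atTop (𝓝 c)) :
    Tendsto (fun n : ℕ => (sumScore α ψ univ (box d n) η ω).toReal / (n : ℝ) ^ d)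
      atTop (𝓝 c) := by
  refine tendsto_div_pow_of_half (T := fun m => (sumScore α ψ univ (cube d m) η ω).toReal) d
    (fun n => ?_) (fun n => ?_) ?_
  · exact ENNReal.toReal_mono (sumScore_ne_top hψ (hη.finite_boxVertices n) ω)
      (sumScore_mono α (cube_subset_box d n) η ω)
  · exact ENNReal.toReal_mono (sumScore_ne_top hψ (hη.finite_cube _) ω)
      (sumScore_mono α (box_subset_cube d n) η ω)
  · simp_rw [sumScore_cube]
    simpa only [ENNReal.toReal_sum fun z _ => sumScore_ne_top hψ (hη.finite_cell z) ω] using h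

theorem toReal_sumScore (α : ℝ) (hψ : IsLocalScore ψ) {S : Set (Space d)} {η : Config d}
    (h : {i | η i ∈ S}.Finite) (ω : Marks) : (sumScore α ψ univ S η ω).toReal =
      ∑ i ∈ h.toFinset, (ψ (spatialGraph α η ω) i).toReal := by
  rw [sumScore, tsum_eq_sum (s := h.toFinset) fun i hi => by
    rw [indicator_of_notMem (by simpa using hi), zero_mul],
    ENNReal.toReal_sum fun i _ => ENNReal.mul_ne_top (by
      by_cases hi : η i ∈ S <;> simp [hi]) (ne_top_of_le_ne_top ENNReal.one_ne_top
        (hψ.le_one _ _))]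
  refine Finset.sum_congr rfl fun i hi => ?_
  rw [indicator_of_mem (by simpa using hi), one_mul, windowGraph_univ]

theorem averagedCC_eq_sum {η : Config d} {n : ℝ} (h : (boxVertices η n).Finite)
    (G : SimpleGraph ℕ) :
    averagedCC η G n = (∑ i ∈ h.toFinset, localCC G i) / (h.toFinset.card : ℝ) := by
  rw [averagedCC, finsum_mem_eq_finite_toFinset_sum _ h, ncard_eq_toFinset_card _ h]

theorem averagedCC_eq_div {η : Config d} (hη : IsLocallyFinite η) (ω : Marks) (n : ℕ) :
    averagedCC η (spatialGraph α η ω) n =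
      (sumScore α (fun G i => ENNReal.ofReal (localCC G i)) univ (box d n) η ω).toReal /
        (sumScore α (fun _ _ => 1) univ (box d n) η ω).toReal := by
  have h := hη.finite_boxVertices n
  rw [averagedCC_eq_sum h, toReal_sumScore α isLocalScore_localCC h,
    toReal_sumScore α isLocalScore_one h]
  simp only [ENNReal.toReal_ofReal (localCC_nonneg _ _), ENNReal.toReal_one, Finset.sum_const,
    nsmul_eq_mul, mul_one]
  rfl

theorem measurable_averagedCC {η : Config d} (hη : IsLocallyFinite η) (n : ℕ) :
    Measurable fun G => averagedCC η G n := by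
  simp_rw [averagedCC_eq_sum (hη.finite_boxVertices n)]
  exact (Finset.measurable_sum _ fun i _ => measurable_localCC i).div_const _

/-! ### The Palm expectation of the local clustering coefficient -/

variable (μ : Measure ℝ) [IsProbabilityMeasure μ]

theorem palmScore_one (hP : IsPoissonPointProcess ν P) :
    palmScore μ α (fun _ _ => 1) P = 1 := by
  have := hP.isProbabilityMeasure
  simp [palmScore, meanScore]

theorem palmCC_eq_toReal_palmScore (hP : IsPoissonPointProcess ν P) :
    palmCC α μ P = (palmScore μ α (fun G i => ENNReal.ofReal (localCC G i)) P).toReal := by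
  have := hP.isProbabilityMeasure
  have hψ := isLocalScore_localCC
  rw [palmScore, ← integral_toReal (measurable_meanScore_consPoint_right μ hψ 0).aemeasurable
    (ae_of_all _ fun η => (meanScore_le_one μ hψ univ _ 0).trans_lt ENNReal.one_lt_top), palmCC]
  refine integral_congr_ae (ae_of_all _ fun η => ?_)
  have hm := (measurable_localCC 0).comp (measurable_spatialGraph α (consPoint 0 η))
  simp only [addOrigin_eq_consPoint, meanScore, windowGraph_univ, quenchedLaw]
  rw [integral_map (measurable_spatialGraph α _).aemeasurable
    (measurable_localCC 0).aestronglyMeasurable,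
    integral_eq_lintegral_of_nonneg_ae (ae_of_all _ fun ω => localCC_nonneg _ _)
      hm.aestronglyMeasurable]

end

end SpatialClustering

open SpatialClustering

theorem theorem2p3 (d : ℕ) (hd : 1 ≤ d) (ν : ℝ) (hν : 0 < ν)
    (P : Measure (Config d)) (hP : IsPoissonPointProcess ν P)
    (μ : Measure ℝ) [IsProbabilityMeasure μ] (hμ : ∀ᵐ w ∂μ, 0 < w)
    (τ : ℝ) (hτ : HasRegularlyVaryingTail μ τ)
    (α : ℝ) (hα : (d : ℝ) < α) (hγ : 1 < α * (τ - 1) / d) :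
    (∀ᵐ η ∂P, ∀ᵐ G ∂(quenchedLaw α μ η),
      (∀ x, (G.neighborSet x).Finite) ∧
      Tendsto (fun n : ℕ => averagedCC η G n) atTop (𝓝 (palmCC α μ P))) ∧
    0 < palmCC α μ P := by
  have := hP.isProbabilityMeasure
  obtain ⟨ε, hε, C, hC, hL⟩ := exists_lintegral_longEdges_le μ hd hP hν hμ hτ hα hγ
  have hψ := isLocalScore_localCC
  have hpalm := palmCC_eq_toReal_palmScore (α := α) μ hP
  refine ⟨?_, ?_⟩
  · have hlln := ae_tendsto_sum_sumScore μ hd hP hν hψ hε hC hL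
    have hone := ae_tendsto_sum_sumScore μ hd hP hν isLocalScore_one hε hC hL
    have hfin := ae_finite_neighborSet μ hP hL
    have hall := Measure.ae_ae_of_ae_prod (hlln.and (hone.and hfin))
    filter_upwards [hall, ae_isLocallyFinite hP] with η h hη
    have hmeas : MeasurableSet {G : SimpleGraph ℕ | (∀ x, (G.neighborSet x).Finite) ∧
        Tendsto (fun n : ℕ => averagedCC η G n) atTop (𝓝 (palmCC α μ P))} := by
      refine MeasurableSet.inter ?_ (measurableSet_tendsto _ fun n => measurable_averagedCC hη n)
      have := MeasurableSet.iInter measurableSet_finite_neighborSet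
      rwa [← ofPred_forall] at this
    refine (ae_map_iff (measurable_spatialGraph α η).aemeasurable hmeas).2 ?_
    filter_upwards [h] with ω hω
    obtain ⟨h1, h2, h3⟩ := hω
    refine ⟨h3, ?_⟩
    rw [palmScore_one μ hP, ENNReal.toReal_one, mul_one] at h2
    have hdiv := (tendsto_sumScore_box hψ hη h1).div
      (tendsto_sumScore_box isLocalScore_one hη h2) hν.ne'
    rw [mul_div_cancel_left₀ _ hν.ne', ← hpalm] at hdiv
    refine hdiv.congr' ?_
    filter_upwards [eventually_gt_atTop 0] with n hn
    have hn' : (n : ℝ) ^ d ≠ 0 := by positivity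
    rw [averagedCC_eq_div hη, Pi.div_apply, div_div_div_cancel_right₀ hn']
  · rw [hpalm]
    exact ENNReal.toReal_pos (palmScore_localCC_pos μ hd hP hν hμ hL).ne'
      (ne_top_of_le_ne_top ENNReal.one_ne_top (palmScore_le_one μ hP hψ))
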